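/- **Characteristic function.** Let $n\in\mathbb N$, let $A,B:\mathbb R\to\mathbb R^{n\times n}$ be continuous and $1$-periodic, let $\tau\in[0,1)$, and for each integer $N\ge 1$ let $M_N$ be the time-$1$ map $\varphi\mapsto x(1+\cdot)$ on $C([-\tau-N,0];\mathbb C^n)$ of the linear delay differential equation $\dot x(t)=A(t)x(t)+B(t)x(t-\tau-N)$ with history $x|_{[-\tau-N,0]}=\varphi$. For $s\in\mathbb R$ let $s_{\mathrm{mod}[-1,0]}$ be the representative of $s$ modulo $1$ in $[-1,0)$. Consider the following spectra. * $\mu\in\mathbb C$ is a *Floquet exponent* of $M_N$ if $e^{\mu}$ is an eigenvalue of $M_N$; its algebraic multiplicity is that of the eigenvalue $e^\mu$. * $\Sigma_A$ is the set of all $\mu\in\mathbb C$ for which $\dot y=[A(t)-\mu I]y$, $y(0)=y(-1)$ has a nontrivial solution $y\in C^1([-1,0];\mathbb C^n)$; the algebraic multiplicity of $\mu$ is that of $e^\mu$ as an eigenvalue of the monodromy matrix $y(-1)\mapsto y(0)$ of $\dot y=A(t)y$. Further, $\mathcal A_+=\{\mu\in\Sigma_A:\operatorname{Re}\mu>0\}$.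 * $\mathcal A_c$ is the set of all $\gamma+i\omega$ with $\gamma\in\mathbb R$, $\omega\in[-\pi,\pi)$ such that for some phase $\varphi\in\mathbb R$ the problem $\dot y(t)=[A(t)-i\omega I]y(t)+e^{-\gamma-i\varphi}B(t)\,y((t-\tau)_{\mathrm{mod}[-1,0]})$, $y(0)=y(-1)$ has a nontrivial solution $y\in C^1([-1,0];\mathbb C^n)$. Let $R>0$ and let $k$ be an integer with $k>\max\{\|A\|_\infty+R,\ \|B\|_\infty e^{1+R}\}$, where $\|\cdot\|_\infty$ is the maximum over $t\in[-1,0]$ of the maximal absolute row sum. Put $t_j=-1+j/k$, $I_j=[t_j,t_{j+1})$ for $0\le j\le k-1$, and let $U(t,s,\mu)$ be the propagation matrix of $\dot y=[A(t)-\mu I]y$. Let $D_R=\{(\mu,z)\in\mathbb C^2:\operatorname{Re}\mu\ge -R,\ |z|\le e^R\}$. Then: 1. For all $(\mu,z)\in D_R$ and all $v=(v_0,\dots,v_{k-1})\in\mathbb C^{nk}$ the integral equation $$y(t)=U(t,t_j,\mu)v_j+z\int_{t_j}^tU(t,s,\mu)B(s)\,y\big((s-\tau)_{\mathrm{mod}[-1,0]}\big)\,ds\qquad(t\in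 I_j,\ 0\le j\le k-1)$$ has a unique solution $y$ on $[-1,0]$ that is continuous on each $I_j$, has left limits at $t_1,\dots,t_k=0$, and takes at $0$ its left limit as value. 2. There are a matrix $\Delta(\mu,z)\in\mathbb C^{nk\times nk}$, defined for $(\mu,z)\in D_R$ by $$\Delta(\mu,z)v=\Big(v_0-y(0),\ v_1-\lim_{t\nearrow t_1}y(t),\ \dots,\ v_{k-1}-\lim_{t\nearrow t_{k-1}}y(t)\Big)$$ with the solution $y$ from 1, and a function $h$, holomorphic (in both variables jointly) in a neighbourhood of $D_R$ and not depending on $N$, with $h=\det\Delta$ on $D_R$, such that: * for all integers $N\ge1$ and all $\mu$ with $\operatorname{Re}\mu\ge -R/(N+\tau)$: $\mu$ is a Floquet exponent of $M_N$ if and only if $h(\mu,e^{-(N+\tau)\mu})=0$, and the (finite) algebraic multiplicity of $e^{\mu}$ for $M_N$ equals the order of $\mu$ as a root of $\nu\mapsto h(\nu,e^{-(N+\tau)\nu})$; * for all $\mu$ with $\operatorname{Re}\mu\ge -R$: $\mu\in\Sigma_A$ if and only if $h(\mu,0)=0$, and the algebraic multiplicity of $\mu$ equals the order of $\mu$ as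 a root of $h(\cdot,0)$; * $\mu\in\mathcal A_+$ if and only if $h(\mu,0)=0$ and $\operatorname{Re}\mu>0$; * for all real $\gamma\ge -R$ and $\omega\in[-\pi,\pi)$: $\gamma+i\omega\in\mathcal A_c$ if and only if $h(i\omega,e^{-\gamma-i\varphi})=0$ for some $\varphi\in\mathbb R$. (A multiplicity or order $0$ means not an eigenvalue, respectively not a root.) -/

import Mathlib

open Set Filter Topology
open scoped Matrix NNReal

noncomputable section

namespace LargeDelay

/-! ### Linear initial value problems -/

/-- Existence for linear initial value problems on a compact interval, continuous coefficients. -/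
theorem exists_linear_ode {E : Type*} [NormedAddCommGroup E] [NormedSpace ℝ E] [CompleteSpace E]
    (F : ℝ → E →L[ℝ] E) (hF : Continuous F) (g : ℝ → E) (hg : Continuous g) {a b : ℝ}
    (hab : a ≤ b) (x₀ : E) :
    ∃ x : ℝ → E, x a = x₀ ∧
      ∀ t ∈ Icc a b, HasDerivWithinAt x (F t (x t) + g t) (Icc a b) t := by
  obtain ⟨K, hK⟩ : ∃ K : ℝ, ∀ t ∈ Icc a b, ‖F t‖ ≤ K :=
    isCompact_Icc.exists_bound_of_continuousOn hF.continuousOn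
  have hK0 : 0 ≤ K := (norm_nonneg _).trans (hK a ⟨le_rfl, hab⟩)
  set C : ℝ := 2 * K + 1 with hC
  have hC0 : 0 < C := by positivity
  have : Nonempty (Icc a b) := ⟨⟨a, le_rfl, hab⟩⟩
  let e : ℝ → ℝ := fun s => Real.exp (C * (s - a))
  have he : Continuous e := by fun_prop
  have hepos : ∀ s, 0 < e s := fun s => Real.exp_pos _
  -- the integrand attached to a candidate
  let f : C(Icc a b, E) → ℝ → E := fun w s => F s (e s • IccExtend hab w s) + g s
  have hf : ∀ w, Continuous (f w) := fun w => by
    have h1 : Continuous (IccExtend hab w) := w.continuous.Icc_extend'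
    exact (hF.clm_apply (he.smul h1)).add hg
  let P : C(Icc a b, E) → ℝ → E := fun w t => x₀ + ∫ s in a..t, f w s
  have hP : ∀ w t, HasDerivAt (P w) (f w t) t := fun w t =>
    (intervalIntegral.integral_hasDerivAt_right ((hf w).intervalIntegrable _ _)
      ((hf w).stronglyMeasurableAtFilter _ _) (hf w).continuousAt).const_add x₀
  have hPc : ∀ w, Continuous (P w) := fun w =>
    continuous_iff_continuousAt.2 fun t => (hP w t).continuousAt
  let T : C(Icc a b, E) → C(Icc a b, E) := fun w =>
    ⟨fun t => (e t)⁻¹ • P w t, by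
      have h2 : Continuous fun t : ℝ => (e t)⁻¹ • P w t :=
        (he.inv₀ fun s => (hepos s).ne').smul (hPc w)
      exact h2.comp continuous_subtype_val⟩
  have hT : ContractingWith (1 / 2 : ℝ≥0) T := by
    refine ⟨by norm_num, LipschitzWith.of_dist_le_mul fun w w' => ?_⟩
    have hd : 0 ≤ dist w w' := dist_nonneg
    refine (ContinuousMap.dist_le (by positivity)).2 fun t => ?_
    have ht : a ≤ (t : ℝ) := t.2.1
    have h1 : P w t - P w' t = ∫ s in a..(t : ℝ), (f w s - f w' s) := by
      simp only [P]
      rw [intervalIntegral.integral_sub ((hf w).intervalIntegrable _ _)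
        ((hf w').intervalIntegrable _ _)]
      abel
    have hint : ∫ s in a..(t : ℝ), (K * dist w w') * e s
        = (K * dist w w') * ((e t - 1) / C) := by
      rw [intervalIntegral.integral_const_mul]
      congr 1
      have hder : ∀ s ∈ uIcc a (t : ℝ), HasDerivAt (fun s => e s / C) (e s) s := by
        intro s _
        have h3 : HasDerivAt (fun s : ℝ => C * (s - a)) C s := by
          simpa using ((hasDerivAt_id s).sub_const a).const_mul C
        have h4 := (h3.exp).div_const C
        refine h4.congr_deriv ?_
        simp only [e]
        field_simp
      rw [intervalIntegral.integral_eq_sub_of_hasDerivAt hder (he.intervalIntegrable _ _)]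
      simp [e, sub_div]
    have h2 : ‖P w t - P w' t‖ ≤ (K * dist w w') * ((e t - 1) / C) := by
      rw [h1, ← hint]
      refine intervalIntegral.norm_integral_le_of_norm_le ht ?_
        ((continuous_const.mul he).intervalIntegrable _ _)
      refine Filter.Eventually.of_forall fun s hs => ?_
      have hs' : s ∈ Icc a b := ⟨hs.1.le, hs.2.trans t.2.2⟩
      have h5 : f w s - f w' s = F s (e s • (IccExtend hab w s - IccExtend hab w' s)) := by
        simp only [f, smul_sub, map_sub]
        abel
      rw [h5]
      have h6 : ‖IccExtend hab w s - IccExtend hab w' s‖ ≤ dist w w' := by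
        rw [← dist_eq_norm]
        exact ContinuousMap.dist_apply_le_dist _
      calc ‖F s (e s • (IccExtend hab w s - IccExtend hab w' s))‖
          ≤ ‖F s‖ * ‖e s • (IccExtend hab w s - IccExtend hab w' s)‖ := (F s).le_opNorm _
        _ ≤ K * (e s * dist w w') := by
            rw [norm_smul, Real.norm_of_nonneg (hepos s).le]
            have := hK s hs'
            have := (hepos s).le
            gcongr
        _ = K * dist w w' * e s := by ring
    change dist ((e t)⁻¹ • P w t) ((e t)⁻¹ • P w' t) ≤ _
    rw [dist_eq_norm, ← smul_sub, norm_smul, Real.norm_of_nonneg (inv_nonneg.2 (hepos t).le)]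
    have h7 : (e t)⁻¹ * ‖P w t - P w' t‖ ≤ (e t)⁻¹ * ((K * dist w w') * (e t / C)) := by
      have := (hepos t).le
      refine mul_le_mul_of_nonneg_left (h2.trans ?_) (inv_nonneg.2 this)
      gcongr
      linarith
    refine h7.trans ?_
    have h8 : (e t)⁻¹ * ((K * dist w w') * (e t / C)) = (K / C) * dist w w' := by
      have := (hepos t).ne'
      field_simp
    rw [h8]
    have h9 : K / C ≤ 1 / 2 := by
      rw [div_le_div_iff₀ hC0 two_pos]
      linarith
    simpa using mul_le_mul_of_nonneg_right h9 hd
  obtain ⟨w, hw⟩ : ∃ w, T w = w := ⟨_, hT.fixedPoint_isFixedPt⟩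
  have key : ∀ t ∈ Icc a b, P w t = e t • IccExtend hab w t := by
    intro t ht
    have h1 : (e t)⁻¹ • P w t = w ⟨t, ht⟩ := congrArg (fun u : C(Icc a b, E) => u ⟨t, ht⟩) hw
    rw [IccExtend_of_mem hab w ht, ← h1, smul_smul, mul_inv_cancel₀ (hepos t).ne', one_smul]
  refine ⟨P w, by simp [P], fun t ht => ?_⟩
  have h1 := (hP w t).hasDerivWithinAt (s := Icc a b)
  have h2 : f w t = F t (P w t) + g t := by rw [key t ht]
  rwa [h2] at h1

/-- Uniqueness for linear initial value problems on a compact interval. -/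
theorem unique_linear_ode {E : Type*} [NormedAddCommGroup E] [NormedSpace ℝ E]
    (F : ℝ → E →L[ℝ] E) (hF : Continuous F) (g : ℝ → E) {a b : ℝ} {x y : ℝ → E}
    (hx : ∀ t ∈ Icc a b, HasDerivWithinAt x (F t (x t) + g t) (Icc a b) t)
    (hy : ∀ t ∈ Icc a b, HasDerivWithinAt y (F t (y t) + g t) (Icc a b) t)
    (hxy : x a = y a) : EqOn x y (Icc a b) := by
  obtain ⟨K, hK⟩ : ∃ K : ℝ, ∀ t ∈ Icc a b, ‖F t‖ ≤ K :=
    isCompact_Icc.exists_bound_of_continuousOn hF.continuousOn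
  have hv : ∀ t ∈ Ico a b, LipschitzOnWith K.toNNReal (fun u => F t u + g t) univ := by
    intro t ht
    refine (LipschitzWith.of_dist_le_mul fun u u' => ?_).lipschitzOnWith
    have h1 : ‖F t‖ ≤ K := hK t ⟨ht.1, ht.2.le⟩
    rw [dist_add_right, dist_eq_norm, ← map_sub, dist_eq_norm]
    exact ((F t).le_opNorm _).trans
      (mul_le_mul_of_nonneg_right (h1.trans (Real.le_coe_toNNReal K)) (norm_nonneg _))
  have hr : ∀ {u : ℝ → E},
      (∀ t ∈ Icc a b, HasDerivWithinAt u (F t (u t) + g t) (Icc a b) t) →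
      ∀ t ∈ Ico a b, HasDerivWithinAt u (F t (u t) + g t) (Ici t) t := fun {u} hu t ht =>
    (hu t ⟨ht.1, ht.2.le⟩).mono_of_mem_nhdsWithin (Icc_mem_nhdsGE_of_mem ht)
  exact ODE_solution_unique_of_mem_Icc_right hv
    (fun t ht => (hx t ht).continuousWithinAt) (hr hx) (fun _ _ => mem_univ _)
    (fun t ht => (hy t ht).continuousWithinAt) (hr hy) (fun _ _ => mem_univ _) hxy

/-! ### The linear delay equation -/

/-- The data of the linear periodic delay differential equations
`x'(t) = A(t) x(t) + B(t) x(t - τ - N)`, `N = 1, 2, …`: real continuous `1`-periodic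
`n × n` coefficient matrices and the delay `τ ∈ [0, 1)`. -/
structure PeriodicDDE (n : ℕ) where
  A : ℝ → Matrix (Fin n) (Fin n) ℝ
  B : ℝ → Matrix (Fin n) (Fin n) ℝ
  τ : ℝ
  continuous_A : Continuous A
  continuous_B : Continuous B
  periodic_A : Function.Periodic A 1
  periodic_B : Function.Periodic B 1
  τ_mem : τ ∈ Ico (0 : ℝ) 1

namespace PeriodicDDE

variable {n : ℕ} (D : PeriodicDDE n)

/-- `A(t)` acting on complex vectors. -/
def Ac (t : ℝ) : Matrix (Fin n) (Fin n) ℂ := (D.A t).map Complex.ofReal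

/-- `B(t)` acting on complex vectors. -/
def Bc (t : ℝ) : Matrix (Fin n) (Fin n) ℂ := (D.B t).map Complex.ofReal

theorem continuous_Ac : Continuous D.Ac := D.continuous_A.matrix_map Complex.continuous_ofReal

theorem continuous_Bc : Continuous D.Bc := D.continuous_B.matrix_map Complex.continuous_ofReal

/-- The vector field `v ↦ [A(t) - μ I] v` as a continuous real-linear map. -/
def field (μ : ℂ) (t : ℝ) : (Fin n → ℂ) →L[ℝ] (Fin n → ℂ) :=
  LinearMap.toContinuousLinearMap ((Matrix.mulVecLin (D.Ac t - μ • 1)).restrictScalars ℝ)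

theorem field_apply (μ : ℂ) (t : ℝ) (v : Fin n → ℂ) :
    D.field μ t v = D.Ac t *ᵥ v - μ • v := by
  change (D.Ac t - μ • 1) *ᵥ v = _
  rw [Matrix.sub_mulVec, Matrix.smul_mulVec, Matrix.one_mulVec]

theorem continuous_field (μ : ℂ) : Continuous (D.field μ) := by
  rw [continuous_clm_apply]
  intro v
  simp only [field_apply]
  exact (D.continuous_Ac.matrix_mulVec continuous_const).sub continuous_const

/-- `y` solves `y'(r) = [A(r) - μ I] y(r)` for all `r ∈ [s, t]`. -/
def IsODESolution (μ : ℂ) (s t : ℝ) (y : ℝ → Fin n → ℂ) : Prop :=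
  ∀ r ∈ Icc s t, HasDerivWithinAt y (D.Ac r *ᵥ y r - μ • y r) (Icc s t) r

theorem existsUnique_propagator (μ : ℂ) {s t : ℝ} (hst : s ≤ t) :
    ∃! U : (Fin n → ℂ) →ₗ[ℂ] (Fin n → ℂ),
      ∀ y : ℝ → Fin n → ℂ, D.IsODESolution μ s t y → U (y s) = y t := by
  have hiff : ∀ y : ℝ → Fin n → ℂ, D.IsODESolution μ s t y ↔
      ∀ r ∈ Icc s t, HasDerivWithinAt y (D.field μ r (y r) + 0) (Icc s t) r := by
    intro y
    simp only [IsODESolution, field_apply, add_zero]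
  have hex : ∀ v, ∃ y, y s = v ∧ D.IsODESolution μ s t y := by
    intro v
    obtain ⟨y, h1, h2⟩ := exists_linear_ode (D.field μ) (D.continuous_field μ) (fun _ => 0)
      continuous_const hst v
    exact ⟨y, h1, (hiff y).2 h2⟩
  have huniq : ∀ x y, D.IsODESolution μ s t x → D.IsODESolution μ s t y → x s = y s →
      x t = y t := fun x y hx hy h =>
    unique_linear_ode (D.field μ) (D.continuous_field μ) (fun _ => 0) ((hiff x).1 hx)
      ((hiff y).1 hy) h ⟨hst, le_rfl⟩
  choose Y hY0 hY using hex
  refine ⟨⟨⟨fun v => Y v t, fun v w => ?_⟩, fun c v => ?_⟩, fun y hy => ?_, fun U hU => ?_⟩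
  · refine huniq _ (fun r => Y v r + Y w r) (hY _) (fun r hr => ?_) (by simp [hY0])
    refine ((hY v r hr).add (hY w r hr)).congr_deriv ?_
    rw [Matrix.mulVec_add, smul_add]
    abel
  · refine huniq _ (fun r => c • Y v r) (hY _) (fun r hr => ?_) (by simp [hY0])
    refine ((hY v r hr).const_smul c).congr_deriv ?_
    rw [Matrix.mulVec_smul, smul_sub, smul_comm]
  · exact huniq _ _ (hY _) hy (hY0 _)
  · refine LinearMap.ext fun v => ?_
    have := hU (Y v) (hY v)
    rw [hY0] at this
    exact this

/-- The propagation matrix `U(t, s, μ)`, `s ≤ t`, of `y' = [A(r) - μ I] y`: the linear map sending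
`y(s)` to `y(t)` for every solution `y` on `[s, t]` (it is used for `s ≤ t` only). -/
def propagator (μ : ℂ) (t s : ℝ) : (Fin n → ℂ) →ₗ[ℂ] (Fin n → ℂ) :=
  open Classical in
  if hst : s ≤ t then (D.existsUnique_propagator μ hst).choose else 0

/-- `x` solves the delay equation `x'(t) = A(t) x(t) + B(t) x(t - d)` on `[0, 1]` with
history `φ` on `[-d, 0]`. -/
structure IsDDESolution (d : ℝ) (φ : C(Icc (-d) 0, Fin n → ℂ)) (x : ℝ → Fin n → ℂ) : Prop where
  history : ∀ θ : Icc (-d) 0, x θ = φ θ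
  eqn : ∀ t ∈ Icc (0 : ℝ) 1,
    HasDerivWithinAt x (D.Ac t *ᵥ x t + D.Bc t *ᵥ x (t - d)) (Icc 0 1) t

theorem existsUnique_timeOneMap {d : ℝ} (hd : 1 ≤ d) :
    ∃! M : Module.End ℂ C(Icc (-d) 0, Fin n → ℂ),
      ∀ φ x, D.IsDDESolution d φ x → ∀ θ : Icc (-d) 0, M φ θ = x (θ + 1) := by
  have hd0 : -d ≤ 0 := by linarith
  let H : C(Icc (-d) 0, Fin n → ℂ) → ℝ → Fin n → ℂ := fun φ t =>
    D.Bc t *ᵥ IccExtend hd0 φ (t - d)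
  have hH : ∀ φ, Continuous (H φ) := fun φ =>
    D.continuous_Bc.matrix_mulVec
      ((φ.continuous.Icc_extend' (h := hd0)).comp (continuous_id.sub continuous_const))
  have hmem : ∀ {t : ℝ}, t ∈ Icc (0 : ℝ) 1 → t - d ∈ Icc (-d) 0 := fun {t} ht =>
    ⟨by linarith [ht.1], by linarith [ht.2]⟩
  have hpast : ∀ φ x, D.IsDDESolution d φ x → ∀ t ∈ Icc (0 : ℝ) 1,
      D.Bc t *ᵥ x (t - d) = H φ t := by
    intro φ x hx t ht
    simp only [H]
    rw [IccExtend_of_mem hd0 φ (hmem ht), ← hx.history ⟨t - d, hmem ht⟩]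
  have hode : ∀ φ x, D.IsDDESolution d φ x → ∀ t ∈ Icc (0 : ℝ) 1,
      HasDerivWithinAt x (D.field 0 t (x t) + H φ t) (Icc 0 1) t := by
    intro φ x hx t ht
    have h1 := hx.eqn t ht
    rw [hpast φ x hx t ht] at h1
    simpa [field_apply] using h1
  have huniq : ∀ φ x y, D.IsDDESolution d φ x → D.IsDDESolution d φ y →
      ∀ θ : Icc (-d) 0, x (θ + 1) = y (θ + 1) := by
    intro φ x y hx hy θ
    have h0 : x 0 = y 0 :=
      (hx.history ⟨0, hd0, le_rfl⟩).trans (hy.history ⟨0, hd0, le_rfl⟩).symm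
    rcases le_total (θ : ℝ) (-1) with h | h
    · have hm : (θ : ℝ) + 1 ∈ Icc (-d) 0 := ⟨by linarith [θ.2.1], by linarith⟩
      exact (hx.history ⟨_, hm⟩).trans (hy.history ⟨_, hm⟩).symm
    · exact unique_linear_ode (D.field 0) (D.continuous_field 0) (H φ) (hode φ x hx)
        (hode φ y hy) h0 ⟨by linarith, by linarith [θ.2.2]⟩
  have hex : ∀ φ, ∃ x, D.IsDDESolution d φ x ∧ Continuous fun θ : Icc (-d) 0 => x (θ + 1) := by
    intro φ
    obtain ⟨u, hu0, hu⟩ := exists_linear_ode (D.field 0) (D.continuous_field 0) (H φ) (hH φ)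
      zero_le_one (φ ⟨0, hd0, le_rfl⟩)
    have huc : ContinuousOn u (Icc 0 1) := fun t ht => (hu t ht).continuousWithinAt
    let x : ℝ → Fin n → ℂ := fun t => if t ≤ 0 then IccExtend hd0 φ t else u t
    have hx1 : ∀ t ∈ Icc (0 : ℝ) 1, x t = u t := by
      intro t ht
      rcases eq_or_lt_of_le ht.1 with h | h
      · subst h
        simp only [x, le_refl, if_true]
        rw [hu0, IccExtend_of_mem hd0 φ ⟨hd0, le_rfl⟩]
      · simp [x, not_le.2 h]
    have hx0 : ∀ θ : Icc (-d) 0, x θ = φ θ := by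
      intro θ
      simp only [x, θ.2.2, if_true]
      exact IccExtend_of_mem hd0 φ θ.2
    refine ⟨x, ⟨hx0, fun t ht => ?_⟩, ?_⟩
    · have h1 := (hu t ht).congr hx1 (hx1 t ht)
      rw [hx0 ⟨t - d, hmem ht⟩, hx1 t ht]
      have h2 : H φ t = D.Bc t *ᵥ φ ⟨t - d, hmem ht⟩ := by
        simp only [H]
        rw [IccExtend_of_mem hd0 φ (hmem ht)]
      rw [h2] at h1
      simpa [field_apply] using h1
    · have hxc : ContinuousOn x (Iic 1) := by
        have h3 : Continuous fun t : ℝ =>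
            if t ≤ 0 then IccExtend hd0 φ t else IccExtend zero_le_one ((Icc (0:ℝ) 1).domRestrict u) t := by
          refine Continuous.if_le (φ.continuous.Icc_extend' (h := hd0))
            (huc.domRestrict.Icc_extend') continuous_id continuous_const ?_
          intro t ht
          subst ht
          rw [IccExtend_of_mem hd0 φ ⟨hd0, le_rfl⟩,
            IccExtend_of_mem zero_le_one _ ⟨le_rfl, zero_le_one⟩]
          exact hu0.symm
        refine h3.continuousOn.congr fun t ht => ?_
        rcases le_or_gt t 0 with h | h
        · simp [x, h]
        · simp only [x, not_le.2 h, if_false]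
          rw [IccExtend_of_mem zero_le_one _ ⟨h.le, ht⟩]
          rfl
      refine hxc.comp_continuous (by fun_prop) fun θ => ?_
      have := θ.2.2
      simp only [mem_Iic]
      linarith
  choose X hX hXc using hex
  refine ⟨⟨⟨fun φ => ⟨fun θ => X φ (θ + 1), hXc φ⟩, fun φ ψ => ?_⟩, fun c φ => ?_⟩,
    fun φ x hx θ => ?_, fun M hM => ?_⟩
  · ext1 θ
    refine huniq (φ + ψ) _ (fun t => X φ t + X ψ t) (hX _) ⟨fun θ => ?_, fun t ht => ?_⟩ θ
    · simp [(hX φ).history, (hX ψ).history]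
    · refine (((hX φ).eqn t ht).add ((hX ψ).eqn t ht)).congr_deriv ?_
      rw [Matrix.mulVec_add, Matrix.mulVec_add]
      abel
  · ext1 θ
    refine huniq (c • φ) _ (fun t => c • X φ t) (hX _) ⟨fun θ => ?_, fun t ht => ?_⟩ θ
    · simp [(hX φ).history]
    · refine (((hX φ).eqn t ht).const_smul c).congr_deriv ?_
      rw [Matrix.mulVec_smul, Matrix.mulVec_smul, smul_add]
  · exact huniq φ _ x (hX φ) hx θ
  · ext1 φ
    ext1 θ
    exact hM φ (X φ) (hX φ) θ

/-- The time-`1` map `φ ↦ x(1 + ·)` on `C([-d, 0]; ℂⁿ)` of the delay equation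
`x'(t) = A(t) x(t) + B(t) x(t - d)`, for a delay `d ≥ 1`. -/
def timeOneMap {d : ℝ} (hd : 1 ≤ d) : Module.End ℂ C(Icc (-d) 0, Fin n → ℂ) :=
  (D.existsUnique_timeOneMap hd).choose

theorem one_le_delay {N : ℕ} (hN : 1 ≤ N) : 1 ≤ (N : ℝ) + D.τ := by
  have h1 : (1 : ℝ) ≤ N := by exact_mod_cast hN
  linarith [D.τ_mem.1]

/-- The map `M_N` on `C([-τ-N, 0]; ℂⁿ)`. -/
def monodromy {N : ℕ} (hN : 1 ≤ N) : Module.End ℂ C(Icc (-((N : ℝ) + D.τ)) 0, Fin n → ℂ) :=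
  D.timeOneMap (D.one_le_delay hN)

/-- `μ` is a Floquet exponent of `M_N`. -/
def IsFloquetExponent {N : ℕ} (hN : 1 ≤ N) (μ : ℂ) : Prop :=
  (D.monodromy hN).HasEigenvalue (Complex.exp μ)

/-! ### Asymptotic spectra -/

/-- `s ↦ s_{mod [-1, 0]}`: the representative of `s` modulo `1` in `[-1, 0)`. -/
def pmod (s : ℝ) : ℝ := Int.fract s - 1

/-- The instantaneous spectrum `Σ_A`. -/
def instantaneousSpectrum : Set ℂ :=
  {μ | ∃ y : ℝ → Fin n → ℂ, ContDiffOn ℝ 1 y (Icc (-1) 0) ∧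
    (∀ t ∈ Icc (-1 : ℝ) 0,
      HasDerivWithinAt y (D.Ac t *ᵥ y t - μ • y t) (Icc (-1) 0) t) ∧
    y 0 = y (-1) ∧ ∃ t ∈ Icc (-1 : ℝ) 0, y t ≠ 0}

/-- The strongly unstable asymptotic spectrum `𝒜₊`. -/
def stronglyUnstableSpectrum : Set ℂ := {μ | μ ∈ D.instantaneousSpectrum ∧ 0 < μ.re}

/-- The asymptotic continuous spectrum `𝒜_c`: the numbers `γ + i ω` with `ω ∈ [-π, π)` such that
for some phase `ϕ` the periodic boundary value problem
`y'(t) = [A(t) - i ω] y(t) + exp(-γ - i ϕ) B(t) y((t - τ)_{mod [-1, 0]})`, `y(0) = y(-1)`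
has a nontrivial `C¹` solution. -/
def asymptoticContinuousSpectrum : Set ℂ :=
  {c | c.im ∈ Ico (-Real.pi) Real.pi ∧ ∃ ϕ : ℝ, ∃ y : ℝ → Fin n → ℂ,
    ContDiffOn ℝ 1 y (Icc (-1) 0) ∧
    (∀ t ∈ Icc (-1 : ℝ) 0,
      HasDerivWithinAt y (D.Ac t *ᵥ y t - (Complex.I * c.im) • y t
        + Complex.exp (-c.re - Complex.I * ϕ) • (D.Bc t *ᵥ y (pmod (t - D.τ)))) (Icc (-1) 0) t) ∧
    y 0 = y (-1) ∧ ∃ t ∈ Icc (-1 : ℝ) 0, y t ≠ 0}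

/-! ### The characteristic matrix -/

/-- `‖M‖_∞ = max_{t ∈ [-1, 0]} ‖M(t)‖_∞`, with the maximal absolute row sum as matrix norm. -/
def supNorm (M : ℝ → Matrix (Fin n) (Fin n) ℝ) : ℝ :=
  ⨆ t : Icc (-1 : ℝ) 0, ((Finset.univ.sup fun i => ∑ j, ‖M t i j‖₊ : ℝ≥0) : ℝ)

/-- The bound `C(R)` for the number of subintervals. -/
def subdivisionBound (R : ℝ) : ℝ :=
  max (supNorm D.A + R) (supNorm D.B * Real.exp (1 + R))

/-- The nodes `t_j = -1 + j / k`. -/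
def node (k j : ℕ) : ℝ := -1 + j / k

/-- `y` is piecewise continuous (with left limits at `t_1, …, t_k`) on `[-1, 0]` and solves the
integral equation `y(t) = U(t, t_j, μ) v_j + z ∫_{t_j}^t U(t, s, μ) B(s) y((s-τ)_{mod [-1,0]}) ds`
for `t ∈ [t_j, t_{j+1})`, `j = 0, …, k - 1`; at the end point `0` its value is its left limit. -/
structure IsShootingSolution (k : ℕ) (μ z : ℂ) (v : Fin k → Fin n → ℂ) (y : ℝ → Fin n → ℂ) :
    Prop where
  continuousOn : ∀ j : Fin k, ContinuousOn y (Ico (node k j) (node k (j + 1)))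
  left_limit : ∀ j : Fin k, ∃ l, Tendsto y (𝓝[<] (node k (j + 1))) (𝓝 l)
  end_value : Tendsto y (𝓝[<] 0) (𝓝 (y 0))
  eqn : ∀ j : Fin k, ∀ t ∈ Ico (node k j) (node k (j + 1)),
    y t = D.propagator μ t (node k j) (v j)
      + z • ∫ s in (node k j)..t, D.propagator μ t s (D.Bc s *ᵥ y (pmod (s - D.τ)))

/-- `Δ` is the characteristic matrix at `(μ, z)`: it maps `v = (v_0, …, v_{k-1})` to the tuple with
entries `v_0 - y(0)` and `v_j - lim_{t ↗ t_j} y(t)`, `1 ≤ j ≤ k - 1`, for the solution `y` of the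
integral equation with data `v`. -/
def IsCharacteristicMatrix (k : ℕ) (μ z : ℂ)
    (Δ : Matrix (Fin k × Fin n) (Fin k × Fin n) ℂ) : Prop :=
  ∀ (v : Fin k → Fin n → ℂ) (y : ℝ → Fin n → ℂ), D.IsShootingSolution k μ z v y →
    ∀ (j : Fin k) (i : Fin n),
      (Δ *ᵥ fun p => v p.1 p.2) (j, i)
        = v j i - (if (j : ℕ) = 0 then y 0 else Function.leftLim y (node k j)) i

end PeriodicDDE

end LargeDelay

end

/-! Substituting x(t) = e^{μt} y(t) turns the integral equation into one for x' = A x + delay term,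
in which (μ, z) enters only through three scalars: the weight p = z e^{μτ} of lags s - τ that stay
in [-1, 0), the weight q = z e^{μ(τ-1)} of lags that cross -1, and the factor c = e^{-μ} with which
the end value at 0 is fed back to -1. With fixed bounded operators S = `initial`, J₁ =
`volterraNear`, J₂ = `volterraFar`, E₀ = `endInner`, E₁ = `endOuter`, the characteristic operator is
`charOp` p q c = I - (E₀ + c E₁)(I - p J₁ - q J₂)⁻¹ S, and h is its determinant. Conjugating p J₁ +
q J₂ back by e^{μt} gives an operator of norm at most ‖B‖ e^{1+R}/k < 1 on D_R (`isUnit_pencil`).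
This yields unique solvability, and holomorphy because inversion is analytic.

A kernel vector of Δ(μ, z) amounts to a nontrivial C¹ solution of the periodic boundary value
problem (`charFun_eq_zero_iff`). The choices z = 0 and (μ, z) = (iω, e^{-γ-iφ}) give Σ_A and 𝒜_c.

For the multiplicities put λ = e^μ. On the curve z = e^{-(N+τ)μ} the scalars become p = λ^{-N}, q =
λ^{-N-1}, c = λ^{-1}. A Jordan chain ξ₀, ξ₁, … at λ₀ is read as the principal part Σ
ξ_i/(λ-λ₀)^{i+1}, on which M_N acts as multiplication by λ; analytic operator germs act on principal
parts compatibly with composition (`germAction_comp`). Outside the newest period M_N is a shift, so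
going back one period is division by λ, and the delay equation becomes the equation of the pencil I
- λ^{-N} J₁ - λ^{-N-1} J₂. Taking values at the nodes thus maps chains bijectively onto the kernel
of the germ of `charOp` (`rank_maxGenEigenspace_monodromy`), and that kernel has dimension equal to
the order of the determinant (`rank_ker_germAction`). The monodromy matrix of y' = A y is treated in
the same way with p = q = 0.

The order is finite because, in the variable ζ = e^{-μ}, the determinant is analytic on a closed
disc around 0. At ζ = 0 the periods decouple and it does not vanish (`det_charOp_zero_ne_zero`), so
the identity theorem applies. The local biholomorphisms ζ = e^{-μ} and ζ = 1/λ transport the order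
(`exists_analyticOrderAt_eq`). -/

noncomputable section

namespace LargeDelay

set_option linter.unusedSectionVars false

/-! ### Analytic germs acting on principal parts -/

section Germ

variable {F G H : Type*} [NormedAddCommGroup F] [NormedSpace ℂ F] [NormedAddCommGroup G]
  [NormedSpace ℂ G] [NormedAddCommGroup H] [NormedSpace ℂ H]

theorem analyticAt_dslope {f : ℂ → F} {c : ℂ} (hf : AnalyticAt ℂ f c) :
    AnalyticAt ℂ (dslope f c) c := by
  obtain ⟨p, hp⟩ := hf
  exact ⟨_, hp.has_fpower_series_dslope_fslope⟩

theorem analyticAt_clm_comp {W : Type*} [NormedAddCommGroup W] [NormedSpace ℂ W]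
    {f : W → G →L[ℂ] H} {g : W → F →L[ℂ] G} {c : W}
    (hf : AnalyticAt ℂ f c) (hg : AnalyticAt ℂ g c) :
    AnalyticAt ℂ (fun z => (f z).comp (g z)) c :=
  ((ContinuousLinearMap.compL ℂ F G H).analyticAt_bilinear (f c, g c)).comp₂ hf hg

theorem dslope_congr {f g : ℂ → F} {c : ℂ} (h : f =ᶠ[𝓝 c] g) :
    dslope f c =ᶠ[𝓝 c] dslope g c := by
  have h0 : f c = g c := h.self_of_nhds
  filter_upwards [h] with z hz
  rcases eq_or_ne z c with rfl | hne
  · rw [dslope_same, dslope_same, h.deriv_eq]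
  · rw [dslope_of_ne _ hne, dslope_of_ne _ hne, slope_def_module, slope_def_module, hz, h0]

theorem dslope_add {f g : ℂ → F} {c : ℂ} (hf : AnalyticAt ℂ f c) (hg : AnalyticAt ℂ g c) :
    dslope (fun z => f z + g z) c = fun z => dslope f c z + dslope g c z := by
  funext z
  rcases eq_or_ne z c with rfl | hne
  · simp only [dslope_same]
    exact deriv_fun_add hf.differentiableAt hg.differentiableAt
  · simp only [dslope_of_ne _ hne, slope_def_module]
    rw [← smul_add]
    congr 1
    abel

/-- Splits f(z)g(z) - f(c)g(c) as (f(z) - f(c))g(z) + f(c)(g(z) - g(c)). Freezing f at c in the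
second summand is what lets the induction for the Cauchy product close. -/
theorem dslope_clm_comp {f : ℂ → G →L[ℂ] H} {g : ℂ → F →L[ℂ] G} {c : ℂ} (hf : AnalyticAt ℂ f c)
    (hg : AnalyticAt ℂ g c) :
    dslope (fun z => (f z).comp (g z)) c =
      fun z => (dslope f c z).comp (g z) + (f c).comp (dslope g c z) := by
  funext z
  rcases eq_or_ne z c with rfl | hne
  · simp only [dslope_same]
    exact (hf.differentiableAt.hasDerivAt.clm_comp hg.differentiableAt.hasDerivAt).deriv
  · simp only [dslope_of_ne _ hne, slope_def_module]
    ext x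
    simp only [_root_.smul_apply, _root_.sub_apply,
      ContinuousLinearMap.comp_apply, _root_.add_apply, map_smul, map_sub]
    rw [← smul_add]
    congr 1
    abel

/-- The `n`-th Taylor coefficient of `f` at `c`. -/
def taylorCoeff (c : ℂ) (f : ℂ → F) (n : ℕ) : F := (fun g : ℂ → F => dslope g c)^[n] f c

@[simp] theorem taylorCoeff_zero (c : ℂ) (f : ℂ → F) : taylorCoeff c f 0 = f c := rfl

theorem taylorCoeff_succ (c : ℂ) (f : ℂ → F) (n : ℕ) :
    taylorCoeff c f (n + 1) = taylorCoeff c (dslope f c) n := rfl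

theorem taylorCoeff_congr {c : ℂ} {f g : ℂ → F} (h : f =ᶠ[𝓝 c] g) (n : ℕ) :
    taylorCoeff c f n = taylorCoeff c g n := by
  induction n generalizing f g with
  | zero => exact h.self_of_nhds
  | succ n ih => exact ih (dslope_congr h)

theorem taylorCoeff_add {c : ℂ} {f g : ℂ → F} (hf : AnalyticAt ℂ f c) (hg : AnalyticAt ℂ g c)
    (n : ℕ) :
    taylorCoeff c (fun z => f z + g z) n = taylorCoeff c f n + taylorCoeff c g n := by
  induction n generalizing f g with
  | zero => rfl
  | succ n ih =>
    rw [taylorCoeff_succ, dslope_add hf hg, ih (analyticAt_dslope hf) (analyticAt_dslope hg)]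
    rfl

theorem dslope_const_fun (c : ℂ) (a : F) : dslope (fun _ : ℂ => a) c = fun _ => 0 := by
  funext z
  rcases eq_or_ne z c with rfl | hne
  · simp
  · simp [dslope_of_ne _ hne, slope_def_module]

theorem taylorCoeff_zero_fun (c : ℂ) (n : ℕ) : taylorCoeff c (fun _ : ℂ => (0 : F)) n = 0 := by
  induction n with
  | zero => rfl
  | succ n ih => rw [taylorCoeff_succ, dslope_const_fun, ih]

theorem taylorCoeff_const_succ (c : ℂ) (a : F) (n : ℕ) :
    taylorCoeff c (fun _ : ℂ => a) (n + 1) = 0 := by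
  rw [taylorCoeff_succ, dslope_const_fun, taylorCoeff_zero_fun]

/-- Cauchy product. The summand with the constant germ f(c) supplies exactly the new antidiagonal
term with first index 0. -/
theorem taylorCoeff_clm_comp {c : ℂ} {f : ℂ → G →L[ℂ] H} {g : ℂ → F →L[ℂ] G}
    (hf : AnalyticAt ℂ f c) (hg : AnalyticAt ℂ g c) (n : ℕ) :
    taylorCoeff c (fun z => (f z).comp (g z)) n =
      ∑ p ∈ Finset.HasAntidiagonal.antidiagonal n, (taylorCoeff c f p.1).comp (taylorCoeff c g p.2) := by
  induction n generalizing f g with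
  | zero => simp
  | succ n ih =>
    have hf' := analyticAt_dslope hf
    have hg' := analyticAt_dslope hg
    have hc : AnalyticAt ℂ (fun _ : ℂ => f c) c := analyticAt_const
    rw [taylorCoeff_succ, dslope_clm_comp hf hg,
      taylorCoeff_add (analyticAt_clm_comp hf' hg) (analyticAt_clm_comp hc hg'), ih hf' hg, ih hc hg',
      Finset.Nat.antidiagonal_succ, Finset.sum_cons, add_comm]
    congr 1
    · rw [Finset.sum_eq_single (0, n)]
      · rfl
      · rintro ⟨i, j⟩ hp hne
        rcases i with _ | i
        · simp only [Finset.HasAntidiagonal.mem_antidiagonal, zero_add] at hp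
          exact absurd (by rw [hp]) hne
        · rw [taylorCoeff_const_succ, ContinuousLinearMap.zero_comp]
      · simp
    · simp [taylorCoeff_succ]

/-- The action of the germ at `c` of an operator-valued function on principal parts
`∑ i, y i / (z - c) ^ (i + 1)`. -/
def germAction (c : ℂ) (f : ℂ → F →L[ℂ] G) : (ℕ →₀ F) →ₗ[ℂ] (ℕ →₀ G) :=
  Finsupp.lsum ℂ fun k => ∑ p ∈ Finset.HasAntidiagonal.antidiagonal k,
    Finsupp.lsingle p.2 ∘ₗ ((taylorCoeff c f p.1 : F →L[ℂ] G) : F →ₗ[ℂ] G)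

theorem germAction_single (c : ℂ) (f : ℂ → F →L[ℂ] G) (k : ℕ) (y : F) :
    germAction c f (Finsupp.single k y) =
      ∑ p ∈ Finset.HasAntidiagonal.antidiagonal k, Finsupp.single p.2 (taylorCoeff c f p.1 y) := by
  simp [germAction]

theorem germAction_congr {c : ℂ} {f g : ℂ → F →L[ℂ] G} (h : f =ᶠ[𝓝 c] g) :
    germAction c f = germAction c g := by
  simp only [germAction, taylorCoeff_congr h]

theorem germAction_add {c : ℂ} {f g : ℂ → F →L[ℂ] G} (hf : AnalyticAt ℂ f c)
    (hg : AnalyticAt ℂ g c) :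
    germAction c (fun z => f z + g z) = germAction c f + germAction c g := by
  refine Finsupp.lhom_ext fun k y => ?_
  simp [germAction_single, taylorCoeff_add hf hg, Finset.sum_add_distrib]

theorem germAction_sub {c : ℂ} {f g : ℂ → F →L[ℂ] G} (hf : AnalyticAt ℂ f c)
    (hg : AnalyticAt ℂ g c) :
    germAction c (fun z => f z - g z) = germAction c f - germAction c g := by
  have h := germAction_add (hf.fun_sub hg) hg
  simp only [sub_add_cancel] at h
  rw [h, add_sub_cancel_right]

/-- Analytic germs map holomorphic parts to holomorphic parts, so discarding them commutes with
composition. In coefficients both sides sum over triples (Taylor order of g, Taylor order of f,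
remaining pole index) with sum k, grouped differently. -/
theorem germAction_comp {c : ℂ} {f : ℂ → G →L[ℂ] H} {g : ℂ → F →L[ℂ] G}
    (hf : AnalyticAt ℂ f c) (hg : AnalyticAt ℂ g c) :
    germAction c (fun z => (f z).comp (g z)) = germAction c f ∘ₗ germAction c g := by
  refine Finsupp.lhom_ext fun k y => ?_
  simp only [LinearMap.comp_apply, germAction_single, map_sum, taylorCoeff_clm_comp hf hg,
    _root_.sum_apply, ContinuousLinearMap.comp_apply, Finsupp.single_finsetSum]
  rw [Finset.sum_sigma', Finset.sum_sigma']
  refine Finset.sum_bij' (fun a _ => ⟨(a.2.2, a.2.1 + a.1.2), (a.2.1, a.1.2)⟩)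
    (fun a _ => ⟨(a.2.1 + a.1.1, a.2.2), (a.2.1, a.1.1)⟩) ?_ ?_ ?_ ?_ ?_ <;>
  simp only [Finset.mem_sigma, Finset.HasAntidiagonal.mem_antidiagonal]
  · rintro ⟨⟨a, b⟩, ⟨d, e⟩⟩ ⟨h1, h2⟩
    dsimp only at h1 h2
    simp only [and_true]
    omega
  · rintro ⟨⟨a, b⟩, ⟨d, e⟩⟩ ⟨h1, h2⟩
    dsimp only at h1 h2
    simp only [and_true]
    omega
  · rintro ⟨⟨a, b⟩, ⟨d, e⟩⟩ ⟨h1, h2⟩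
    dsimp only at h1 h2
    subst h2
    rfl
  · rintro ⟨⟨a, b⟩, ⟨d, e⟩⟩ ⟨h1, h2⟩
    dsimp only at h1 h2
    subst h2
    rfl
  · intros
    trivial

theorem germAction_const (c : ℂ) (T : F →L[ℂ] G) :
    germAction c (fun _ => T) = Finsupp.mapRange.linearMap (T : F →ₗ[ℂ] G) := by
  refine Finsupp.lhom_ext fun k y => ?_
  rw [germAction_single, Finsupp.mapRange.linearMap_apply, Finsupp.mapRange_single,
    Finset.sum_eq_single (0, k)]
  · rfl
  · rintro ⟨i, j⟩ hp hne
    rcases i with _ | i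
    · simp only [Finset.HasAntidiagonal.mem_antidiagonal, zero_add] at hp
      exact absurd (by rw [hp]) hne
    · simp [taylorCoeff_const_succ]
  · simp

theorem germAction_one (c : ℂ) :
    germAction c (fun _ => ContinuousLinearMap.id ℂ F) = LinearMap.id := by
  rw [germAction_const]
  ext; simp

/-- The left shift of finitely supported sequences. -/
def leftShift (F : Type*) [AddCommGroup F] [Module ℂ F] : (ℕ →₀ F) →ₗ[ℂ] (ℕ →₀ F) :=
  Finsupp.lcomapDomain Nat.succ Nat.succ_injective

@[simp] theorem leftShift_apply {F : Type*} [AddCommGroup F] [Module ℂ F] (y : ℕ →₀ F) (i : ℕ) :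
    leftShift F y i = y (i + 1) := rfl

theorem taylorCoeff_sub_smul (c : ℂ) (T : F) (n : ℕ) :
    taylorCoeff c (fun z => (z - c) • T) n = if n = 1 then T else 0 := by
  rcases n with _ | n
  · simp
  · have : dslope (fun z => (z - c) • T) c = fun _ => T := by
      funext z
      rcases eq_or_ne z c with rfl | hne
      · rw [dslope_same]
        have := ((hasDerivAt_id z).sub_const z).smul_const T
        simpa using this.deriv
      · rw [dslope_of_ne _ hne, slope_def_module, sub_self, zero_smul, sub_zero, smul_smul,
          inv_mul_cancel₀ (sub_ne_zero.2 hne), one_smul]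
    rw [taylorCoeff_succ, this]
    rcases n with _ | n
    · simp
    · simp [taylorCoeff_const_succ]

/-- Multiplication by z - c lowers each pole order by one and discards the simple pole. -/
theorem germAction_sub_smul_one (c : ℂ) :
    germAction c (fun z => (z - c) • ContinuousLinearMap.id ℂ F) = leftShift F := by
  refine Finsupp.lhom_ext fun k y => ?_
  rw [germAction_single]
  simp only [taylorCoeff_sub_smul]
  rcases k with _ | k
  · ext i
    simp [leftShift_apply]
  · rw [Finset.sum_eq_single (1, k)]
    · ext i
      simp [leftShift_apply, Finsupp.single_apply]
    · rintro ⟨i, j⟩ hp hne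
      simp only [Finset.HasAntidiagonal.mem_antidiagonal] at hp
      have : i ≠ 1 := by
        rintro rfl
        apply hne
        congr 1
        omega
      simp [this]
    · intro h
      simp [add_comm] at h

theorem germAction_smul_one (c : ℂ) :
    germAction c (fun z => z • ContinuousLinearMap.id ℂ F) = c • LinearMap.id + leftShift F := by
  have h1 : AnalyticAt ℂ (fun _ : ℂ => c • ContinuousLinearMap.id ℂ F) c := analyticAt_const
  have h2 : AnalyticAt ℂ (fun z : ℂ => (z - c) • ContinuousLinearMap.id ℂ F) c := by fun_prop
  have := germAction_add h1 h2
  simp only [← add_smul, add_sub_cancel] at this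
  rw [this, germAction_sub_smul_one, germAction_const]
  rfl

end Germ

end LargeDelay
end

noncomputable section

namespace LargeDelay

set_option linter.unusedSectionVars false

/-! ### Multiplicities of analytic matrix functions -/

/-- Additivity of kernel dimension along a factorisation. It is phrased with cardinals because
sequence spaces are infinite-dimensional. -/
theorem rank_ker_comp_of_surjective {F G H : Type} [AddCommGroup F] [Module ℂ F]
    [AddCommGroup G] [Module ℂ G] [AddCommGroup H] [Module ℂ H] (S : G →ₗ[ℂ] H) (T : F →ₗ[ℂ] G)
    (hT : Function.Surjective T) :
    Module.rank ℂ (LinearMap.ker (S ∘ₗ T)) =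
      Module.rank ℂ (LinearMap.ker S) + Module.rank ℂ (LinearMap.ker T) := by
  let f : LinearMap.ker (S ∘ₗ T) →ₗ[ℂ] LinearMap.ker S :=
    (T.domRestrict (LinearMap.ker (S ∘ₗ T))).codRestrict (LinearMap.ker S) fun x => x.2
  have hf : Function.Surjective f := by
    rintro ⟨y, hy⟩
    obtain ⟨x, rfl⟩ := hT y
    exact ⟨⟨x, hy⟩, rfl⟩
  have hle : LinearMap.ker T ≤ LinearMap.ker (S ∘ₗ T) := LinearMap.ker_le_ker_comp T S
  have hker : LinearMap.ker f = (LinearMap.ker T).comap (LinearMap.ker (S ∘ₗ T)).subtype := by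
    ext x
    exact ⟨fun h => congrArg Subtype.val h, fun h => Subtype.ext h⟩
  rw [← LinearMap.rank_range_add_rank_ker f, rank_range_of_surjective f hf, hker,
    (Submodule.comapSubtypeEquivOfLe hle).rank_eq]

section Det

variable {V : Type} [NormedAddCommGroup V] [NormedSpace ℂ V] [FiniteDimensional ℂ V]

theorem analyticAt_det {W : Type*} [NormedAddCommGroup W] [NormedSpace ℂ W] {f : W → V →L[ℂ] V}
    {w : W} (hf : AnalyticAt ℂ f w) : AnalyticAt ℂ (fun x => (f x).det) w := by
  let b := Module.finBasis ℂ V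
  have h1 : (fun x => (f x).det) = fun x => (LinearMap.toMatrix b b (f x : V →ₗ[ℂ] V)).det := by
    funext x
    rw [LinearMap.det_toMatrix]
  rw [h1]
  simp only [Matrix.det_apply']
  refine Finset.analyticAt_fun_sum _ fun σ _ => ?_
  refine analyticAt_const.mul (Finset.analyticAt_fun_prod _ fun i _ => ?_)
  simp only [LinearMap.toMatrix_apply]
  let φ : (V →L[ℂ] V) →L[ℂ] ℂ :=
    (LinearMap.toContinuousLinearMap (b.coord (σ i))).comp (ContinuousLinearMap.apply ℂ V (b i))
  exact (φ.analyticAt _).comp hf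

/-- The pointwise inverse is analytic near c, and its action is a left inverse. -/
theorem germAction_ker_eq_bot {Δ : ℂ → V →L[ℂ] V} {c : ℂ} (hΔ : AnalyticAt ℂ Δ c)
    (h : IsUnit (Δ c)) : LinearMap.ker (germAction c Δ) = ⊥ := by
  have hinv : AnalyticAt ℂ (fun z => Ring.inverse (Δ z)) c := by
    have := analyticAt_inverse (𝕜 := ℂ) h.unit
    exact AnalyticAt.comp (g := Ring.inverse) (f := Δ) (by simpa using this) hΔ
  have hcomp := germAction_comp hinv hΔ
  have hev : (fun z => (Ring.inverse (Δ z)).comp (Δ z)) =ᶠ[𝓝 c]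
      fun _ => ContinuousLinearMap.id ℂ V := by
    filter_upwards [hΔ.continuousAt.eventually (Units.isOpen.mem_nhds h)] with z hz
    exact Ring.inverse_mul_cancel _ hz
  rw [germAction_congr hev, germAction_one] at hcomp
  refine LinearMap.ker_eq_bot'.2 fun y hy => ?_
  have := LinearMap.congr_fun hcomp y
  simpa [hy] using this

theorem isUnit_of_det_ne_zero {T : V →L[ℂ] V} (h : T.det ≠ 0) : IsUnit T := by
  refine (ContinuousLinearMap.isUnit_iff_bijective).2 ?_
  have h1 : IsUnit (T : V →ₗ[ℂ] V) := (LinearMap.isUnit_iff_isUnit_det _).2 (Ne.isUnit h)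
  exact (Module.End.isUnit_iff _).1 h1

/-- Take v in the kernel of Δ(c) and the rank-one projection P = l(·)v. Since Δ(z)v = (z -
c)·`dslope Δ c z` v, the factor z - c can be split off on the line of v: Δ' is Δ on ker P and the
divided difference on the range of P. -/
theorem exists_factor_of_det_eq_zero {Δ : ℂ → V →L[ℂ] V} {c : ℂ} (hΔ : AnalyticAt ℂ Δ c)
    (h : (Δ c).det = 0) :
    ∃ (Δ' : ℂ → V →L[ℂ] V) (v : V) (l : V →L[ℂ] ℂ), AnalyticAt ℂ Δ' c ∧ l v = 1 ∧
      ∀ z, Δ z = (Δ' z).comp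
        (ContinuousLinearMap.id ℂ V - l.smulRight v + (z - c) • l.smulRight v) := by
  obtain ⟨v, hv, hv0⟩ :=
    Submodule.exists_mem_ne_zero_of_ne_bot (LinearMap.bot_lt_ker_of_det_eq_zero h).ne'
  obtain ⟨l, hl⟩ := SeparatingDual.exists_eq_one (R := ℂ) hv0
  refine ⟨fun z => (Δ z).comp (ContinuousLinearMap.id ℂ V - l.smulRight v) +
    (dslope Δ c z).comp (l.smulRight v), v, l, ?_, hl, fun z => ?_⟩
  · exact (analyticAt_clm_comp hΔ analyticAt_const).add
      (analyticAt_clm_comp (analyticAt_dslope hΔ) analyticAt_const)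
  · have hs : ∀ x, (z - c) • dslope Δ c z x = Δ z x - Δ c x := fun x => by
      have := congrArg (fun T : V →L[ℂ] V => T x) (sub_smul_dslope Δ c z)
      exact this
    have hv' : Δ c v = 0 := hv
    ext x
    have h1 := hs v
    rw [hv', sub_zero] at h1
    have h2 : l (x - l x • v + (z - c) • l x • v) = (z - c) * l x := by
      simp [hl]
    change Δ z x = Δ z ((x - l x • v + (z - c) • l x • v) - l (x - l x • v + (z - c) • l x • v) • v)
      + dslope Δ c z (l (x - l x • v + (z - c) • l x • v) • v)
    rw [h2, mul_smul, add_sub_cancel_right, map_smul, map_smul, map_sub, map_smul, smul_comm, h1,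
      sub_add_cancel]

/-- On principal parts the factor is y_i ↦ (I - P)y_i + P y_{i+1}: the identity on ker P and the
left shift on the line of v. Only a simple pole along v is killed. -/
theorem germAction_elementary_factor (c : ℂ) (v : V) (l : V →L[ℂ] ℂ) (hl : l v = 1) :
    Function.Surjective (germAction c fun z =>
      ContinuousLinearMap.id ℂ V - l.smulRight v + (z - c) • l.smulRight v) ∧
    Module.rank ℂ (LinearMap.ker (germAction c fun z =>
      ContinuousLinearMap.id ℂ V - l.smulRight v + (z - c) • l.smulRight v)) = 1 := by
  have hform : ∀ y i, germAction c (fun z =>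
      ContinuousLinearMap.id ℂ V - l.smulRight v + (z - c) • l.smulRight v) y i =
        y i - l (y i) • v + l (y (i + 1)) • v := by
    intro y i
    have h1 : AnalyticAt ℂ (fun z : ℂ => (z - c) • ContinuousLinearMap.id ℂ V) c := by fun_prop
    have h2 : AnalyticAt ℂ (fun _ : ℂ => l.smulRight v) c := analyticAt_const
    have h3 := germAction_comp h1 h2
    have h4 : (fun z => ((z - c) • ContinuousLinearMap.id ℂ V).comp (l.smulRight v)) =
        fun z => (z - c) • l.smulRight v := by
      funext z; ext x; simp
    rw [germAction_add analyticAt_const (by rw [← h4]; exact analyticAt_clm_comp h1 h2), ← h4, h3,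
      germAction_const, germAction_const, germAction_sub_smul_one]
    simp
  constructor
  · intro u
    -- Preimage: keep (I - P)u and shift Pu to the right by one place.
    refine ⟨u - Finsupp.mapRange.linearMap (l.smulRight v : V →ₗ[ℂ] V) u +
      Finsupp.lmapDomain V ℂ Nat.succ
        (Finsupp.mapRange.linearMap (l.smulRight v : V →ₗ[ℂ] V) u), ?_⟩
    have hsucc : ∀ (w : ℕ →₀ V) (i : ℕ), Finsupp.mapDomain Nat.succ w (i + 1) = w i := fun w i =>
      Finsupp.mapDomain_apply Nat.succ_injective w i
    have hzero : ∀ w : ℕ →₀ V, Finsupp.mapDomain Nat.succ w 0 = 0 := fun w =>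
      Finsupp.mapDomain_of_notMem_range _ _ (by simp)
    ext1 i
    rw [hform]
    rcases i with _ | i
    · simp [hsucc, hzero, hl]
    · simp [hsucc, hl]
  · have : LinearMap.ker (germAction c (fun z =>
      ContinuousLinearMap.id ℂ V - l.smulRight v + (z - c) • l.smulRight v)) =
        ℂ ∙ (Finsupp.single 0 v) := by
      ext y
      rw [LinearMap.mem_ker, Submodule.mem_span_singleton]
      constructor
      · intro hy
        have h1 : ∀ i, y i - l (y i) • v + l (y (i + 1)) • v = 0 := fun i => by
          rw [← hform, hy]; rfl
        have h2 : ∀ i, l (y (i + 1)) = 0 := fun i => by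
          simpa [hl] using congrArg l (h1 i)
        refine ⟨l (y 0), ?_⟩
        ext1 i
        rcases i with _ | i
        · have := h1 0
          simp only [h2, zero_smul, add_zero] at this
          simpa using (sub_eq_zero.1 this).symm
        · have := h1 (i + 1)
          simp only [h2, zero_smul, add_zero, sub_zero] at this
          simp [this]
      · rintro ⟨a, rfl⟩
        ext1 i
        rw [hform]
        rcases i with _ | i
        · simp [hl]
        · simp
    rw [this]
    have hv : v ≠ 0 := by
      rintro rfl
      simp at hl
    have hs : (Finsupp.single 0 v : ℕ →₀ V) ≠ 0 := by simpa using hv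
    rw [← (LinearEquiv.toSpanNonzeroSingleton ℂ (ℕ →₀ V) _ hs).rank_eq, Module.rank_self]

/-- Each elementary factor removes one zero of the determinant and, being surjective with
one-dimensional kernel, one dimension of the kernel. The induction ends at an invertible germ. -/
theorem rank_ker_germAction {Δ : ℂ → V →L[ℂ] V} {c : ℂ} (hΔ : AnalyticAt ℂ Δ c) {d : ℕ}
    (hd : analyticOrderAt (fun z => (Δ z).det) c = d) :
    Module.rank ℂ (LinearMap.ker (germAction c Δ)) = d := by
  induction d generalizing Δ with
  | zero =>
    have h0 : (Δ c).det ≠ 0 := by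
      have := (analyticAt_det hΔ).analyticOrderAt_eq_zero.1 (by simpa using hd)
      simpa using this
    rw [germAction_ker_eq_bot hΔ (isUnit_of_det_ne_zero h0)]
    simp
  | succ d ih =>
    have h0 : (Δ c).det = 0 := by
      refine (analyticAt_det hΔ).analyticOrderAt_ne_zero.1 ?_
      rw [hd]
      simp
    obtain ⟨Δ', v, l, hΔ', hl, hfac⟩ := exists_factor_of_det_eq_zero hΔ h0
    have hDan : AnalyticAt ℂ (fun z : ℂ =>
      ContinuousLinearMap.id ℂ V - l.smulRight v + (z - c) • l.smulRight v) c := by fun_prop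
    have hdet : ∀ z, (Δ z).det = (z - c) * (Δ' z).det := by
      intro z
      rw [hfac z, mul_comm]
      -- The factor equals I + (z - c - 1)P, a transvection in the wide sense, with determinant 1 +
      -- (z - c - 1) l(v) = z - c.
      have h2 : ((ContinuousLinearMap.id ℂ V - l.smulRight v + (z - c) • l.smulRight v :
          V →L[ℂ] V) : V →ₗ[ℂ] V) = LinearMap.transvection ((z - c - 1) • (l : V →ₗ[ℂ] ℂ)) v := by
        ext x
        simp [LinearMap.transvection, sub_smul, mul_smul]
        abel
      have h3 : (ContinuousLinearMap.id ℂ V - l.smulRight v + (z - c) • l.smulRight v :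
          V →L[ℂ] V).det = z - c := by
        rw [ContinuousLinearMap.det, h2, LinearMap.transvection.det]
        simp [hl]
      exact (LinearMap.det_comp (Δ' z : V →ₗ[ℂ] V) ((ContinuousLinearMap.id ℂ V - l.smulRight v +
        (z - c) • l.smulRight v : V →L[ℂ] V) : V →ₗ[ℂ] V)).trans (congrArg (_ * ·) h3)
    have hd' : analyticOrderAt (fun z => (Δ' z).det) c = d := by
      have h4 : (fun z => (Δ z).det) = (fun z => z - c) * fun z => (Δ' z).det := funext hdet
      rw [h4, analyticOrderAt_mul (by fun_prop) (analyticAt_det hΔ')] at hd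
      have h5 : analyticOrderAt (fun z : ℂ => z - c) c = 1 := by
        have := analyticOrderAt_id_sub_const_self (𝕜 := ℂ) (c := c)
        exact this
      rw [h5, Nat.cast_add, Nat.cast_one, add_comm] at hd
      exact (ENat.add_left_injective_of_ne_top ENat.one_ne_top) hd
    rw [show Δ = fun z => (Δ' z).comp _ from funext hfac, germAction_comp hΔ' hDan,
      rank_ker_comp_of_surjective _ _ (germAction_elementary_factor c v l hl).1,
      (germAction_elementary_factor c v l hl).2, ih hΔ' hd']
    simp

end Det

/-! ### Jordan chains -/

section Chains

variable {X : Type} [AddCommGroup X] [Module ℂ X]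

/-- The finitely supported sequences `ξ` with `M ξ i = c ξ i + ξ (i + 1)`. -/
def chains (M : Module.End ℂ X) (c : ℂ) : Submodule ℂ (ℕ →₀ X) :=
  LinearMap.ker (Finsupp.mapRange.linearMap M - (c • LinearMap.id + leftShift X))

theorem mem_chains {M : Module.End ℂ X} {c : ℂ} {ξ : ℕ →₀ X} :
    ξ ∈ chains M c ↔ ∀ i, M (ξ i) = c • ξ i + ξ (i + 1) := by
  rw [chains, LinearMap.mem_ker, Finsupp.ext_iff]
  simp [sub_eq_zero]

theorem chains_apply {M : Module.End ℂ X} {c : ℂ} {ξ : ℕ →₀ X} (h : ξ ∈ chains M c) (i : ℕ) :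
    ξ i = ((M - c • (1 : Module.End ℂ X)) ^ i) (ξ 0) := by
  induction i with
  | zero => simp
  | succ i ih =>
    rw [pow_succ', Module.End.mul_apply, ← ih]
    simp [mem_chains.1 h i]

/-- A chain is determined by its head through ξ_i = (M - c)^i ξ₀, and finite support says precisely
that some power of M - c annihilates the head. -/
theorem rank_maxGenEigenspace_eq_rank_chains (M : Module.End ℂ X) (c : ℂ) :
    Module.rank ℂ (M.maxGenEigenspace c) = Module.rank ℂ (chains M c) := by
  let f : chains M c →ₗ[ℂ] M.maxGenEigenspace c :=
    ((Finsupp.lapply 0).domRestrict (chains M c)).codRestrict (M.maxGenEigenspace c) fun ξ => by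
      rw [Module.End.mem_maxGenEigenspace]
      obtain ⟨m, hm⟩ := Finset.exists_notMem (ξ : ℕ →₀ X).support
      refine ⟨m, ?_⟩
      have := chains_apply ξ.2 m
      rw [Finsupp.notMem_support_iff.1 hm] at this
      exact this.symm
  refine (LinearEquiv.ofBijective f ⟨?_, ?_⟩).rank_eq.symm
  · rw [← LinearMap.ker_eq_bot, LinearMap.ker_eq_bot']
    intro ξ hξ
    have h0 : (ξ : ℕ →₀ X) 0 = 0 := congrArg Subtype.val hξ
    ext i
    rw [chains_apply ξ.2, h0]
    simp
  · rintro ⟨x, hx⟩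
    obtain ⟨m, hm⟩ := (Module.End.mem_maxGenEigenspace M c x).1 hx
    have hfin : (Function.support fun i => ((M - c • (1 : Module.End ℂ X)) ^ i) x).Finite := by
      refine (Set.finite_lt_nat m).subset fun i hi => ?_
      by_contra hmi
      rw [Set.mem_ofPred_eq, not_lt] at hmi
      apply hi
      obtain ⟨j, rfl⟩ := Nat.exists_eq_add_of_le' hmi
      change ((M - c • (1 : Module.End ℂ X)) ^ (j + m)) x = 0
      rw [pow_add, Module.End.mul_apply, hm, map_zero]
    refine ⟨⟨Finsupp.ofSupportFinite _ hfin, mem_chains.2 fun i => ?_⟩, ?_⟩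
    · simp only [Finsupp.ofSupportFinite_coe, pow_succ', Module.End.mul_apply]
      simp
    · apply Subtype.ext
      simp [f, Finsupp.ofSupportFinite_coe]

variable {V : Type} [NormedAddCommGroup V] [NormedSpace ℂ V] [FiniteDimensional ℂ V]

/-- If a linear map `e` carries the Jordan chains of `M` at `c` bijectively onto the kernel of the
germ of `Δ` at `c`, then the algebraic multiplicity of `c` is the order of `det Δ`. -/
theorem rank_maxGenEigenspace_of_chains {M : Module.End ℂ X} {c : ℂ} {Δ : ℂ → V →L[ℂ] V}
    (hΔ : AnalyticAt ℂ Δ c) {d : ℕ} (hd : analyticOrderAt (fun z => (Δ z).det) c = d)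
    (e : X →ₗ[ℂ] V)
    (hmap : ∀ ξ ∈ chains M c, germAction c Δ (Finsupp.mapRange.linearMap e ξ) = 0)
    (hinj : ∀ ξ ∈ chains M c, Finsupp.mapRange.linearMap e ξ = 0 → ξ = 0)
    (hsurj : ∀ v, germAction c Δ v = 0 → ∃ ξ ∈ chains M c, Finsupp.mapRange.linearMap e ξ = v) :
    Module.rank ℂ (M.maxGenEigenspace c) = d := by
  rw [rank_maxGenEigenspace_eq_rank_chains, ← rank_ker_germAction hΔ hd]
  let f : chains M c →ₗ[ℂ] LinearMap.ker (germAction c Δ) :=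
    ((Finsupp.mapRange.linearMap e).domRestrict (chains M c)).codRestrict _ fun ξ => hmap ξ ξ.2
  refine (LinearEquiv.ofBijective f ⟨?_, ?_⟩).rank_eq
  · rw [← LinearMap.ker_eq_bot, LinearMap.ker_eq_bot']
    exact fun ξ hξ => Subtype.ext (hinj ξ ξ.2 (congrArg Subtype.val hξ))
  · rintro ⟨v, hv⟩
    obtain ⟨ξ, hξ, rfl⟩ := hsurj v hv
    exact ⟨⟨ξ, hξ⟩, rfl⟩

theorem finrank_of_rank_eq_natCast {d : ℕ} (h : Module.rank ℂ X = d) :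
    FiniteDimensional ℂ X ∧ Module.finrank ℂ X = d :=
  ⟨Module.rank_lt_aleph0_iff.1 (h ▸ Cardinal.natCast_lt_aleph0), Module.finrank_eq_of_rank_eq h⟩

end Chains

end LargeDelay
end

noncomputable section

namespace LargeDelay

set_option linter.unusedSectionVars false

/-! ### Fundamental matrices -/

theorem hasDerivWithinAt_clm_apply {E F : Type*} [NormedAddCommGroup E] [NormedSpace ℂ E]
    [NormedAddCommGroup F] [NormedSpace ℂ F] {L : ℝ → E →L[ℂ] F} {L' : E →L[ℂ] F} {u : ℝ → E}
    {u' : E} {s : Set ℝ} {t : ℝ} (hL : HasDerivWithinAt L L' s t)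
    (hu : HasDerivWithinAt u u' s t) :
    HasDerivWithinAt (fun r => L r (u r)) (L' (u t) + L t u') s t := by
  have h1 : HasDerivWithinAt (fun r => (L r).restrictScalars ℝ) (L'.restrictScalars ℝ) s t :=
    ((ContinuousLinearMap.restrictScalarsL ℂ E F ℝ ℝ).hasFDerivAt.comp_hasDerivWithinAt t hL)
  exact h1.clm_apply hu

theorem eq_of_hasDerivWithinAt_zero {E : Type*} [NormedAddCommGroup E] [NormedSpace ℝ E]
    {u : ℝ → E} {a b : ℝ} (hu : ∀ t ∈ Icc a b, HasDerivWithinAt u 0 (Icc a b) t) {t : ℝ}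
    (ht : t ∈ Icc a b) : u t = u a :=
  unique_linear_ode (E := E) (fun _ => 0) continuous_const (fun _ => 0) (a := a) (b := b)
    (x := u) (y := fun _ => u a) (by simpa using hu)
    (by simpa using fun t _ _ => hasDerivWithinAt_const t (Icc a b) (u a)) rfl ht

namespace PeriodicDDE

variable {n : ℕ} (D : PeriodicDDE n)

/-- `A(t)` as a continuous linear map. -/
def opA (t : ℝ) : (Fin n → ℂ) →L[ℂ] (Fin n → ℂ) :=
  LinearMap.toContinuousLinearMap (Matrix.mulVecLin (D.Ac t))

/-- `B(t)` as a continuous linear map. -/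
def opB (t : ℝ) : (Fin n → ℂ) →L[ℂ] (Fin n → ℂ) :=
  LinearMap.toContinuousLinearMap (Matrix.mulVecLin (D.Bc t))

@[simp] theorem opA_apply (t : ℝ) (v : Fin n → ℂ) : D.opA t v = D.Ac t *ᵥ v := rfl

@[simp] theorem opB_apply (t : ℝ) (v : Fin n → ℂ) : D.opB t v = D.Bc t *ᵥ v := rfl

theorem continuous_opA : Continuous D.opA :=
  continuous_clm_apply.2 fun _ => D.continuous_Ac.matrix_mulVec continuous_const

theorem continuous_opB : Continuous D.opB :=
  continuous_clm_apply.2 fun _ => D.continuous_Bc.matrix_mulVec continuous_const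

/-- Ψ is obtained from its own equation Ψ' = -ΨA, so ΨΦ has derivative zero and no differentiation
of an inverse is needed. Freezing both outside [-1, 0] keeps them continuous and mutually inverse on
all of ℝ. -/
theorem exists_fundamental : ∃ Φ Ψ : ℝ → (Fin n → ℂ) →L[ℂ] (Fin n → ℂ),
    Continuous Φ ∧ Continuous Ψ ∧ (∀ t, (Ψ t).comp (Φ t) = ContinuousLinearMap.id ℂ _) ∧
    (∀ t, (Φ t).comp (Ψ t) = ContinuousLinearMap.id ℂ _) ∧
    (∀ t ∈ Icc (-1 : ℝ) 0, HasDerivWithinAt Φ ((D.opA t).comp (Φ t)) (Icc (-1) 0) t) ∧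
    (∀ t ∈ Icc (-1 : ℝ) 0, HasDerivWithinAt Ψ (-(Ψ t).comp (D.opA t)) (Icc (-1) 0) t) := by
  have h01 : (-1 : ℝ) ≤ 0 := by norm_num
  let FL : ℝ → ((Fin n → ℂ) →L[ℂ] (Fin n → ℂ)) →L[ℝ] ((Fin n → ℂ) →L[ℂ] (Fin n → ℂ)) := fun t =>
    (ContinuousLinearMap.compL ℂ (Fin n → ℂ) (Fin n → ℂ) (Fin n → ℂ) (D.opA t)).restrictScalars ℝ
  let FR : ℝ → ((Fin n → ℂ) →L[ℂ] (Fin n → ℂ)) →L[ℝ] ((Fin n → ℂ) →L[ℂ] (Fin n → ℂ)) := fun t =>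
    (-((ContinuousLinearMap.compL ℂ (Fin n → ℂ) (Fin n → ℂ) (Fin n → ℂ)).flip
      (D.opA t))).restrictScalars ℝ
  have hFL : Continuous FL := (ContinuousLinearMap.restrictScalarsL ℂ _ _ ℝ ℝ).continuous.comp
    ((ContinuousLinearMap.continuous _).comp D.continuous_opA)
  have hflip : Continuous fun T : (Fin n → ℂ) →L[ℂ] (Fin n → ℂ) =>
      (ContinuousLinearMap.compL ℂ (Fin n → ℂ) (Fin n → ℂ) (Fin n → ℂ)).flip T :=
    ContinuousLinearMap.continuous _
  have hFR : Continuous FR := (ContinuousLinearMap.restrictScalarsL ℂ _ _ ℝ ℝ).continuous.comp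
    (hflip.comp D.continuous_opA).neg
  obtain ⟨Φ, hΦ0, hΦ⟩ := exists_linear_ode FL hFL (fun _ => (0 : (Fin n → ℂ) →L[ℂ] (Fin n → ℂ))) continuous_const h01
    (ContinuousLinearMap.id ℂ _)
  obtain ⟨Ψ, hΨ0, hΨ⟩ := exists_linear_ode FR hFR (fun _ => (0 : (Fin n → ℂ) →L[ℂ] (Fin n → ℂ))) continuous_const h01
    (ContinuousLinearMap.id ℂ _)
  have hΦ' : ∀ t ∈ Icc (-1 : ℝ) 0, HasDerivWithinAt Φ ((D.opA t).comp (Φ t)) (Icc (-1) 0) t :=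
    fun t ht => (hΦ t ht).congr_deriv (by rw [add_zero]; rfl)
  have hΨ' : ∀ t ∈ Icc (-1 : ℝ) 0, HasDerivWithinAt Ψ (-(Ψ t).comp (D.opA t)) (Icc (-1) 0) t :=
    fun t ht => (hΨ t ht).congr_deriv (by rw [add_zero]; rfl)
  have hprod : ∀ t ∈ Icc (-1 : ℝ) 0, (Ψ t).comp (Φ t) = ContinuousLinearMap.id ℂ _ := by
    intro t ht
    ext1 v
    have := eq_of_hasDerivWithinAt_zero (u := fun r => Ψ r (Φ r v)) (a := -1) (b := 0)
      (fun r hr => by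
        have h1 := hasDerivWithinAt_clm_apply (hΦ' r hr)
          (hasDerivWithinAt_const r (Icc (-1 : ℝ) 0) v)
        exact (hasDerivWithinAt_clm_apply (hΨ' r hr) h1).congr_deriv (by simp)) ht
    simp only [hΦ0, hΨ0, ContinuousLinearMap.id_apply] at this
    exact this
  have hproj : ∀ t : ℝ, (projIcc (-1 : ℝ) 0 h01 t : ℝ) ∈ Icc (-1 : ℝ) 0 := fun t =>
    (projIcc (-1 : ℝ) 0 h01 t).2
  have hid : ∀ t ∈ Icc (-1 : ℝ) 0, (projIcc (-1 : ℝ) 0 h01 t : ℝ) = t := fun t ht => by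
    rw [projIcc_of_mem h01 ht]
  have hcont : ∀ {f : ℝ → (Fin n → ℂ) →L[ℂ] (Fin n → ℂ)}, ContinuousOn f (Icc (-1) 0) →
      Continuous fun t => f (projIcc (-1 : ℝ) 0 h01 t) := fun hf =>
    hf.comp_continuous (continuous_subtype_val.comp continuous_projIcc) hproj
  refine ⟨fun t => Φ (projIcc (-1 : ℝ) 0 h01 t), fun t => Ψ (projIcc (-1 : ℝ) 0 h01 t),
    hcont fun t ht => (hΦ t ht).continuousWithinAt, hcont fun t ht => (hΨ t ht).continuousWithinAt,
    fun t => hprod _ (hproj t), fun t => ?_, fun t ht => ?_, fun t ht => ?_⟩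
  -- In finite dimension a left inverse is also a right inverse.
  · set r : ℝ := (projIcc (-1 : ℝ) 0 h01 t : ℝ)
    have h1 : ∀ v, Ψ r (Φ r v) = v := fun v =>
      congrArg (fun T : (Fin n → ℂ) →L[ℂ] (Fin n → ℂ) => T v) (hprod r (hproj t))
    have h2 : Function.Surjective (Φ r : (Fin n → ℂ) →ₗ[ℂ] (Fin n → ℂ)) :=
      LinearMap.injective_iff_surjective.1 (Function.LeftInverse.injective h1)
    ext1 v
    obtain ⟨w, rfl⟩ := h2 v
    exact congrArg (Φ r) (h1 w)
  · refine ((hΦ' t ht).congr (fun r hr => ?_) ?_).congr_deriv ?_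
    · simp only [hid r hr]
    · simp only [hid t ht]
    · simp only [hid t ht]
  · refine ((hΨ' t ht).congr (fun r hr => ?_) ?_).congr_deriv ?_
    · simp only [hid r hr]
    · simp only [hid t ht]
    · simp only [hid t ht]

/-- A fundamental matrix `Φ` of `x' = A(t) x` on `[-1, 0]`. -/
def fund : ℝ → (Fin n → ℂ) →L[ℂ] (Fin n → ℂ) := D.exists_fundamental.choose

/-- The inverse of the fundamental matrix. -/
def fundInv : ℝ → (Fin n → ℂ) →L[ℂ] (Fin n → ℂ) := D.exists_fundamental.choose_spec.choose

theorem continuous_fund : Continuous D.fund := D.exists_fundamental.choose_spec.choose_spec.1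

theorem continuous_fundInv : Continuous D.fundInv :=
  D.exists_fundamental.choose_spec.choose_spec.2.1

@[simp] theorem fundInv_fund (t : ℝ) (v : Fin n → ℂ) : D.fundInv t (D.fund t v) = v :=
  congrArg (fun T : (Fin n → ℂ) →L[ℂ] (Fin n → ℂ) => T v)
    (D.exists_fundamental.choose_spec.choose_spec.2.2.1 t)

@[simp] theorem fund_fundInv (t : ℝ) (v : Fin n → ℂ) : D.fund t (D.fundInv t v) = v :=
  congrArg (fun T : (Fin n → ℂ) →L[ℂ] (Fin n → ℂ) => T v)
    (D.exists_fundamental.choose_spec.choose_spec.2.2.2.1 t)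

theorem hasDerivWithinAt_fund {t : ℝ} (ht : t ∈ Icc (-1 : ℝ) 0) :
    HasDerivWithinAt D.fund ((D.opA t).comp (D.fund t)) (Icc (-1) 0) t :=
  D.exists_fundamental.choose_spec.choose_spec.2.2.2.2.1 t ht

/-! ### Variation of constants -/

theorem hasDerivWithinAt_variation {g : ℝ → Fin n → ℂ} (hg : ContinuousOn g (Icc (-1) 0))
    (c : Fin n → ℂ) {t : ℝ} (ht : t ∈ Icc (-1 : ℝ) 0) :
    HasDerivWithinAt (fun t => D.fund t (c + ∫ s in (-1)..t, D.fundInv s (g s)))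
      (D.Ac t *ᵥ D.fund t (c + ∫ s in (-1)..t, D.fundInv s (g s)) + g t) (Icc (-1) 0) t := by
  have h01 : (-1 : ℝ) ≤ 0 := by norm_num
  -- Extending g by constants makes the integrand continuous on ℝ, so the fundamental theorem of
  -- calculus applies at the end points too.
  let g' : ℝ → Fin n → ℂ := IccExtend h01 ((Icc (-1 : ℝ) 0).domRestrict g)
  have hg' : Continuous g' := hg.domRestrict.Icc_extend'
  have hgg : ∀ s ∈ Icc (-1 : ℝ) 0, g' s = g s := fun s hs => by
    simp only [g']
    rw [IccExtend_of_mem h01 _ hs]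
    rfl
  have hint : ∀ t ∈ Icc (-1 : ℝ) 0, ∫ s in (-1)..t, D.fundInv s (g s) =
      ∫ s in (-1)..t, D.fundInv s (g' s) := by
    intro t ht
    refine intervalIntegral.integral_congr fun s hs => ?_
    rw [uIcc_of_le ht.1] at hs
    simp only [hgg s ⟨hs.1, hs.2.trans ht.2⟩]
  have hc : Continuous fun s => D.fundInv s (g' s) := D.continuous_fundInv.clm_apply hg'
  have h1 : HasDerivWithinAt (fun t => c + ∫ s in (-1)..t, D.fundInv s (g' s))
      (D.fundInv t (g' t)) (Icc (-1) 0) t :=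
    ((intervalIntegral.integral_hasDerivAt_right (hc.intervalIntegrable _ _)
      (hc.stronglyMeasurableAtFilter _ _) hc.continuousAt).const_add c).hasDerivWithinAt
  have h2 := hasDerivWithinAt_clm_apply (D.hasDerivWithinAt_fund ht) h1
  refine (h2.congr (fun r hr => ?_) ?_).congr_deriv ?_
  · rw [hint r hr]
  · rw [hint t ht]
  · rw [hint t ht, fund_fundInv, hgg t ht]
    rfl

theorem eq_variation {u g : ℝ → Fin n → ℂ} (hg : ContinuousOn g (Icc (-1) 0))
    (hu : ∀ t ∈ Icc (-1 : ℝ) 0, HasDerivWithinAt u (D.Ac t *ᵥ u t + g t) (Icc (-1) 0) t) {t : ℝ}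
    (ht : t ∈ Icc (-1 : ℝ) 0) :
    u t = D.fund t (D.fundInv (-1) (u (-1)) + ∫ s in (-1)..t, D.fundInv s (g s)) := by
  refine unique_linear_ode (D.field 0) (D.continuous_field 0) g (a := -1) (b := 0) (x := u)
    (y := fun t => D.fund t (D.fundInv (-1) (u (-1)) + ∫ s in (-1)..t, D.fundInv s (g s)))
    (fun r hr => ?_) (fun r hr => ?_) ?_ ht
  · simpa [field_apply] using hu r hr
  · simpa [field_apply] using D.hasDerivWithinAt_variation hg (D.fundInv (-1) (u (-1))) hr
  · simp

/-- Restarts the variation of constants at a. This is the passage between the local formula on one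
subinterval and the global formula on [-1, 0]. -/
theorem fund_variation_shift {g : ℝ → Fin n → ℂ} {c : Fin n → ℂ}
    (hg : ∀ a b, IntervalIntegrable (fun s => D.fundInv s (g s)) MeasureTheory.volume a b)
    (a t : ℝ) :
    D.fund t (c + ∫ s in (-1)..t, D.fundInv s (g s)) =
      D.fund t (D.fundInv a (D.fund a (c + ∫ s in (-1)..a, D.fundInv s (g s))) +
        ∫ s in a..t, D.fundInv s (g s)) := by
  rw [fundInv_fund, add_assoc, intervalIntegral.integral_add_adjacent_intervals (hg _ _) (hg _ _)]

/-- The scalar μ commutes with A, so the dependence of the propagator on μ is an explicit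
exponential factor. -/
theorem propagator_apply (μ : ℂ) {s t : ℝ} (hs : -1 ≤ s) (hst : s ≤ t) (ht : t ≤ 0)
    (v : Fin n → ℂ) :
    D.propagator μ t s v = Complex.exp (-μ * (t - s)) • D.fund t (D.fundInv s v) := by
  have hspec := (D.existsUnique_propagator μ hst).choose_spec.1
  rw [propagator, dif_pos hst]
  have := hspec (fun r => Complex.exp (-μ * (r - s)) • D.fund r (D.fundInv s v)) ?_
  · simpa using this
  · intro r hr
    have hr' : r ∈ Icc (-1 : ℝ) 0 := ⟨hs.trans hr.1, hr.2.trans ht⟩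
    have h1 : HasDerivWithinAt (fun r => D.fund r (D.fundInv s v))
        (D.Ac r *ᵥ D.fund r (D.fundInv s v)) (Icc s t) r := by
      have := hasDerivWithinAt_clm_apply (D.hasDerivWithinAt_fund hr')
        (hasDerivWithinAt_const r (Icc (-1 : ℝ) 0) (D.fundInv s v))
      simp only [map_zero, add_zero] at this
      exact this.mono (Icc_subset_Icc hs ht)
    have h2 : HasDerivAt (fun r : ℝ => Complex.exp (-μ * (r - s)))
        (Complex.exp (-μ * (r - s)) * -μ) r := by
      have h3 : HasDerivAt (fun r : ℝ => -μ * ((r : ℂ) - s)) (-μ) r := by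
        simpa using (((hasDerivAt_id r).ofReal_comp.sub_const (s : ℂ)).const_mul (-μ))
      exact h3.cexp
    refine (h2.hasDerivWithinAt.smul h1).congr_deriv ?_
    rw [Matrix.mulVec_smul, smul_smul, mul_neg, neg_smul, mul_comm μ, ← sub_eq_add_neg]

end PeriodicDDE

end LargeDelay
end

noncomputable section

namespace LargeDelay

set_option linter.unusedSectionVars false

/-! ### Functions given piecewise on the subintervals -/

/-- Tuples of continuous functions on the closed subintervals `[t_j, t_{j+1}]`, each parametrized
by the unit interval. -/
def Pieces (k n : ℕ) : Type := C(Fin k × unitInterval, Fin n → ℂ)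

section Pieces

variable {k n : ℕ}

instance : NormedAddCommGroup (Pieces k n) :=
  inferInstanceAs (NormedAddCommGroup C(Fin k × unitInterval, Fin n → ℂ))

instance : NormedSpace ℂ (Pieces k n) :=
  inferInstanceAs (NormedSpace ℂ C(Fin k × unitInterval, Fin n → ℂ))

instance : CompleteSpace (Pieces k n) :=
  inferInstanceAs (CompleteSpace C(Fin k × unitInterval, Fin n → ℂ))

instance : FunLike (Pieces k n) (Fin k × unitInterval) (Fin n → ℂ) :=
  inferInstanceAs (FunLike C(Fin k × unitInterval, Fin n → ℂ) _ _)

namespace Pieces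

/-- The piecewise function given by a continuous function. -/
def mk (f : Fin k × unitInterval → Fin n → ℂ) (hf : Continuous f) : Pieces k n :=
  ContinuousMap.mk f hf

@[simp] theorem mk_apply (f : Fin k × unitInterval → Fin n → ℂ) (hf : Continuous f)
    (x : Fin k × unitInterval) : mk f hf x = f x := rfl

protected theorem continuous (w : Pieces k n) : Continuous w := ContinuousMap.continuous w

protected theorem ext {v w : Pieces k n} (h : ∀ x, v x = w x) : v = w := DFunLike.ext _ _ h

@[simp] theorem add_apply (v w : Pieces k n) (x : Fin k × unitInterval) :
    (v + w) x = v x + w x := rfl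

@[simp] theorem sub_apply (v w : Pieces k n) (x : Fin k × unitInterval) :
    (v - w) x = v x - w x := rfl

@[simp] theorem smul_apply (c : ℂ) (w : Pieces k n) (x : Fin k × unitInterval) :
    (c • w) x = c • w x := rfl

@[simp] theorem zero_apply (x : Fin k × unitInterval) : (0 : Pieces k n) x = 0 := rfl

theorem norm_apply_le (w : Pieces k n) (x : Fin k × unitInterval) : ‖w x‖ ≤ ‖w‖ :=
  ContinuousMap.norm_coe_le_norm w x

theorem norm_le {w : Pieces k n} {C : ℝ} (hC : 0 ≤ C) (h : ∀ x, ‖w x‖ ≤ C) : ‖w‖ ≤ C :=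
  (ContinuousMap.norm_le w hC).2 h

/-- Evaluation at a point. -/
def eval (x : Fin k × unitInterval) : Pieces k n →L[ℂ] (Fin n → ℂ) :=
  LinearMap.mkContinuous
    { toFun := fun w => w x
      map_add' := fun _ _ => rfl
      map_smul' := fun _ _ => rfl } 1 fun w => (norm_apply_le w x).trans_eq (one_mul _).symm

@[simp] theorem eval_apply (x : Fin k × unitInterval) (w : Pieces k n) : eval x w = w x := rfl

end Pieces

/-- The point `t_j + σ / k`. -/
def piecePt (k : ℕ) (p : Fin k × unitInterval) : ℝ := PeriodicDDE.node k p.1 + p.2 / k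

theorem continuous_piecePt : Continuous (piecePt k) := by
  have h1 : Continuous fun j : Fin k => PeriodicDDE.node k j := continuous_of_discreteTopology
  exact (h1.comp continuous_fst).add
    ((continuous_subtype_val.comp continuous_snd).div_const _)

variable [NeZero k]

theorem cast_pos_of_neZero : (0 : ℝ) < k := Nat.cast_pos.2 (NeZero.pos k)

theorem piecePt_eq (p : Fin k × unitInterval) :
    piecePt k p = -1 + ((p.1 : ℕ) + (p.2 : ℝ)) / k := by
  rw [piecePt, PeriodicDDE.node]
  ring

theorem piecePt_mem (p : Fin k × unitInterval) : piecePt k p ∈ Icc (-1 : ℝ) 0 := by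
  have hk := cast_pos_of_neZero (k := k)
  have h1 : ((p.1 : ℕ) : ℝ) + 1 ≤ k := by exact_mod_cast p.1.2
  rw [piecePt_eq]
  constructor
  · have : 0 ≤ ((p.1 : ℕ) + (p.2 : ℝ)) / k :=
      div_nonneg (add_nonneg (Nat.cast_nonneg _) p.2.2.1) hk.le
    linarith
  · have : ((p.1 : ℕ) + (p.2 : ℝ)) / k ≤ 1 := by
      rw [div_le_one hk]
      linarith [p.2.2.2]
    linarith

theorem node_le_piecePt (p : Fin k × unitInterval) : PeriodicDDE.node k p.1 ≤ piecePt k p :=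
  le_add_of_nonneg_right (div_nonneg p.2.2.1 (Nat.cast_nonneg _))

theorem piecePt_sub_node_le (p : Fin k × unitInterval) :
    piecePt k p - PeriodicDDE.node k p.1 ≤ 1 / k := by
  rw [piecePt, add_sub_cancel_left]
  have := p.2.2.2
  have := cast_pos_of_neZero (k := k)
  gcongr

theorem piecePt_zero (j : Fin k) : piecePt k (j, 0) = PeriodicDDE.node k j := by
  simp [piecePt]

theorem piecePt_one (j : Fin k) : piecePt k (j, 1) = PeriodicDDE.node k (j + 1) := by
  rw [piecePt_eq, PeriodicDDE.node]
  simp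

theorem node_mem (j : Fin k) : PeriodicDDE.node k j ∈ Icc (-1 : ℝ) 0 := by
  rw [← piecePt_zero]
  exact piecePt_mem _

theorem node_zero : PeriodicDDE.node k 0 = -1 := by simp [PeriodicDDE.node]

theorem node_self : PeriodicDDE.node k k = 0 := by
  have := (cast_pos_of_neZero (k := k)).ne'
  simp [PeriodicDDE.node, this]

variable (k) in
/-- The representation of `t` modulo `1` as `t_j + σ / k` with `σ < 1`. -/
def pieceOf (t : ℝ) : Fin k × unitInterval :=
  (⟨⌊Int.fract t * k⌋₊, by
      have hk := cast_pos_of_neZero (k := k)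
      rw [Nat.floor_lt (mul_nonneg (Int.fract_nonneg _) hk.le)]
      exact mul_lt_of_lt_one_left hk (Int.fract_lt_one t)⟩,
    ⟨Int.fract (Int.fract t * k), Int.fract_nonneg _, (Int.fract_lt_one _).le⟩)

theorem pieceOf_snd_lt (t : ℝ) : ((pieceOf k t).2 : ℝ) < 1 := Int.fract_lt_one _

theorem piecePt_pieceOf (t : ℝ) : piecePt k (pieceOf k t) = PeriodicDDE.pmod t := by
  have hk := cast_pos_of_neZero (k := k)
  have h0 : 0 ≤ Int.fract t * k := mul_nonneg (Int.fract_nonneg _) hk.le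
  have h1 : ((⌊Int.fract t * k⌋₊ : ℕ) : ℝ) + Int.fract (Int.fract t * k) = Int.fract t * k := by
    rw [natCast_floor_eq_intCast_floor h0, Int.floor_add_fract]
  rw [piecePt_eq]
  simp only [pieceOf, h1, PeriodicDDE.pmod]
  field_simp
  ring

theorem pieceOf_piecePt {p : Fin k × unitInterval} (hp : (p.2 : ℝ) < 1) :
    pieceOf k (piecePt k p) = p := by
  have hk := cast_pos_of_neZero (k := k)
  have h1 : ((p.1 : ℕ) : ℝ) + 1 ≤ k := by exact_mod_cast p.1.2
  have h2 : 0 ≤ ((p.1 : ℕ) + (p.2 : ℝ)) / k :=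
    div_nonneg (add_nonneg (Nat.cast_nonneg _) p.2.2.1) hk.le
  have h3 : ((p.1 : ℕ) + (p.2 : ℝ)) / k < 1 := by
    rw [div_lt_one hk]
    linarith
  have h4 : Int.fract (piecePt k p) = ((p.1 : ℕ) + (p.2 : ℝ)) / k := by
    rw [piecePt_eq, Int.fract_eq_iff]
    exact ⟨h2, h3, -1, by push_cast; ring⟩
  have h5 : Int.fract (piecePt k p) * k = (p.1 : ℕ) + (p.2 : ℝ) := by
    rw [h4]
    field_simp
  have h6 : Int.fract (p.2 : ℝ) = p.2 := Int.fract_eq_self.2 ⟨p.2.2.1, hp⟩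
  refine Prod.ext (Fin.ext ?_) (Subtype.ext ?_)
  · simp only [pieceOf, h5]
    rw [Nat.floor_eq_iff (add_nonneg (Nat.cast_nonneg _) p.2.2.1)]
    exact ⟨le_add_of_nonneg_right p.2.2.1, by linarith⟩
  · simp only [pieceOf, h5, Int.fract_natCast_add, h6]

theorem measurable_pieceOf : Measurable (pieceOf k) := by
  refine Measurable.prodMk ?_ ?_
  · refine measurable_to_countable' fun j => ?_
    have h1 : Measurable fun t : ℝ => ⌊Int.fract t * k⌋₊ :=
      Nat.measurable_floor.comp (measurable_fract.mul_const _)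
    have h2 := h1 (measurableSet_singleton (j : ℕ))
    refine (congrArg MeasurableSet ?_).mp h2
    ext t
    simp [Fin.ext_iff]
  · exact (measurable_fract.comp (measurable_fract.mul_const _)).subtype_mk

/-- The `1`-periodic function on `ℝ` described by `w`. -/
def liftPieces (w : Pieces k n) (t : ℝ) : Fin n → ℂ := w (pieceOf k t)

theorem liftPieces_piecePt (w : Pieces k n) {p : Fin k × unitInterval} (hp : (p.2 : ℝ) < 1) :
    liftPieces w (piecePt k p) = w p := by
  rw [liftPieces, pieceOf_piecePt hp]

theorem norm_liftPieces_le (w : Pieces k n) (t : ℝ) : ‖liftPieces w t‖ ≤ ‖w‖ :=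
  w.norm_apply_le _

theorem measurable_liftPieces (w : Pieces k n) : Measurable (liftPieces w) :=
  w.continuous.measurable.comp measurable_pieceOf

theorem pmod_mem (t : ℝ) : PeriodicDDE.pmod t ∈ Ico (-1 : ℝ) 0 :=
  ⟨by simp [PeriodicDDE.pmod, Int.fract_nonneg],
    by have := Int.fract_lt_one t; simp only [PeriodicDDE.pmod]; linarith⟩

theorem pieceOf_add_one (t : ℝ) : pieceOf k (t + 1) = pieceOf k t := by
  simp only [pieceOf, Int.fract_add_one]

theorem pieceOf_pmod (t : ℝ) : pieceOf k (PeriodicDDE.pmod t) = pieceOf k t := by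
  simp only [pieceOf, PeriodicDDE.pmod, Int.fract_sub_one, Int.fract_fract]

theorem pmod_of_mem {t : ℝ} (ht : t ∈ Ico (-1 : ℝ) 0) : PeriodicDDE.pmod t = t := by
  have : Int.fract t = t + 1 := by
    rw [Int.fract_eq_iff]
    exact ⟨by linarith [ht.1], by linarith [ht.2], -1, by push_cast; ring⟩
  rw [PeriodicDDE.pmod, this, add_sub_cancel_right]

theorem pmod_add_one (t : ℝ) : PeriodicDDE.pmod (t + 1) = PeriodicDDE.pmod t := by
  simp only [PeriodicDDE.pmod, Int.fract_add_one]

end Pieces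

/-! ### The operators of the integral equation -/

/-- Lagged functions may jump at the nodes, so the Volterra integrands are only bounded and
measurable. -/
theorem intervalIntegrable_clm_apply {n : ℕ} {L : ℝ → (Fin n → ℂ) →L[ℂ] (Fin n → ℂ)}
    (hL : Continuous L) {g : ℝ → Fin n → ℂ} (hg : Measurable g) {C : ℝ} (hC : ∀ t, ‖g t‖ ≤ C)
    (a b : ℝ) : IntervalIntegrable (fun s => L s (g s)) MeasureTheory.volume a b := by
  have h1 : Continuous fun s => ‖L s‖ * C := by fun_prop
  refine (h1.intervalIntegrable a b).mono_fun' ?_ (Eventually.of_forall fun s => ?_)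
  · exact (isBoundedBilinearMap_apply (𝕜 := ℂ) (E := Fin n → ℂ) (F := Fin n → ℂ)).continuous.comp_aestronglyMeasurable₂
      hL.aestronglyMeasurable hg.aestronglyMeasurable
  · exact ((L s).le_opNorm _).trans (mul_le_mul_of_nonneg_left (hC s) (norm_nonneg _))

/-- Agreement in the open interval is needed because the formulas for s - τ modulo 1 are available
for s in [-1, 0), while a subinterval may end at 0. -/
theorem intervalIntegral_congr_Ioo {E : Type*} [NormedAddCommGroup E] [NormedSpace ℝ E]
    {f g : ℝ → E} {a b : ℝ} (hab : a ≤ b) (h : ∀ s ∈ Ioo a b, f s = g s) :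
    ∫ s in a..b, f s = ∫ s in a..b, g s := by
  rw [intervalIntegral.integral_of_le hab, intervalIntegral.integral_of_le hab,
    MeasureTheory.integral_Ioc_eq_integral_Ioo, MeasureTheory.integral_Ioc_eq_integral_Ioo]
  exact MeasureTheory.setIntegral_congr_fun measurableSet_Ioo h

namespace PeriodicDDE

variable {n : ℕ} (D : PeriodicDDE n) {k : ℕ} [NeZero k]

/-- The indicator function of `s - τ ≥ -1` for `true` and of `s - τ < -1` for `false`. -/
def weight (b : Bool) (s : ℝ) : ℂ := if decide (-1 ≤ s - D.τ) = b then 1 else 0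

theorem weight_true {s : ℝ} (h : -1 ≤ s - D.τ) : D.weight true s = 1 ∧ D.weight false s = 0 := by
  simp [weight, h]

theorem weight_false {s : ℝ} (h : s - D.τ < -1) : D.weight true s = 0 ∧ D.weight false s = 1 := by
  simp [weight, not_le.2 h]

theorem measurable_weight (b : Bool) : Measurable (D.weight b) := by
  have h : MeasurableSet {s : ℝ | -1 ≤ s - D.τ} :=
    measurableSet_le measurable_const (measurable_id.sub_const _)
  refine Measurable.ite ?_ measurable_const measurable_const
  cases b
  · convert! h.compl using 1
    ext s
    simp
  · convert! h using 1
    ext s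
    simp

theorem norm_weight_le (b : Bool) (s : ℝ) : ‖D.weight b s‖ ≤ 1 := by
  rw [weight]
  split_ifs <;> simp

/-- The lagged values `w(s - τ)` of a piecewise function with weights `p` and `q` according to
whether the lag crosses `-1`. -/
def lagged (p q : ℂ) (w : Pieces k n) (s : ℝ) : Fin n → ℂ :=
  (p * D.weight true s + q * D.weight false s) • liftPieces w (s - D.τ)

theorem measurable_lagged (p q : ℂ) (w : Pieces k n) : Measurable (D.lagged p q w) :=
  (((D.measurable_weight true).const_mul p).add ((D.measurable_weight false).const_mul q)).smul
    ((measurable_liftPieces w).comp (measurable_id.sub_const _))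

theorem norm_lagged_le (p q : ℂ) (w : Pieces k n) (s : ℝ) :
    ‖D.lagged p q w s‖ ≤ (‖p‖ + ‖q‖) * ‖w‖ := by
  rw [lagged, norm_smul]
  refine mul_le_mul ((norm_add_le _ _).trans ?_) (norm_liftPieces_le _ _) (norm_nonneg _)
    (by positivity)
  rw [norm_mul, norm_mul]
  exact add_le_add (mul_le_of_le_one_right (norm_nonneg _) (D.norm_weight_le _ _))
    (mul_le_of_le_one_right (norm_nonneg _) (D.norm_weight_le _ _))

theorem intervalIntegrable_lagged (p q : ℂ) (w : Pieces k n) (a b : ℝ) :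
    IntervalIntegrable (fun s => D.fundInv s (D.opB s (D.lagged p q w s)))
      MeasureTheory.volume a b :=
  intervalIntegrable_clm_apply (L := fun s => (D.fundInv s).comp (D.opB s))
    (D.continuous_fundInv.clm_comp D.continuous_opB) (D.measurable_lagged p q w)
    (D.norm_lagged_le p q w) a b

theorem exists_kernel_bound : ∃ C : ℝ, 0 ≤ C ∧ ∀ t ∈ Icc (-1 : ℝ) 0, ∀ s ∈ Icc (-1 : ℝ) 0,
    ∀ v, ‖D.fund t (D.fundInv s (D.opB s v))‖ ≤ C * ‖v‖ := by
  obtain ⟨C1, h1⟩ := isCompact_Icc.exists_bound_of_continuousOn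
    (s := Icc (-1 : ℝ) 0) D.continuous_fund.continuousOn
  obtain ⟨C2, h2⟩ := isCompact_Icc.exists_bound_of_continuousOn
    (s := Icc (-1 : ℝ) 0) (D.continuous_fundInv.clm_comp D.continuous_opB).continuousOn
  have hm : (-1 : ℝ) ∈ Icc (-1 : ℝ) 0 := by norm_num
  have hC1 := (norm_nonneg _).trans (h1 _ hm)
  have hC2 := (norm_nonneg _).trans (h2 _ hm)
  refine ⟨C1 * C2, mul_nonneg hC1 hC2, fun t ht s hs v => ?_⟩
  have h3 := ((D.fundInv s).comp (D.opB s)).le_of_opNorm_le (h2 s hs) v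
  exact ((D.fund t).le_of_opNorm_le (h1 t ht) _).trans
    ((mul_le_mul_of_nonneg_left h3 hC1).trans_eq (mul_assoc _ _ _).symm)

/-- The value of the Volterra operator. -/
def volterraVal (p q : ℂ) (w : Pieces k n) (x : Fin k × unitInterval) : Fin n → ℂ :=
  D.fund (piecePt k x)
    (∫ s in (node k x.1)..(piecePt k x), D.fundInv s (D.opB s (D.lagged p q w s)))

theorem continuous_volterraVal (p q : ℂ) (w : Pieces k n) : Continuous (D.volterraVal p q w) := by
  refine (D.continuous_fund.comp continuous_piecePt).clm_apply ?_
  have h1 : Continuous fun t => ∫ s in (0 : ℝ)..t, D.fundInv s (D.opB s (D.lagged p q w s)) :=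
    intervalIntegral.continuous_primitive (D.intervalIntegrable_lagged p q w) 0
  have h2 : Continuous fun j : Fin k => node k j := continuous_of_discreteTopology
  have h3 : (fun x : Fin k × unitInterval => ∫ s in (node k x.1)..(piecePt k x),
      D.fundInv s (D.opB s (D.lagged p q w s))) = fun x =>
      (∫ s in (0 : ℝ)..(piecePt k x), D.fundInv s (D.opB s (D.lagged p q w s))) -
      ∫ s in (0 : ℝ)..(node k x.1), D.fundInv s (D.opB s (D.lagged p q w s)) := by
    funext x
    rw [intervalIntegral.integral_interval_sub_left] <;> exact D.intervalIntegrable_lagged p q w _ _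
  rw [h3]
  exact (h1.comp continuous_piecePt).sub (h1.comp (h2.comp continuous_fst))

theorem volterraVal_eq_integral (p q : ℂ) (w : Pieces k n) (x : Fin k × unitInterval) :
    D.volterraVal p q w x = ∫ s in (node k x.1)..(piecePt k x),
      D.fund (piecePt k x) (D.fundInv s (D.opB s (D.lagged p q w s))) :=
  (((D.fund (piecePt k x)).intervalIntegral_comp_comm
    (D.intervalIntegrable_lagged p q w _ _))).symm

theorem exists_volterraVal_bound : ∃ C : ℝ, ∀ (p q : ℂ) (w : Pieces k n) x,
    ‖D.volterraVal p q w x‖ ≤ C * ((‖p‖ + ‖q‖) * ‖w‖) := by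
  obtain ⟨C, hC0, hC⟩ := D.exists_kernel_bound
  refine ⟨C, fun p q w x => ?_⟩
  rw [volterraVal_eq_integral]
  have hx := node_le_piecePt x
  have hle : piecePt k x - node k x.1 ≤ 1 := by
    linarith [(piecePt_mem x).2, (node_mem x.1).1]
  have h1 := intervalIntegral.norm_integral_le_of_norm_le_const (a := node k x.1)
    (b := piecePt k x) (C := C * ((‖p‖ + ‖q‖) * ‖w‖))
    (f := fun s => D.fund (piecePt k x) (D.fundInv s (D.opB s (D.lagged p q w s)))) (by
      intro s hs
      rw [uIoc_of_le hx] at hs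
      exact (hC _ (piecePt_mem x) s
        ⟨(node_mem x.1).1.trans hs.1.le, hs.2.trans (piecePt_mem x).2⟩ _).trans
        (mul_le_mul_of_nonneg_left (D.norm_lagged_le p q w s) hC0))
  refine h1.trans (mul_le_of_le_one_right (by positivity) ?_)
  rwa [abs_of_nonneg (sub_nonneg.2 hx)]

theorem lagged_add (p q : ℂ) (v w : Pieces k n) (s : ℝ) :
    D.lagged p q (v + w) s = D.lagged p q v s + D.lagged p q w s := by
  simp [lagged, liftPieces]

theorem lagged_smul (p q c : ℂ) (w : Pieces k n) (s : ℝ) :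
    D.lagged p q (c • w) s = c • D.lagged p q w s := by
  simp [lagged, liftPieces, smul_smul, mul_comm]

/-- The Volterra operator with weights `p` and `q`. -/
def volterraAux (p q : ℂ) : Pieces k n →L[ℂ] Pieces k n :=
  LinearMap.mkContinuousOfExistsBound
    { toFun := fun w => Pieces.mk (D.volterraVal p q w) (D.continuous_volterraVal p q w)
      map_add' := fun v w => by
        refine Pieces.ext fun x => ?_
        simp only [Pieces.mk_apply, Pieces.add_apply, volterraVal, lagged_add, map_add]
        rw [intervalIntegral.integral_add (D.intervalIntegrable_lagged p q v _ _)
          (D.intervalIntegrable_lagged p q w _ _), map_add]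
      map_smul' := fun c w => by
        refine Pieces.ext fun x => ?_
        simp only [Pieces.mk_apply, Pieces.smul_apply, volterraVal, lagged_smul,
          map_smul, RingHom.id_apply]
        rw [intervalIntegral.integral_smul, map_smul] }
    (by
      obtain ⟨C, hC⟩ := D.exists_volterraVal_bound (k := k)
      refine ⟨max C 0 * (‖p‖ + ‖q‖), fun w => Pieces.norm_le (by positivity)
        fun x => (hC p q w x).trans ?_⟩
      rw [← mul_assoc]
      gcongr
      exact le_max_left _ _)

variable (k) in
/-- The Volterra operator collecting the lags that do not cross `-1`. -/
def volterraNear : Pieces k n →L[ℂ] Pieces k n := D.volterraAux 1 0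

variable (k) in
/-- The Volterra operator collecting the lags that cross `-1`. -/
def volterraFar : Pieces k n →L[ℂ] Pieces k n := D.volterraAux 0 1

theorem volterra_apply (p q : ℂ) (w : Pieces k n) (x : Fin k × unitInterval) :
    (p • D.volterraNear k w + q • D.volterraFar k w) x = D.fund (piecePt k x)
      (∫ s in (node k x.1)..(piecePt k x), D.fundInv s (D.opB s (D.lagged p q w s))) := by
  have h : ∀ s, D.fundInv s (D.opB s (D.lagged p q w s)) =
      p • D.fundInv s (D.opB s (D.lagged 1 0 w s)) +
      q • D.fundInv s (D.opB s (D.lagged 0 1 w s)) := by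
    intro s
    rw [← map_smul, ← map_smul, ← map_smul, ← map_smul, ← map_add, ← map_add]
    congr 2
    simp [lagged, smul_smul, add_smul]
  have h1 := intervalIntegral.integral_add ((D.intervalIntegrable_lagged 1 0 w (node k x.1)
    (piecePt k x)).smul p) ((D.intervalIntegrable_lagged 0 1 w (node k x.1) (piecePt k x)).smul q)
  simp only [Pi.smul_apply] at h1
  simp only [h]
  rw [h1, intervalIntegral.integral_smul, intervalIntegral.integral_smul, map_add, map_smul,
    map_smul]
  rfl

variable (k) in
/-- The solution operator of the equation without delay term on the subintervals. -/
def initial : (Fin k → Fin n → ℂ) →L[ℂ] Pieces k n :=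
  LinearMap.toContinuousLinearMap
    { toFun := fun v => Pieces.mk (fun x => D.fund (piecePt k x) (D.fundInv (node k x.1) (v x.1))) <| by
        refine (D.continuous_fund.comp continuous_piecePt).clm_apply ?_
        have : Continuous fun j : Fin k => D.fundInv (node k j) (v j) :=
          continuous_of_discreteTopology
        exact this.comp continuous_fst
      map_add' := fun v w => Pieces.ext fun x => by simp
      map_smul' := fun c w => Pieces.ext fun x => by simp }

theorem initial_apply (v : Fin k → Fin n → ℂ) (x : Fin k × unitInterval) :
    D.initial k v x = D.fund (piecePt k x) (D.fundInv (node k x.1) (v x.1)) := rfl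

variable (n k) in
/-- The end values of the preceding pieces, without the wrap-around. -/
def endInner : Pieces k n →L[ℂ] (Fin k → Fin n → ℂ) :=
  ContinuousLinearMap.pi fun j => if j = 0 then 0 else Pieces.eval (j - 1, 1)

variable (n k) in
/-- The end value of the last piece, as data for the first one. -/
def endOuter : Pieces k n →L[ℂ] (Fin k → Fin n → ℂ) :=
  ContinuousLinearMap.pi fun j => if j = 0 then Pieces.eval (j - 1, 1) else 0

/-- In `Fin k` the predecessor of 0 is the last index, so one formula covers the inner nodes and the
wrap-around; only the latter carries the factor c. -/
theorem end_apply (c : ℂ) (w : Pieces k n) (j : Fin k) :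
    (endInner n k w + c • endOuter n k w) j = (if j = 0 then c else 1) • w (j - 1, 1) := by
  by_cases hj : j = 0 <;> simp [endInner, endOuter, hj]

/-- The operator `I - p J₁ - q J₂` of the integral equation. -/
def pencil (k : ℕ) [NeZero k] (p q : ℂ) : Pieces k n →L[ℂ] Pieces k n :=
  ContinuousLinearMap.id ℂ _ - (p • D.volterraNear k + q • D.volterraFar k)

/-- The characteristic operator, in terms of `x(t) = e^{μ t} y(t)`. -/
def charOp (k : ℕ) [NeZero k] (p q c : ℂ) : (Fin k → Fin n → ℂ) →L[ℂ] (Fin k → Fin n → ℂ) :=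
  ContinuousLinearMap.id ℂ _ - (endInner n k + c • endOuter n k).comp
    ((Ring.inverse (D.pencil k p q)).comp (D.initial k))

theorem eq_inverse_pencil_iff {p q : ℂ} (h : IsUnit (D.pencil k p q)) (v : Fin k → Fin n → ℂ)
    (w : Pieces k n) : w = Ring.inverse (D.pencil k p q) (D.initial k v) ↔
      w = D.initial k v + (p • D.volterraNear k w + q • D.volterraFar k w) := by
  have h1 : ∀ u, Ring.inverse (D.pencil k p q) (D.pencil k p q u) = u := fun u =>
    congrArg (fun T : Pieces k n →L[ℂ] Pieces k n => T u) (Ring.inverse_mul_cancel _ h)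
  have h2 : ∀ u, D.pencil k p q (Ring.inverse (D.pencil k p q) u) = u := fun u =>
    congrArg (fun T : Pieces k n →L[ℂ] Pieces k n => T u) (Ring.mul_inverse_cancel _ h)
  have h3 : D.pencil k p q w = w - (p • D.volterraNear k w + q • D.volterraFar k w) := rfl
  constructor
  · intro hw
    have h4 := h2 (D.initial k v)
    rw [← hw, h3] at h4
    rw [← h4, sub_add_cancel]
  · intro hw
    have h4 := h1 w
    rw [h3, sub_eq_of_eq_add hw] at h4
    exact h4.symm

theorem initial_apply_zero (v : Fin k → Fin n → ℂ) (j : Fin k) : D.initial k v (j, 0) = v j := by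
  simp [initial_apply, piecePt_zero]

theorem volterra_apply_zero (p q : ℂ) (w : Pieces k n) (j : Fin k) :
    (p • D.volterraNear k w + q • D.volterraFar k w) (j, 0) = 0 := by
  rw [volterra_apply, piecePt_zero]
  simp

end PeriodicDDE

end LargeDelay
end

noncomputable section

namespace LargeDelay

set_option linter.unusedSectionVars false

namespace PeriodicDDE

variable {n : ℕ} (D : PeriodicDDE n) {k : ℕ} [NeZero k]

/-! ### Solvability of the integral equation -/

theorem supNorm_nonneg (M : ℝ → Matrix (Fin n) (Fin n) ℝ) : 0 ≤ supNorm M :=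
  Real.iSup_nonneg fun _ => NNReal.coe_nonneg _

theorem norm_mulVec_le_supNorm {M : ℝ → Matrix (Fin n) (Fin n) ℝ} (hM : Continuous M) {t : ℝ}
    (ht : t ∈ Icc (-1 : ℝ) 0) (v : Fin n → ℂ) :
    ‖(M t).map Complex.ofReal *ᵥ v‖ ≤ supNorm M * ‖v‖ := by
  have hc : Continuous fun t : Icc (-1 : ℝ) 0 =>
      ((Finset.univ.sup fun i => ∑ j, ‖M t i j‖₊ : ℝ≥0) : ℝ) := by
    refine NNReal.continuous_coe.comp (Continuous.finset_sup_apply fun i _ => ?_)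
    exact continuous_finsetSum _ fun j _ => continuous_nnnorm.comp
      ((hM.comp continuous_subtype_val).matrix_elem i j)
  have hle := le_ciSup (isCompact_range hc).bddAbove ⟨t, ht⟩
  refine (pi_norm_le_iff_of_nonneg (mul_nonneg (supNorm_nonneg M) (norm_nonneg v))).2 fun i => ?_
  have h1 : ∑ j, ‖M t i j‖ ≤ supNorm M := by
    refine le_trans ?_ hle
    have := Finset.le_sup (f := fun i => ∑ j, ‖M t i j‖₊) (Finset.mem_univ i)
    have h2 : ((∑ j, ‖M t i j‖₊ : ℝ≥0) : ℝ) ≤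
      ((Finset.univ.sup fun i => ∑ j, ‖M t i j‖₊ : ℝ≥0) : ℝ) := NNReal.coe_le_coe.2 this
    simpa using h2
  calc ‖((M t).map Complex.ofReal *ᵥ v) i‖ ≤ ∑ j, ‖M t i j‖ * ‖v‖ := by
        change ‖∑ j, (M t).map Complex.ofReal i j * v j‖ ≤ _
        refine (norm_sum_le _ _).trans (Finset.sum_le_sum fun j _ => ?_)
        rw [norm_mul, Matrix.map_apply, Complex.norm_real]
        exact mul_le_mul_of_nonneg_left (norm_le_pi_norm v j) (norm_nonneg _)
    _ = (∑ j, ‖M t i j‖) * ‖v‖ := by rw [Finset.sum_mul]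
    _ ≤ _ := mul_le_mul_of_nonneg_right h1 (norm_nonneg _)

theorem hasDerivWithinAt_fund_apply {t : ℝ} (ht : t ∈ Icc (-1 : ℝ) 0) (v : Fin n → ℂ) :
    HasDerivWithinAt (fun r => D.fund r v) (D.Ac t *ᵥ D.fund t v) (Icc (-1) 0) t := by
  have := hasDerivWithinAt_clm_apply (D.hasDerivWithinAt_fund ht)
    (hasDerivWithinAt_const t (Icc (-1 : ℝ) 0) v)
  simp only [map_zero, add_zero] at this
  exact this

/-- Grönwall's inequality for the solution starting at s with value v. -/
theorem norm_fund_fundInv_le {s t : ℝ} (hs : -1 ≤ s) (hst : s ≤ t) (ht : t ≤ 0)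
    (v : Fin n → ℂ) :
    ‖D.fund t (D.fundInv s v)‖ ≤ ‖v‖ * Real.exp (supNorm D.A * (t - s)) := by
  have h := norm_le_gronwallBound_of_norm_deriv_right_le (a := s) (b := t) (δ := ‖v‖)
    (f := fun r => D.fund r (D.fundInv s v))
    (f' := fun r => D.Ac r *ᵥ D.fund r (D.fundInv s v)) (K := supNorm D.A) (ε := 0)
    (D.continuous_fund.clm_apply continuous_const).continuousOn
    (fun r hr => (D.hasDerivWithinAt_fund_apply ⟨hs.trans hr.1, hr.2.le.trans ht⟩
      (D.fundInv s v)).mono_of_mem_nhdsWithin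
        (Icc_mem_nhdsGE_of_mem ⟨hs.trans hr.1, hr.2.trans_le ht⟩))
    (by rw [fund_fundInv])
    (fun r hr => by
      rw [add_zero]
      exact norm_mulVec_le_supNorm D.continuous_A ⟨hs.trans hr.1, hr.2.le.trans ht⟩ _)
    t ⟨hst, le_rfl⟩
  rwa [gronwallBound_ε0] at h

/-- This is where k > ‖A‖ + R enters: the exponent (‖A‖ - Re μ)(t - s) is at most k · (1/k) = 1 on a
subinterval. -/
theorem norm_exp_fund_fundInv_le {μ : ℂ} {r : ℝ} (hμ : -r ≤ μ.re) (hA : supNorm D.A + r ≤ k)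
    {s t : ℝ} (hs : -1 ≤ s) (hst : s ≤ t) (ht : t ≤ 0) (hts : t - s ≤ 1 / k) (v : Fin n → ℂ) :
    ‖Complex.exp (-μ * (t - s)) • D.fund t (D.fundInv s v)‖ ≤ Real.exp 1 * ‖v‖ := by
  have hk := cast_pos_of_neZero (k := k)
  rw [norm_smul, Complex.norm_exp]
  have h1 : (-μ * ((t : ℂ) - s)).re = -μ.re * (t - s) := by
    rw [← Complex.ofReal_sub, Complex.re_mul_ofReal, Complex.neg_re]
  rw [h1]
  refine (mul_le_mul_of_nonneg_left (D.norm_fund_fundInv_le hs hst ht v)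
    (Real.exp_pos _).le).trans ?_
  rw [mul_left_comm, ← Real.exp_add, mul_comm ‖v‖]
  refine mul_le_mul_of_nonneg_right (Real.exp_le_exp.2 ?_) (norm_nonneg _)
  have h2 : 0 ≤ t - s := sub_nonneg.2 hst
  have h3 : (k : ℝ) * (t - s) ≤ 1 := by
    have := mul_le_mul_of_nonneg_left hts hk.le
    rwa [mul_one_div_cancel hk.ne'] at this
  nlinarith [mul_le_mul_of_nonneg_right (show supNorm D.A - μ.re ≤ k by linarith) h2]

variable (n k) in
/-- Multiplication by `t ↦ exp (μ t)`. -/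
def mulExp (μ : ℂ) : Pieces k n →L[ℂ] Pieces k n :=
  LinearMap.mkContinuousOfExistsBound
    { toFun := fun w => Pieces.mk (fun x => Complex.exp (μ * piecePt k x) • w x) <| by
        have := continuous_piecePt (k := k)
        have := w.continuous
        fun_prop
      map_add' := fun v w => Pieces.ext fun x => by simp
      map_smul' := fun c w => Pieces.ext fun x => by simp [smul_comm c] }
    (by
      have hc : Continuous fun x : Fin k × unitInterval => Complex.exp (μ * piecePt k x) := by
        have := continuous_piecePt (k := k)
        fun_prop
      obtain ⟨C, hC⟩ := isCompact_univ.exists_bound_of_continuousOn hc.continuousOn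
      have hC0 : 0 ≤ C := (norm_nonneg _).trans (hC (0, 0) (mem_univ _))
      refine ⟨C, fun w => Pieces.norm_le (by positivity) fun x => ?_⟩
      change ‖Complex.exp (μ * piecePt k x) • w x‖ ≤ _
      rw [norm_smul]
      exact mul_le_mul (hC x (mem_univ _)) (w.norm_apply_le x) (norm_nonneg _) hC0)

theorem mulExp_apply (μ : ℂ) (w : Pieces k n) (x : Fin k × unitInterval) :
    mulExp n k μ w x = Complex.exp (μ * piecePt k x) • w x := rfl

theorem mulExp_neg_mulExp (μ : ℂ) (w : Pieces k n) :
    mulExp n k (-μ) (mulExp n k μ w) = w := by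
  refine Pieces.ext fun x => ?_
  rw [mulExp_apply, mulExp_apply, smul_smul, ← Complex.exp_add, neg_mul, neg_add_cancel,
    Complex.exp_zero, one_smul]

theorem mulExp_mulExp_neg (μ : ℂ) (w : Pieces k n) :
    mulExp n k μ (mulExp n k (-μ) w) = w := by
  have := mulExp_neg_mulExp (-μ) w
  rwa [neg_neg] at this

theorem pmod_sub_τ {s : ℝ} (hs : s ∈ Ico (-1 : ℝ) 0) :
    (-1 ≤ s - D.τ ∧ pmod (s - D.τ) = s - D.τ) ∨
      (s - D.τ < -1 ∧ pmod (s - D.τ) = s - D.τ + 1) := by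
  have h0 := D.τ_mem.1
  have h1 := D.τ_mem.2
  rcases le_or_gt (-1) (s - D.τ) with h | h
  · exact Or.inl ⟨h, pmod_of_mem ⟨h, by linarith [hs.2]⟩⟩
  · refine Or.inr ⟨h, ?_⟩
    rw [← pmod_add_one, pmod_of_mem ⟨by linarith [hs.1], by linarith⟩]

/-- The two weights are the two possible values of z e^{μ(s - (s-τ) mod)}: the difference in the
exponent is τ without wrap-around and τ - 1 with it. -/
theorem lagged_exp (μ z : ℂ) (w : Pieces k n) {s : ℝ} (hs : s ∈ Ico (-1 : ℝ) 0) :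
    D.lagged (z * Complex.exp (μ * D.τ)) (z * Complex.exp (μ * (D.τ - 1))) w s =
      (z * Complex.exp (μ * (s - pmod (s - D.τ)))) • liftPieces w (s - D.τ) := by
  rw [lagged]
  congr 1
  rcases D.pmod_sub_τ hs with ⟨h, h1⟩ | ⟨h, h1⟩
  · rw [(D.weight_true h).1, (D.weight_true h).2, h1]
    push_cast
    ring_nf
  · rw [(D.weight_false h).1, (D.weight_false h).2, h1]
    push_cast
    ring_nf

theorem liftPieces_mulExp (μ : ℂ) (w : Pieces k n) (t : ℝ) :
    liftPieces (mulExp n k μ w) t = Complex.exp (μ * pmod t) • liftPieces w t := by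
  rw [liftPieces, mulExp_apply, piecePt_pieceOf]
  rfl

/-- Undoing the substitution x = e^{μt} y recovers the delay term of the integral equation with the
μ-propagator, which is the form that can be estimated. -/
theorem conj_volterra_apply (μ z : ℂ) (w : Pieces k n) (x : Fin k × unitInterval) :
    mulExp n k (-μ) ((z * Complex.exp (μ * D.τ)) • D.volterraNear k (mulExp n k μ w) +
      (z * Complex.exp (μ * (D.τ - 1))) • D.volterraFar k (mulExp n k μ w)) x =
      z • ∫ s in (node k x.1)..(piecePt k x), Complex.exp (-μ * (piecePt k x - s)) •
        D.fund (piecePt k x) (D.fundInv s (D.opB s (liftPieces w (s - D.τ)))) := by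
  rw [mulExp_apply, volterra_apply,
    ← (D.fund (piecePt k x)).intervalIntegral_comp_comm (D.intervalIntegrable_lagged _ _ _ _ _),
    ← intervalIntegral.integral_smul, ← intervalIntegral.integral_smul]
  refine intervalIntegral_congr_Ioo (node_le_piecePt x) fun s hs => ?_
  have hs' : s ∈ Ico (-1 : ℝ) 0 :=
    ⟨(node_mem x.1).1.trans hs.1.le, hs.2.trans_le (piecePt_mem x).2⟩
  rw [D.lagged_exp μ z _ hs', liftPieces_mulExp, smul_smul, map_smul, map_smul, map_smul,
    smul_smul, smul_smul]
  congr 1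
  rw [mul_assoc z, ← Complex.exp_add, mul_left_comm, ← Complex.exp_add]
  congr 2
  ring

/-- The pencil is similar to I - K, where K is the delay term written for y. The bounds |z| ≤ e^r,
propagator ≤ e, and subinterval length ≤ 1/k give ‖K‖ ≤ ‖B‖ e^{1+r}/k < 1, so the Neumann series
applies. -/
theorem isUnit_pencil {r : ℝ} (hA : supNorm D.A + r ≤ k)
    (hB : supNorm D.B * Real.exp (1 + r) < k) {μ z : ℂ} (hμ : -r ≤ μ.re)
    (hz : ‖z‖ ≤ Real.exp r) :
    IsUnit (D.pencil k (z * Complex.exp (μ * D.τ)) (z * Complex.exp (μ * (D.τ - 1)))) := by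
  have hk := cast_pos_of_neZero (k := k)
  set T : Pieces k n →L[ℂ] Pieces k n := (z * Complex.exp (μ * D.τ)) • D.volterraNear k +
    (z * Complex.exp (μ * (D.τ - 1))) • D.volterraFar k with hT
  set K : Pieces k n →L[ℂ] Pieces k n := mulExp n k (-μ) * T * mulExp n k μ with hK
  have hb0 := supNorm_nonneg D.B
  have hKn : ‖K‖ ≤ supNorm D.B * Real.exp (1 + r) / k := by
    refine ContinuousLinearMap.opNorm_le_bound _ (by positivity) fun w =>
      Pieces.norm_le (by positivity) fun x => ?_
    have h1 : K w x = _ := D.conj_volterra_apply μ z w x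
    rw [h1, norm_smul]
    have h2 := intervalIntegral.norm_integral_le_of_norm_le_const (a := node k x.1)
      (b := piecePt k x) (C := Real.exp 1 * (supNorm D.B * ‖w‖))
      (f := fun s : ℝ => Complex.exp (-μ * (piecePt k x - s)) •
        D.fund (piecePt k x) (D.fundInv s (D.opB s (liftPieces w (s - D.τ))))) (by
        intro s hs
        rw [uIoc_of_le (node_le_piecePt x)] at hs
        have hs1 : -1 ≤ s := (node_mem x.1).1.trans hs.1.le
        refine (D.norm_exp_fund_fundInv_le (k := k) hμ hA hs1 hs.2 (piecePt_mem x).2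
          (by linarith [piecePt_sub_node_le x, hs.1]) _).trans ?_
        refine mul_le_mul_of_nonneg_left ?_ (Real.exp_pos _).le
        exact (norm_mulVec_le_supNorm D.continuous_B ⟨hs1, hs.2.trans (piecePt_mem x).2⟩ _).trans
          (mul_le_mul_of_nonneg_left (norm_liftPieces_le w _) hb0))
    rw [abs_of_nonneg (sub_nonneg.2 (node_le_piecePt x))] at h2
    have h3 : Real.exp 1 * (supNorm D.B * ‖w‖) * (piecePt k x - node k x.1) ≤
        Real.exp 1 * (supNorm D.B * ‖w‖) * (1 / k) :=
      mul_le_mul_of_nonneg_left (piecePt_sub_node_le x) (by positivity)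
    calc _ ≤ Real.exp r * (Real.exp 1 * (supNorm D.B * ‖w‖) * (1 / k)) :=
          mul_le_mul hz (h2.trans h3) (norm_nonneg _) (Real.exp_pos _).le
      _ = _ := by
          rw [Real.exp_add]
          ring
  have hK1 : ‖K‖ < 1 := hKn.trans_lt (by rwa [div_lt_one hk])
  have hu : IsUnit (1 - K) := isUnit_one_sub_of_norm_lt_one hK1
  have h1 : mulExp n k μ * mulExp n k (-μ) = 1 := ContinuousLinearMap.ext fun w =>
    mulExp_mulExp_neg μ w
  have h2 : mulExp n k (-μ) * mulExp n k μ = 1 := ContinuousLinearMap.ext fun w =>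
    mulExp_neg_mulExp μ w
  have hm : IsUnit (mulExp n k μ) := ⟨⟨_, _, h1, h2⟩, rfl⟩
  have hm' : IsUnit (mulExp n k (-μ)) := ⟨⟨_, _, h2, h1⟩, rfl⟩
  have h3 : D.pencil k (z * Complex.exp (μ * D.τ)) (z * Complex.exp (μ * (D.τ - 1))) =
      mulExp n k μ * (1 - K) * mulExp n k (-μ) := by
    have h4 : mulExp n k μ * K * mulExp n k (-μ) = T := by
      calc _ = (mulExp n k μ * mulExp n k (-μ)) * T * (mulExp n k μ * mulExp n k (-μ)) := by
            simp only [hK, mul_assoc]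
        _ = T := by rw [h1, one_mul, mul_one]
    have h5 : mulExp n k μ * (1 - K) * mulExp n k (-μ) = 1 - T := by
      rw [mul_sub, sub_mul, mul_one, h1, h4]
    rw [h5]
    rfl
  rw [h3]
  exact (hm.mul hu).mul hm'

/-! ### The characteristic function -/

/-- The parameter space is kept general: ℂ × ℂ gives joint holomorphy of h, and ℂ serves the curves
along which orders are counted. -/
theorem analyticAt_charOp {W : Type*} [NormedAddCommGroup W] [NormedSpace ℂ W] {p q c : W → ℂ}
    {x : W} (hp : AnalyticAt ℂ p x) (hq : AnalyticAt ℂ q x) (hc : AnalyticAt ℂ c x)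
    (hu : IsUnit (D.pencil k (p x) (q x))) :
    AnalyticAt ℂ (fun y => D.charOp k (p y) (q y) (c y)) x := by
  have h1 : AnalyticAt ℂ (fun y => D.pencil k (p y) (q y)) x :=
    analyticAt_const.sub ((hp.smul analyticAt_const).add (hq.smul analyticAt_const))
  have h2 : AnalyticAt ℂ (fun y => Ring.inverse (D.pencil k (p y) (q y))) x := by
    have := analyticAt_inverse (𝕜 := ℂ) hu.unit
    exact AnalyticAt.comp (g := Ring.inverse) (by simpa using this) h1
  exact analyticAt_const.sub (analyticAt_clm_comp
    (analyticAt_const.add (hc.smul analyticAt_const)) (analyticAt_clm_comp h2 analyticAt_const))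

/-- The characteristic operator at `(μ, z)` in terms of `x(t) = e^{μ t} y(t)`. -/
def charOpAt (k : ℕ) [NeZero k] (μ z : ℂ) : (Fin k → Fin n → ℂ) →L[ℂ] (Fin k → Fin n → ℂ) :=
  D.charOp k (z * Complex.exp (μ * D.τ)) (z * Complex.exp (μ * (D.τ - 1))) (Complex.exp (-μ))

/-- The characteristic function. -/
def charFun (k : ℕ) [NeZero k] (x : ℂ × ℂ) : ℂ := (D.charOpAt k x.1 x.2).det

theorem analyticAt_charFun {x : ℂ × ℂ} (hu : IsUnit (D.pencil k (x.2 * Complex.exp (x.1 * D.τ))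
    (x.2 * Complex.exp (x.1 * (D.τ - 1))))) : AnalyticAt ℂ (D.charFun k) x := by
  refine analyticAt_det (f := fun x : ℂ × ℂ => D.charOpAt k x.1 x.2) ?_
  have h1 : AnalyticAt ℂ (fun x : ℂ × ℂ => x.1) x := analyticAt_fst
  have h2 : AnalyticAt ℂ (fun x : ℂ × ℂ => x.2) x := analyticAt_snd
  exact D.analyticAt_charOp (h2.mul (h1.mul analyticAt_const).cexp)
    (h2.mul (h1.mul analyticAt_const).cexp) h1.neg.cexp hu

end PeriodicDDE

end LargeDelay
end

noncomputable section

namespace LargeDelay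

set_option linter.unusedSectionVars false

/-! ### Piecewise continuous functions with left limits, as tuples of pieces -/

section Pieces

variable {k n : ℕ} [NeZero k]

open PeriodicDDE (node)

/-- The parameter of `t` in the subinterval `[t_j, t_{j+1}]`. -/
def pieceParam (j : Fin k) (t : ℝ) : unitInterval :=
  projIcc 0 1 zero_le_one (k * (t - node k j))

theorem continuous_pieceParam (j : Fin k) : Continuous (pieceParam j) :=
  continuous_projIcc.comp (by fun_prop)

theorem node_succ (j : ℕ) : node k (j + 1) = node k j + 1 / k := by
  simp only [node]
  push_cast
  ring

theorem node_lt_succ (j : ℕ) : node k j < node k (j + 1) := by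
  rw [node_succ]
  exact lt_add_of_pos_right _ (one_div_pos.2 cast_pos_of_neZero)

theorem node_succ_le_zero (j : Fin k) : node k (j + 1) ≤ 0 := by
  rw [← piecePt_one]
  exact (piecePt_mem _).2

theorem coe_pieceParam {j : Fin k} {t : ℝ} (ht : t ∈ Icc (node k j) (node k (j + 1))) :
    (pieceParam j t : ℝ) = k * (t - node k j) := by
  have hk := cast_pos_of_neZero (k := k)
  have h1 : (k : ℝ) * (t - node k j) ∈ Icc (0 : ℝ) 1 := by
    refine ⟨mul_nonneg hk.le (sub_nonneg.2 ht.1), ?_⟩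
    have h2 := ht.2
    rw [node_succ, ← sub_le_iff_le_add', le_div_iff₀ hk] at h2
    linarith
  rw [pieceParam, projIcc_of_mem _ h1]

theorem piecePt_pieceParam {j : Fin k} {t : ℝ} (ht : t ∈ Icc (node k j) (node k (j + 1))) :
    piecePt k (j, pieceParam j t) = t := by
  have hk := (cast_pos_of_neZero (k := k)).ne'
  rw [piecePt, coe_pieceParam ht]
  field_simp
  ring

theorem pieceParam_lt {j : Fin k} {t : ℝ} (ht : t ∈ Ico (node k j) (node k (j + 1))) :
    (pieceParam j t : ℝ) < 1 := by
  have hk := cast_pos_of_neZero (k := k)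
  rw [coe_pieceParam (Ico_subset_Icc_self ht)]
  have h2 := ht.2
  rw [node_succ, ← sub_lt_iff_lt_add', lt_div_iff₀ hk] at h2
  linarith

theorem pieceParam_node_succ (j : Fin k) : pieceParam j (node k (j + 1)) = 1 := by
  have hk := (cast_pos_of_neZero (k := k)).ne'
  refine Subtype.ext ?_
  rw [coe_pieceParam ⟨(node_lt_succ _).le, le_rfl⟩, node_succ]
  simp [hk]

theorem liftPieces_eq_pieceParam (w : Pieces k n) {j : Fin k} {t : ℝ}
    (ht : t ∈ Ico (node k j) (node k (j + 1))) : liftPieces w t = w (j, pieceParam j t) := by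
  rw [← liftPieces_piecePt w (p := (j, pieceParam j t)) (pieceParam_lt ht),
    piecePt_pieceParam (Ico_subset_Icc_self ht)]

theorem mem_Ico_of_mem_piece {j : Fin k} {t : ℝ} (ht : t ∈ Ico (node k j) (node k (j + 1))) :
    t ∈ Ico (-1 : ℝ) 0 :=
  ⟨(node_mem j).1.trans ht.1, ht.2.trans_le (node_succ_le_zero j)⟩

theorem piecePt_mem_piece {x : Fin k × unitInterval} (hx : (x.2 : ℝ) < 1) :
    piecePt k x ∈ Ico (node k x.1) (node k (x.1 + 1)) := by
  refine ⟨node_le_piecePt x, ?_⟩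
  have := cast_pos_of_neZero (k := k)
  rw [piecePt, node_succ]
  gcongr

theorem continuous_pieces_comp (w : Pieces k n) (j : Fin k) :
    Continuous fun t => w (j, pieceParam j t) :=
  w.continuous.comp (continuous_const.prodMk (continuous_pieceParam j))

theorem tendsto_node_of_eq_lift {y : ℝ → Fin n → ℂ} {w : Pieces k n}
    (h : ∀ t ∈ Ico (-1 : ℝ) 0, y t = liftPieces w t) (j : Fin k) :
    Tendsto y (𝓝[<] (node k (j + 1))) (𝓝 (w (j, 1))) := by
  have h1 : Tendsto (fun t => w (j, pieceParam j t)) (𝓝[<] (node k (j + 1))) (𝓝 (w (j, 1))) := by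
    have := (continuous_pieces_comp w j).tendsto (node k (j + 1))
    rw [pieceParam_node_succ] at this
    exact this.mono_left nhdsWithin_le_nhds
  refine h1.congr' ?_
  filter_upwards [Ico_mem_nhdsLT (node_lt_succ (k := k) j)] with t ht
  rw [h t (mem_Ico_of_mem_piece ht), liftPieces_eq_pieceParam w ht]

theorem continuousOn_of_eq_lift {y : ℝ → Fin n → ℂ} {w : Pieces k n}
    (h : ∀ t ∈ Ico (-1 : ℝ) 0, y t = liftPieces w t) (j : Fin k) :
    ContinuousOn y (Ico (node k j) (node k (j + 1))) :=
  (continuous_pieces_comp w j).continuousOn.congr fun t ht => by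
    rw [h t (mem_Ico_of_mem_piece ht), liftPieces_eq_pieceParam w ht]

/-- On each subinterval the value at the right end is replaced by the left limit, which makes the
restriction continuous on the closed subinterval. -/
theorem exists_pieces {y : ℝ → Fin n → ℂ}
    (hc : ∀ j : Fin k, ContinuousOn y (Ico (node k j) (node k (j + 1))))
    (hl : ∀ j : Fin k, ∃ l, Tendsto y (𝓝[<] (node k (j + 1))) (𝓝 l)) :
    ∃ w : Pieces k n, ∀ t ∈ Ico (-1 : ℝ) 0, y t = liftPieces w t := by
  choose l hl using hl
  have hu : ∀ j : Fin k, ContinuousOn (Function.update y (node k (j + 1)) (l j))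
      (Icc (node k j) (node k (j + 1))) := by
    intro j
    rw [continuousOn_update_iff, Icc_sdiff_right]
    refine ⟨hc j, fun _ => ?_⟩
    rw [nhdsWithin_Ico_eq_nhdsLT (node_lt_succ _)]
    exact hl j
  refine ⟨Pieces.mk (fun x => Function.update y (node k (x.1 + 1)) (l x.1) (piecePt k x)) ?_, ?_⟩
  · rw [continuous_prod_of_discrete_left]
    intro j
    refine (hu j).comp_continuous (continuous_piecePt.comp (by fun_prop)) fun σ => ?_
    refine ⟨node_le_piecePt (j, σ), ?_⟩
    rw [node_succ]
    linarith [piecePt_sub_node_le (j, σ)]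
  · intro t ht
    have h1 := pieceOf_snd_lt (k := k) t
    rw [liftPieces, Pieces.mk_apply, piecePt_pieceOf, pmod_of_mem ht, Function.update_of_ne]
    have := (piecePt_mem_piece h1).2
    rw [piecePt_pieceOf, pmod_of_mem ht] at this
    exact this.ne

/-- The lifted function never sees the parameter value 1; continuity recovers it as the left limit
at the next node. -/
theorem eq_of_eq_off_end {v w : Pieces k n}
    (h : ∀ x : Fin k × unitInterval, (x.2 : ℝ) < 1 → v x = w x) : v = w := by
  refine Pieces.ext fun x => ?_
  have h1 := tendsto_node_of_eq_lift (y := liftPieces v) (w := v) (fun _ _ => rfl) x.1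
  have h2 := tendsto_node_of_eq_lift (y := liftPieces v) (w := w)
    (fun t _ => h _ (pieceOf_snd_lt t)) x.1
  rcases eq_or_lt_of_le x.2.2.2 with hx | hx
  · have : x = (x.1, 1) := Prod.ext rfl (Subtype.ext hx)
    rw [this]
    exact tendsto_nhds_unique h1 h2
  · exact h x hx

theorem val_sub_one_add_one {j : Fin k} (hj : j ≠ 0) : ((j - 1 : Fin k) : ℕ) + 1 = j := by
  have h1 : 1 ≤ (j : ℕ) := Nat.one_le_iff_ne_zero.2 fun h => hj (Fin.ext h)
  have h2 : 1 < k := lt_of_le_of_lt h1 j.2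
  have h3 : ((1 : Fin k) : ℕ) = 1 := by
    rw [Fin.val_one']
    exact Nat.mod_eq_of_lt h2
  rw [Fin.sub_val_of_le (by rw [Fin.le_def, h3]; exact h1), h3]
  omega

theorem val_zero_sub_one_add_one : ((0 - 1 : Fin k) : ℕ) + 1 = k := by
  obtain ⟨m, rfl⟩ := Nat.exists_eq_succ_of_ne_zero (NeZero.ne k)
  have : (0 - 1 : Fin (m + 1)) = Fin.last m := by
    rw [sub_eq_iff_eq_add, Fin.last_add_one]
  rw [this]
  simp

end Pieces

namespace PeriodicDDE

variable {n : ℕ} (D : PeriodicDDE n) {k : ℕ} [NeZero k]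

/-! ### Solutions of the integral equation -/

/-- Multiplication of the data at `t_j` by `exp (μ t_j)`. -/
def nodeExp (n k : ℕ) (μ : ℂ) : (Fin k → Fin n → ℂ) ≃ₗ[ℂ] (Fin k → Fin n → ℂ) :=
  LinearEquiv.piCongrRight fun j =>
    LinearEquiv.smulOfNeZero ℂ (Fin n → ℂ) (Complex.exp (μ * node k j)) (Complex.exp_ne_zero _)

theorem nodeExp_apply (μ : ℂ) (v : Fin k → Fin n → ℂ) (j : Fin k) :
    nodeExp n k μ v j = Complex.exp (μ * node k j) • v j := rfl

theorem nodeExp_symm_apply (μ : ℂ) (v : Fin k → Fin n → ℂ) (j : Fin k) :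
    (nodeExp n k μ).symm v j = Complex.exp (-μ * node k j) • v j := by
  have h : v = nodeExp n k μ fun j => Complex.exp (-μ * node k j) • v j := by
    funext j
    rw [nodeExp_apply, smul_smul, ← Complex.exp_add, neg_mul, add_neg_cancel, Complex.exp_zero,
      one_smul]
  conv_lhs => rw [h]
  rw [LinearEquiv.symm_apply_apply]

/-- The solution of the integral equation. -/
def shootingPieces (k : ℕ) [NeZero k] (μ z : ℂ) (v : Fin k → Fin n → ℂ) : Pieces k n :=
  mulExp n k (-μ) (Ring.inverse (D.pencil k (z * Complex.exp (μ * D.τ))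
    (z * Complex.exp (μ * (D.τ - 1)))) (D.initial k (nodeExp n k μ v)))

/-- Identifies the right-hand side of the integral equation with the fixed-point map of the pencil,
conjugated by e^{μt}. -/
theorem shooting_rhs {μ z : ℂ} {v : Fin k → Fin n → ℂ} {y : ℝ → Fin n → ℂ} {w : Pieces k n}
    (h : ∀ t ∈ Ico (-1 : ℝ) 0, y t = liftPieces w t) (x : Fin k × unitInterval) :
    D.propagator μ (piecePt k x) (node k x.1) (v x.1) + z • ∫ s in (node k x.1)..(piecePt k x),
        D.propagator μ (piecePt k x) s (D.Bc s *ᵥ y (pmod (s - D.τ))) =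
      mulExp n k (-μ) (D.initial k (nodeExp n k μ v) +
        ((z * Complex.exp (μ * D.τ)) • D.volterraNear k (mulExp n k μ w) +
          (z * Complex.exp (μ * (D.τ - 1))) • D.volterraFar k (mulExp n k μ w))) x := by
  rw [map_add, Pieces.add_apply, conj_volterra_apply, mulExp_apply, initial_apply, nodeExp_apply,
    map_smul, map_smul, smul_smul, ← Complex.exp_add,
    D.propagator_apply μ (node_mem x.1).1 (node_le_piecePt x) (piecePt_mem x).2]
  congr 2
  · congr 1
    ring
  · refine intervalIntegral_congr_Ioo (node_le_piecePt x) fun s hs => ?_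
    rw [D.propagator_apply μ ((node_mem x.1).1.trans hs.1.le) hs.2.le (piecePt_mem x).2,
      h _ (pmod_mem _), opB_apply, liftPieces, pieceOf_pmod]
    rfl

/-- A solution is the same as a fixed point in the space of pieces, which is unique as the pencil is
invertible. The value at 0 is the end value of the last piece, since by definition it is the left
limit. -/
theorem isShootingSolution_iff {μ z : ℂ} (hu : IsUnit (D.pencil k (z * Complex.exp (μ * D.τ))
    (z * Complex.exp (μ * (D.τ - 1))))) {v : Fin k → Fin n → ℂ} {y : ℝ → Fin n → ℂ} :
    D.IsShootingSolution k μ z v y ↔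
      (∀ t ∈ Ico (-1 : ℝ) 0, y t = liftPieces (D.shootingPieces k μ z v) t) ∧
        y 0 = D.shootingPieces k μ z v (0 - 1, 1) := by
  have hend : ∀ {w : Pieces k n}, (∀ t ∈ Ico (-1 : ℝ) 0, y t = liftPieces w t) →
      Tendsto y (𝓝[<] 0) (𝓝 (w (0 - 1, 1))) := fun h => by
    have := tendsto_node_of_eq_lift h (0 - 1)
    rwa [val_zero_sub_one_add_one, node_self] at this
  have hfix : ∀ w : Pieces k n, w = D.shootingPieces k μ z v ↔
      w = mulExp n k (-μ) (D.initial k (nodeExp n k μ v) +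
        ((z * Complex.exp (μ * D.τ)) • D.volterraNear k (mulExp n k μ w) +
          (z * Complex.exp (μ * (D.τ - 1))) • D.volterraFar k (mulExp n k μ w))) := by
    intro w
    have h1 := D.eq_inverse_pencil_iff hu (nodeExp n k μ v) (mulExp n k μ w)
    constructor
    · intro h
      rw [← h1.1 (by rw [h, shootingPieces, mulExp_mulExp_neg]), mulExp_neg_mulExp]
    · intro h
      rw [shootingPieces, ← h1.2 (by conv_lhs => rw [h, mulExp_mulExp_neg]), mulExp_neg_mulExp]
  constructor
  · intro hy
    obtain ⟨w, hw⟩ := exists_pieces hy.continuousOn hy.left_limit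
    have : w = D.shootingPieces k μ z v := by
      rw [hfix]
      refine eq_of_eq_off_end fun x hx => ?_
      rw [← D.shooting_rhs hw, ← hy.eqn x.1 _ (piecePt_mem_piece hx),
        hw _ (mem_Ico_of_mem_piece (piecePt_mem_piece hx)), liftPieces_piecePt w hx]
    subst this
    exact ⟨hw, tendsto_nhds_unique hy.end_value (hend hw)⟩
  · rintro ⟨h1, h2⟩
    refine ⟨continuousOn_of_eq_lift h1, fun j => ⟨_, tendsto_node_of_eq_lift h1 j⟩,
      h2 ▸ hend h1, fun j t ht => ?_⟩
    have h3 := D.shooting_rhs (μ := μ) (z := z) (v := v) h1 (j, pieceParam j t)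
    simp only [piecePt_pieceParam (Ico_subset_Icc_self ht)] at h3
    rw [h3, ← (hfix _).1 rfl, h1 t (mem_Ico_of_mem_piece ht), liftPieces_eq_pieceParam _ ht]

theorem exists_isShootingSolution {μ z : ℂ}
    (hu : IsUnit (D.pencil k (z * Complex.exp (μ * D.τ)) (z * Complex.exp (μ * (D.τ - 1)))))
    (v : Fin k → Fin n → ℂ) :
    ∃ y : ℝ → Fin n → ℂ, D.IsShootingSolution k μ z v y ∧
      ∀ y' : ℝ → Fin n → ℂ, D.IsShootingSolution k μ z v y' → EqOn y' y (Icc (-1) 0) := by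
  refine ⟨fun t => if t = 0 then D.shootingPieces k μ z v (0 - 1, 1) else
    liftPieces (D.shootingPieces k μ z v) t, (D.isShootingSolution_iff hu).2 ⟨fun t ht => ?_, ?_⟩,
    fun y' hy' t ht => ?_⟩
  · simp [ht.2.ne]
  · simp
  · rw [D.isShootingSolution_iff hu] at hy'
    rcases eq_or_lt_of_le ht.2 with rfl | h
    · simp [hy'.2]
    · simp only [h.ne, if_false]
      exact hy'.1 t ⟨ht.1, h⟩

/-- The characteristic matrix. -/
def charMatrix (k : ℕ) [NeZero k] (μ z : ℂ) : Matrix (Fin k × Fin n) (Fin k × Fin n) ℂ :=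
  LinearMap.toMatrix' (((nodeExp n k μ).symm.trans (LinearEquiv.curry ℂ ℂ (Fin k) (Fin n)).symm).conj
    (D.charOpAt k μ z : (Fin k → Fin n → ℂ) →ₗ[ℂ] (Fin k → Fin n → ℂ)))

/-- The matrix is the characteristic operator in another basis: conjugation by e^{μ t_j} at the
nodes leaves the determinant unchanged. -/
theorem det_charMatrix (μ z : ℂ) : (D.charMatrix k μ z).det = D.charFun k (μ, z) := by
  rw [charMatrix, LinearMap.det_toMatrix', LinearEquiv.conj_apply, LinearMap.comp_assoc,
    LinearMap.det_conj]
  rfl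

theorem charMatrix_mulVec (μ z : ℂ) (v : Fin k → Fin n → ℂ) (j : Fin k) (i : Fin n) :
    (D.charMatrix k μ z *ᵥ fun p => v p.1 p.2) (j, i) =
      v j i - D.shootingPieces k μ z v (j - 1, 1) i := by
  have h0 : (D.charMatrix k μ z *ᵥ fun p => v p.1 p.2) (j, i) =
      (nodeExp n k μ).symm (D.charOpAt k μ z (nodeExp n k μ v)) j i := by
    rw [charMatrix, LinearMap.toMatrix'_mulVec]
    rfl
  set w := Ring.inverse (D.pencil k (z * Complex.exp (μ * D.τ))
    (z * Complex.exp (μ * (D.τ - 1)))) (D.initial k (nodeExp n k μ v)) with hw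
  have h1 : D.charOpAt k μ z (nodeExp n k μ v) = nodeExp n k μ v -
    (endInner n k w + Complex.exp (-μ) • endOuter n k w) := rfl
  -- For j ≠ 0 the end of piece j - 1 is t_j itself. For j = 0 the feedback factor e^{-μ} cancels
  -- e^{-μ t_0} = e^{μ}, leaving 1, which is the exponential at the end point 0 of the last piece.
  have h2 : Complex.exp (-μ * node k j) * (if j = 0 then Complex.exp (-μ) else 1) =
      Complex.exp (-μ * node k ((j - 1 : Fin k) + 1)) := by
    by_cases hj : j = 0
    · subst hj
      rw [if_pos rfl, val_zero_sub_one_add_one, node_self, Fin.val_zero, node_zero,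
        ← Complex.exp_add]
      simp
    · rw [if_neg hj, val_sub_one_add_one hj, mul_one]
  have h3 : D.shootingPieces k μ z v (j - 1, 1) =
      Complex.exp (-μ * node k ((j - 1 : Fin k) + 1)) • w (j - 1, 1) := by
    rw [← piecePt_one]
    rfl
  rw [h0, h1, map_sub, LinearEquiv.symm_apply_apply, Pi.sub_apply, nodeExp_symm_apply, end_apply,
    smul_smul, h2, h3]
  rfl

theorem isCharacteristicMatrix_charMatrix {μ z : ℂ}
    (hu : IsUnit (D.pencil k (z * Complex.exp (μ * D.τ)) (z * Complex.exp (μ * (D.τ - 1))))) :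
    D.IsCharacteristicMatrix k μ z (D.charMatrix k μ z) := by
  intro v y hy j i
  rw [D.isShootingSolution_iff hu] at hy
  rw [charMatrix_mulVec]
  by_cases hj : j = 0
  · subst hj
    rw [Fin.val_zero, if_pos rfl, hy.2]
  · rw [if_neg (show ¬(j : ℕ) = 0 from fun h => hj (Fin.ext h))]
    have h1 := tendsto_node_of_eq_lift hy.1 (j - 1)
    rw [val_sub_one_add_one hj] at h1
    rw [leftLim_eq_of_tendsto h1]

end PeriodicDDE

end LargeDelay
end

noncomputable section

namespace LargeDelay

set_option linter.unusedSectionVars false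

/-! ### Gluing pieces to continuous functions on (-∞, 0] -/

section Pieces

variable {k n : ℕ} [NeZero k]

open PeriodicDDE (node)

theorem piecePt_end {l : Fin k} (hl : l ≠ 0) : piecePt k (l - 1, 1) = piecePt k (l, 0) := by
  rw [piecePt_one, piecePt_zero, val_sub_one_add_one hl]

theorem piecePt_last : piecePt k (0 - 1, 1) = 0 := by
  rw [piecePt_one, val_zero_sub_one_add_one, node_self]

theorem piecePt_first : piecePt k (0, 0) = -1 := by
  rw [piecePt_zero, Fin.val_zero, node_zero]

theorem exists_piecePt_eq {t : ℝ} (ht : t ∈ Icc (-1 : ℝ) 0) : ∃ x, piecePt k x = t := by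
  rcases eq_or_lt_of_le ht.2 with rfl | h
  · exact ⟨_, piecePt_last⟩
  · exact ⟨pieceOf k t, by rw [piecePt_pieceOf, pmod_of_mem ⟨ht.1, h⟩]⟩

/-- `y j` is placed on [-1-j, -j]; the hypotheses match the values at inner nodes and at negative
integers. -/
theorem exists_glue {y : ℕ → Pieces k n} (hin : ∀ j, ∀ l : Fin k, l ≠ 0 → y j (l, 0) = y j (l - 1, 1))
    (hout : ∀ j, y j (0, 0) = y (j + 1) (0 - 1, 1)) :
    ∃ f : ℝ → Fin n → ℂ, ContinuousOn f (Iic 0) ∧ ∀ (j : ℕ) x, f (piecePt k x - j) = y j x := by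
  let f : ℝ → Fin n → ℂ := fun t =>
    -- On [-1-j, -j) the ceiling of -t is j + 1. The point 0 needs its own clause, as truncated
    -- subtraction and reduction modulo 1 would assign it the value of `y 0` at -1.
    if t = 0 then y 0 (0 - 1, 1) else y (⌈-t⌉₊ - 1) (pieceOf k t)
  have h1 : ∀ (j : ℕ) (x : Fin k × unitInterval), (x.2 : ℝ) < 1 → f (piecePt k x - j) = y j x := by
    intro j x hx
    have h2 := mem_Ico_of_mem_piece (piecePt_mem_piece hx)
    have hj : (0 : ℝ) ≤ j := Nat.cast_nonneg j
    have h3 : ⌈-(piecePt k x - j)⌉₊ = j + 1 := by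
      rw [Nat.ceil_eq_iff (Nat.succ_ne_zero j)]
      push_cast
      constructor <;> linarith [h2.1, h2.2]
    have h4 : ∀ m : ℕ, pieceOf k (piecePt k x - m) = x := by
      intro m
      induction m with
      | zero => simpa using pieceOf_piecePt hx
      | succ m ih =>
        rw [← pieceOf_add_one]
        refine (congrArg (pieceOf k) ?_).trans ih
        push_cast
        ring
    have h5 : piecePt k x - j ≠ 0 := by linarith [h2.2]
    simp only [f, if_neg h5, h3, h4, Nat.add_sub_cancel]
  have h2 : ∀ (j : ℕ) x, f (piecePt k x - j) = y j x := by
    rintro j ⟨l, σ⟩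
    rcases eq_or_lt_of_le σ.2.2 with hσ | hσ
    · obtain rfl : σ = 1 := Subtype.ext hσ
      obtain ⟨m, rfl⟩ : ∃ m, l = m - 1 := ⟨l + 1, (add_sub_cancel_right l 1).symm⟩
      by_cases hm : m = 0
      · subst hm
        rw [piecePt_last]
        rcases j with _ | j
        · simp [f]
        · rw [← hout, ← h1 j (0, 0) (by simp), piecePt_first]
          congr 1
          push_cast
          ring
      · rw [piecePt_end hm, h1 j (m, 0) (by simp), hin j m hm]
    · exact h1 j _ hσ
  refine ⟨f, ?_, h2⟩
  -- The translated closed subintervals form a locally finite closed cover, so continuity may be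
  -- checked on each of them.
  let C : ℕ × Fin k → Set ℝ := fun i => Icc (node k i.2 - i.1) (node k (i.2 + 1) - i.1)
  have hlf : LocallyFinite C := by
    intro x
    refine ⟨Ioo (x - 1) (x + 1), Ioo_mem_nhds (by linarith) (by linarith), ?_⟩
    refine ((finite_Iic ⌈-x + 1⌉₊).prod (finite_univ (α := Fin k))).subset ?_
    rintro ⟨j, l⟩ ⟨t, ht, ht'⟩
    refine ⟨?_, mem_univ _⟩
    have h3 := node_succ_le_zero l
    have : (j : ℝ) ≤ ⌈-x + 1⌉₊ := by
      have h4 := Nat.le_ceil (-x + 1)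
      linarith [ht.2, ht'.1]
    exact_mod_cast this
  have hc := hlf.continuousOn_iUnion (g := f) (fun i => isClosed_Icc) (by
    rintro ⟨j, l⟩
    refine ((continuous_pieces_comp (y j) l).comp (continuous_id.add continuous_const)).continuousOn
      (s := C (j, l)) |>.congr (f := fun t : ℝ => y j (l, pieceParam l (t + j))) fun t ht => ?_
    have h3 : t + j ∈ Icc (node k l) (node k (l + 1)) := ⟨by linarith [ht.1], by linarith [ht.2]⟩
    simp only []
    rw [← h2 j, piecePt_pieceParam h3, add_sub_cancel_right])
  refine hc.mono fun t ht => ?_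
  rw [mem_iUnion]
  rcases eq_or_lt_of_le (mem_Iic.1 ht) with rfl | ht0
  · refine ⟨(0, 0 - 1), ?_⟩
    simp only [C]
    rw [val_zero_sub_one_add_one, node_self]
    simpa using (node_mem (0 - 1 : Fin k)).2
  · set x := pieceOf k t with hx
    have h3 := piecePt_mem_piece (pieceOf_snd_lt (k := k) t)
    rw [piecePt_pieceOf, ← hx] at h3
    have h4 : 1 ≤ ⌈-t⌉₊ := Nat.one_le_ceil_iff.2 (by linarith)
    have h5 : ⌊t⌋ < 0 := Int.floor_lt.2 (by simpa using ht0)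
    have h6 : (((-⌊t⌋ - 1).toNat : ℕ) : ℝ) = -⌊t⌋ - 1 := by
      have : (((-⌊t⌋ - 1).toNat : ℤ)) = -⌊t⌋ - 1 := Int.toNat_of_nonneg (by omega)
      exact_mod_cast this
    have h7 : PeriodicDDE.pmod t = t - ⌊t⌋ - 1 := by
      rw [PeriodicDDE.pmod, Int.fract]
    refine ⟨((-⌊t⌋ - 1).toNat, x.1), ?_⟩
    simp only [C, h6]
    rw [h7] at h3
    exact ⟨by linarith [h3.1], by linarith [h3.2]⟩

/-- The continuous periodic extension. -/
theorem exists_periodic_glue {w : Pieces k n} (h : ∀ l : Fin k, w (l, 0) = w (l - 1, 1)) :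
    ∃ f : ℝ → Fin n → ℂ, ContinuousOn f (Iic 0) ∧ (∀ x, f (piecePt k x) = w x) ∧
      ∀ r ≤ 0, f (r - 1) = liftPieces w r := by
  obtain ⟨f, hf, hfw⟩ := exists_glue (y := fun _ => w) (fun _ l _ => h l) (fun _ => h 0)
  refine ⟨f, hf, fun x => by simpa using hfw 0 x, fun r hr => ?_⟩
  have h1 : ⌊r⌋ ≤ 0 := by
    have : (⌊r⌋ : ℝ) ≤ 0 := (Int.floor_le r).trans hr
    exact_mod_cast this
  have h2 : (((-⌊r⌋).toNat : ℕ) : ℝ) = -⌊r⌋ := by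
    have : (((-⌊r⌋).toNat : ℤ)) = -⌊r⌋ := Int.toNat_of_nonneg (by omega)
    exact_mod_cast this
  rw [liftPieces, ← hfw (-⌊r⌋).toNat, piecePt_pieceOf, h2, PeriodicDDE.pmod, Int.fract]
  congr 1
  ring

end Pieces

namespace PeriodicDDE

variable {n : ℕ} (D : PeriodicDDE n) {k : ℕ} [NeZero k]

/-- Matching at the inner nodes propagates the local formulas from left to right to a single
variation of constants formula starting at -1. -/
theorem eq_variation_of_pieces {w : Pieces k n} {g : ℝ → Fin n → ℂ}
    (hg : ∀ a b, IntervalIntegrable (fun s => D.fundInv s (g s)) MeasureTheory.volume a b)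
    (hw : ∀ x, w x = D.fund (piecePt k x) (D.fundInv (node k x.1) (w (x.1, 0)) +
      ∫ s in (node k x.1)..(piecePt k x), D.fundInv s (g s)))
    (hin : ∀ l : Fin k, l ≠ 0 → w (l, 0) = w (l - 1, 1)) (x : Fin k × unitInterval) :
    w x = D.fund (piecePt k x) (D.fundInv (-1) (w (0, 0)) +
      ∫ s in (-1)..(piecePt k x), D.fundInv s (g s)) := by
  have h0 : ∀ (m : ℕ) (l : Fin k), (l : ℕ) = m → w (l, 0) = D.fund (node k l)
      (D.fundInv (-1) (w (0, 0)) + ∫ s in (-1)..(node k l), D.fundInv s (g s)) := by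
    intro m
    induction m with
    | zero =>
      intro l hl
      obtain rfl : l = 0 := Fin.ext hl
      rw [Fin.val_zero, node_zero]
      simp
    | succ m ih =>
      intro l hl
      have hl0 : l ≠ 0 := fun h => by simp [h] at hl
      have h1 := val_sub_one_add_one hl0
      have h2 := ih (l - 1) (by omega)
      have h3 := hw (l - 1, 1)
      simp only [h2] at h3
      rw [hin l hl0, h3, ← D.fund_variation_shift hg, piecePt_end hl0, piecePt_zero]
  rw [hw x, h0 _ x.1 rfl, ← D.fund_variation_shift hg]

/-! ### The periodic boundary value problem -/

theorem charFun_eq_zero_iff_exists {μ z : ℂ} :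
    D.charFun k (μ, z) = 0 ↔ ∃ v, v ≠ 0 ∧ D.charOpAt k μ z v = 0 := by
  constructor
  · intro h
    obtain ⟨v, hv, hv0⟩ :=
      Submodule.exists_mem_ne_zero_of_ne_bot (LinearMap.bot_lt_ker_of_det_eq_zero h).ne'
    exact ⟨v, hv0, hv⟩
  · rintro ⟨v, hv0, hv⟩
    by_contra h
    have h1 := (ContinuousLinearMap.isUnit_iff_bijective).1 (isUnit_of_det_ne_zero h)
    exact hv0 (h1.1 (hv.trans (map_zero _).symm))

/-- `y` is a `C¹` solution of the periodic boundary value problem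
`y' = [A(t) - μ] y + z B(t) y((t - τ) mod [-1, 0])`, `y(0) = y(-1)`. -/
structure IsPeriodicSolution (μ z : ℂ) (y : ℝ → Fin n → ℂ) : Prop where
  contDiffOn : ContDiffOn ℝ 1 y (Icc (-1) 0)
  eqn : ∀ t ∈ Icc (-1 : ℝ) 0, HasDerivWithinAt y (D.Ac t *ᵥ y t - μ • y t
    + z • (D.Bc t *ᵥ y (pmod (t - D.τ)))) (Icc (-1) 0) t
  periodic : y 0 = y (-1)

theorem hasDerivWithinAt_exp_smul (μ : ℂ) {y : ℝ → Fin n → ℂ} {y' : Fin n → ℂ} {s : Set ℝ} {t : ℝ}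
    (h : HasDerivWithinAt y y' s t) :
    HasDerivWithinAt (fun r : ℝ => Complex.exp (μ * r) • y r)
      (μ • Complex.exp (μ * t) • y t + Complex.exp (μ * t) • y') s t := by
  have h2 : HasDerivAt (fun r : ℝ => Complex.exp (μ * r)) (Complex.exp (μ * t) * μ) t := by
    have h3 : HasDerivAt (fun r : ℝ => μ * (r : ℂ)) μ t := by
      simpa using ((hasDerivAt_id t).ofReal_comp.const_mul μ)
    exact h3.cexp
  refine (h2.hasDerivWithinAt.smul h).congr_deriv ?_
  rw [smul_smul, mul_comm μ (Complex.exp _), add_comm]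

theorem exp_neg_smul_exp_smul (a : ℂ) (v : Fin n → ℂ) :
    Complex.exp (-a) • Complex.exp a • v = v := by
  rw [smul_smul, ← Complex.exp_add, neg_add_cancel, Complex.exp_zero, one_smul]

theorem liftPieces_exp_smul_eq {μ z : ℂ} (w : Pieces k n) {s : ℝ} (hs : s ∈ Ico (-1 : ℝ) 0) :
    Complex.exp (μ * s) • z • D.opB s (liftPieces w (s - D.τ)) =
      D.opB s (D.lagged (z * Complex.exp (μ * D.τ)) (z * Complex.exp (μ * (D.τ - 1)))
        (mulExp n k μ w) s) := by
  rw [D.lagged_exp μ z _ hs, liftPieces_mulExp, map_smul, map_smul, smul_smul, smul_smul]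
  congr 1
  rw [mul_assoc z, ← Complex.exp_add, mul_comm]
  ring_nf

/-- A kernel vector of the characteristic operator gives pieces of x with x(-1) = e^{-μ} x(0). Then
y = e^{-μt} x closes up periodically, and its integral equation can be differentiated. -/
theorem exists_isPeriodicSolution {μ z : ℂ}
    (hu : IsUnit (D.pencil k (z * Complex.exp (μ * D.τ)) (z * Complex.exp (μ * (D.τ - 1)))))
    (h : D.charFun k (μ, z) = 0) :
    ∃ y, D.IsPeriodicSolution μ z y ∧ ∃ t ∈ Icc (-1 : ℝ) 0, y t ≠ 0 := by
  obtain ⟨v, hv0, hv⟩ := D.charFun_eq_zero_iff_exists.1 h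
  set p := z * Complex.exp (μ * D.τ) with hp
  set q := z * Complex.exp (μ * (D.τ - 1)) with hq
  set w := Ring.inverse (D.pencil k p q) (D.initial k v) with hw
  have hfix := (D.eq_inverse_pencil_iff hu v w).1 hw
  have hw0 : ∀ l, w (l, 0) = v l := fun l => by
    rw [hfix, Pieces.add_apply, initial_apply_zero, volterra_apply_zero, add_zero]
  have hend : ∀ l, w (l, 0) = (if l = 0 then Complex.exp (-μ) else 1) • w (l - 1, 1) := fun l => by
    have h1 : v - (endInner n k w + Complex.exp (-μ) • endOuter n k w) = 0 := hv
    rw [hw0, ← end_apply, ← sub_eq_zero.1 h1]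
  set w' := mulExp n k (-μ) w with hw'
  have hww : mulExp n k μ w' = w := mulExp_mulExp_neg μ w
  have hend' : ∀ l, w' (l, 0) = w' (l - 1, 1) := by
    intro l
    rw [hw', mulExp_apply, mulExp_apply, hend l]
    by_cases hl : l = 0
    · subst hl
      rw [if_pos rfl, piecePt_first, piecePt_last, smul_smul, ← Complex.exp_add]
      simp
    · rw [if_neg hl, one_smul, piecePt_end hl]
  obtain ⟨y, hyc, hyw, hyl⟩ := exists_periodic_glue hend'
  have hlag : ∀ t, y (pmod (t - D.τ)) = liftPieces w' (t - D.τ) := fun t => by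
    rw [← piecePt_pieceOf (k := k), hyw]
    rfl
  have hyc' : ContinuousOn y (Icc (-1) 0) := hyc.mono Icc_subset_Iic_self
  -- The boundary condition removes the jump at the wrap-around: the lagged function is a translate
  -- of the continuous periodic extension. This continuity is what makes y continuously
  -- differentiable.
  have hlagc : ContinuousOn (fun t => liftPieces w' (t - D.τ)) (Icc (-1) 0) := by
    have h1 : ContinuousOn (fun t => y (t - D.τ - 1)) (Icc (-1) 0) := by
      refine hyc.comp (by fun_prop) fun t ht => ?_
      have := D.τ_mem.1
      simp only [mem_Iic]
      linarith [ht.2]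
    exact h1.congr fun t ht => (hyl _ (by linarith [ht.2, D.τ_mem.1])).symm
  have hBc : ContinuousOn (fun t => D.opB t (liftPieces w' (t - D.τ))) (Icc (-1) 0) :=
    D.continuous_opB.continuousOn.clm_apply hlagc
  have hgc : ContinuousOn (fun s : ℝ => Complex.exp (μ * s) • z •
      D.opB s (liftPieces w' (s - D.τ))) (Icc (-1) 0) := by
    have h1 : Continuous fun s : ℝ => Complex.exp (μ * s) := by fun_prop
    exact h1.continuousOn.smul (hBc.const_smul z)
  have hvar : ∀ t ∈ Icc (-1 : ℝ) 0, Complex.exp (μ * t) • y t =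
      D.fund t (D.fundInv (-1) (w (0, 0)) + ∫ s in (-1)..t, D.fundInv s
        (Complex.exp (μ * s) • z • D.opB s (liftPieces w' (s - D.τ)))) := by
    intro t ht
    obtain ⟨x, rfl⟩ := exists_piecePt_eq (k := k) ht
    have h1 := D.eq_variation_of_pieces (w := w) (g := fun s => D.opB s (D.lagged p q w s))
      (D.intervalIntegrable_lagged p q w) (fun x => by
        conv_lhs => rw [hfix]
        rw [Pieces.add_apply, initial_apply, volterra_apply, hw0, map_add])
      (fun l hl => by rw [hend l, if_neg hl, one_smul]) x
    rw [hyw, ← mulExp_apply, hww]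
    refine h1.trans ?_
    congr 2
    refine intervalIntegral_congr_Ioo ht.1 fun s hs => ?_
    rw [D.liftPieces_exp_smul_eq w' ⟨hs.1.le, hs.2.trans_le ht.2⟩, hww]
  have hder : ∀ t ∈ Icc (-1 : ℝ) 0, HasDerivWithinAt y (D.Ac t *ᵥ y t - μ • y t
      + z • (D.Bc t *ᵥ y (pmod (t - D.τ)))) (Icc (-1) 0) t := by
    intro t ht
    have h1 := D.hasDerivWithinAt_variation hgc (D.fundInv (-1) (w (0, 0))) ht
    rw [← hvar t ht] at h1
    have h2 := hasDerivWithinAt_exp_smul (-μ) (h1.congr hvar (hvar t ht))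
    simp only [neg_mul, exp_neg_smul_exp_smul] at h2
    refine h2.congr_deriv ?_
    rw [hlag, smul_add, exp_neg_smul_exp_smul, Matrix.mulVec_smul, exp_neg_smul_exp_smul, neg_smul,
      opB_apply]
    abel
  refine ⟨y, ⟨?_, hder, ?_⟩, ?_⟩
  · have hud : UniqueDiffOn ℝ (Icc (-1 : ℝ) 0) := uniqueDiffOn_Icc (by norm_num)
    rw [contDiffOn_one_iff_derivWithin hud]
    refine ⟨fun t ht => (hder t ht).differentiableWithinAt, ?_⟩
    have h1 : ContinuousOn (fun t => D.opA t (y t) - μ • y t +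
        z • D.opB t (liftPieces w' (t - D.τ))) (Icc (-1) 0) :=
      ((D.continuous_opA.continuousOn.clm_apply hyc').sub (hyc'.const_smul μ)).add
        (hBc.const_smul z)
    refine h1.congr fun t ht => ?_
    rw [(hder t ht).derivWithin (hud t ht), hlag]
    rfl
  · rw [← piecePt_last (k := k), ← piecePt_first (k := k), hyw, hyw, hend' 0]
  · obtain ⟨l, hl⟩ := Function.ne_iff.1 hv0
    refine ⟨node k l, node_mem l, ?_⟩
    rw [← piecePt_zero, hyw, hw', mulExp_apply, hw0]
    exact smul_ne_zero (Complex.exp_ne_zero _) hl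

/-- Conversely, the values of e^{μt} y at the nodes form a kernel vector. They cannot all vanish,
because the pencil is invertible and they determine y. -/
theorem charFun_eq_zero_of_isPeriodicSolution {μ z : ℂ}
    (hu : IsUnit (D.pencil k (z * Complex.exp (μ * D.τ)) (z * Complex.exp (μ * (D.τ - 1)))))
    {y : ℝ → Fin n → ℂ} (hy : D.IsPeriodicSolution μ z y) {t₀ : ℝ} (ht₀ : t₀ ∈ Icc (-1 : ℝ) 0)
    (hy0 : y t₀ ≠ 0) : D.charFun k (μ, z) = 0 := by
  have hyc : ContinuousOn y (Icc (-1) 0) := hy.contDiffOn.continuousOn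
  set w' : Pieces k n := Pieces.mk (fun x => y (piecePt k x))
    (hyc.comp_continuous continuous_piecePt piecePt_mem) with hw'
  have hyw : ∀ x, w' x = y (piecePt k x) := fun x => rfl
  have hend' : ∀ l, w' (l, 0) = w' (l - 1, 1) := by
    intro l
    rw [hyw, hyw]
    by_cases hl : l = 0
    · subst hl
      rw [piecePt_first, piecePt_last, hy.periodic]
    · rw [piecePt_end hl]
  obtain ⟨f, hfc, -, hfl⟩ := exists_periodic_glue hend'
  have hlag : ∀ t, y (pmod (t - D.τ)) = liftPieces w' (t - D.τ) := fun t => by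
    rw [liftPieces, hyw, piecePt_pieceOf]
  have hlagc : ContinuousOn (fun t => liftPieces w' (t - D.τ)) (Icc (-1) 0) := by
    have h1 : ContinuousOn (fun t => f (t - D.τ - 1)) (Icc (-1) 0) := by
      refine hfc.comp (by fun_prop) fun t ht => ?_
      have := D.τ_mem.1
      simp only [mem_Iic]
      linarith [ht.2]
    exact h1.congr fun t ht => (hfl _ (by linarith [ht.2, D.τ_mem.1])).symm
  set p := z * Complex.exp (μ * D.τ) with hp
  set q := z * Complex.exp (μ * (D.τ - 1)) with hq
  set w := mulExp n k μ w' with hw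
  have hgc : ContinuousOn (fun s : ℝ => Complex.exp (μ * s) • z •
      D.opB s (liftPieces w' (s - D.τ))) (Icc (-1) 0) := by
    have h1 : Continuous fun s : ℝ => Complex.exp (μ * s) := by fun_prop
    exact h1.continuousOn.smul ((D.continuous_opB.continuousOn.clm_apply hlagc).const_smul z)
  have hder : ∀ t ∈ Icc (-1 : ℝ) 0, HasDerivWithinAt (fun r : ℝ => Complex.exp (μ * r) • y r)
      (D.Ac t *ᵥ (Complex.exp (μ * t) • y t) + Complex.exp (μ * t) • z •
        D.opB t (liftPieces w' (t - D.τ))) (Icc (-1) 0) t := by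
    intro t ht
    refine (hasDerivWithinAt_exp_smul μ (hy.eqn t ht)).congr_deriv ?_
    rw [hlag, Matrix.mulVec_smul, smul_add, smul_sub, smul_comm μ, opB_apply]
    abel
  have hvar : ∀ x, w x = D.fund (piecePt k x) (D.fundInv (-1) (Complex.exp (μ * (-1 : ℝ)) • y (-1)) +
      ∫ s in (-1)..(piecePt k x), D.fundInv s (D.opB s (D.lagged p q w s))) := by
    intro x
    have h1 := D.eq_variation hgc hder (piecePt_mem x)
    rw [hw, mulExp_apply, hyw, h1]
    congr 2
    refine intervalIntegral_congr_Ioo (piecePt_mem x).1 fun s hs => ?_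
    rw [D.liftPieces_exp_smul_eq w' ⟨hs.1.le, hs.2.trans_le (piecePt_mem x).2⟩]
  set v : Fin k → Fin n → ℂ := fun l => w (l, 0) with hv
  have hfix : w = D.initial k v + (p • D.volterraNear k w + q • D.volterraFar k w) := by
    refine Pieces.ext fun x => ?_
    have h1 := hvar (x.1, 0)
    rw [piecePt_zero] at h1
    conv_lhs => rw [hvar x, D.fund_variation_shift (D.intervalIntegrable_lagged p q w) (node k x.1),
      ← h1]
    rw [Pieces.add_apply, volterra_apply, initial_apply, map_add]
  have hinv := (D.eq_inverse_pencil_iff hu v w).2 hfix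
  refine D.charFun_eq_zero_iff_exists.2 ⟨v, fun hv0 => ?_, ?_⟩
  · rw [hv0, map_zero, map_zero] at hinv
    obtain ⟨x, rfl⟩ := exists_piecePt_eq (k := k) ht₀
    refine hy0 ?_
    rw [← hyw, ← mulExp_neg_mulExp μ w', ← hw, hinv, map_zero]
    rfl
  · have h1 : D.charOpAt k μ z v = v - (endInner n k w + Complex.exp (-μ) • endOuter n k w) := by
      rw [hinv]
      rfl
    rw [h1, sub_eq_zero]
    funext l
    rw [end_apply, hv]
    simp only [hw, mulExp_apply, hend' l]
    by_cases hl : l = 0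
    · subst hl
      rw [if_pos rfl, piecePt_first, piecePt_last, smul_smul, ← Complex.exp_add]
      simp
    · rw [if_neg hl, one_smul, piecePt_end hl]

theorem charFun_eq_zero_iff {μ z : ℂ}
    (hu : IsUnit (D.pencil k (z * Complex.exp (μ * D.τ)) (z * Complex.exp (μ * (D.τ - 1))))) :
    D.charFun k (μ, z) = 0 ↔ ∃ y, D.IsPeriodicSolution μ z y ∧ ∃ t ∈ Icc (-1 : ℝ) 0, y t ≠ 0 :=
  ⟨D.exists_isPeriodicSolution hu, fun ⟨_, hy, _, ht, h0⟩ =>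
    D.charFun_eq_zero_of_isPeriodicSolution hu hy ht h0⟩

end PeriodicDDE

end LargeDelay
end

noncomputable section

namespace LargeDelay

set_option linter.unusedSectionVars false

/-! ### Multiplication by the spectral parameter -/

section GermShift

variable {F G : Type*} [NormedAddCommGroup F] [NormedSpace ℂ F] [NormedAddCommGroup G]
  [NormedSpace ℂ G]

/-- A linear map applied to all coefficients. -/
abbrev coeffMap {F G : Type*} [AddCommGroup F] [Module ℂ F] [AddCommGroup G] [Module ℂ G]
    (T : F →ₗ[ℂ] G) : (ℕ →₀ F) →ₗ[ℂ] (ℕ →₀ G) :=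
  Finsupp.mapRange.linearMap T

theorem coeffMap_apply {F G : Type*} [AddCommGroup F] [Module ℂ F] [AddCommGroup G] [Module ℂ G]
    (T : F →ₗ[ℂ] G) (y : ℕ →₀ F) (i : ℕ) : coeffMap T y i = T (y i) := rfl

/-- Multiplication of principal parts at `c` by `z`. -/
def germShift (c : ℂ) (F : Type*) [AddCommGroup F] [Module ℂ F] : (ℕ →₀ F) →ₗ[ℂ] (ℕ →₀ F) :=
  c • LinearMap.id + leftShift F

theorem germShift_apply (c : ℂ) {F : Type*} [AddCommGroup F] [Module ℂ F] (y : ℕ →₀ F) (i : ℕ) :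
    germShift c F y i = c • y i + y (i + 1) := rfl

theorem coeffMap_germShift (c : ℂ) {F G : Type*} [AddCommGroup F] [Module ℂ F] [AddCommGroup G]
    [Module ℂ G] (T : F →ₗ[ℂ] G) (y : ℕ →₀ F) :
    coeffMap T (germShift c F y) = germShift c G (coeffMap T y) := by
  ext i : 1
  simp only [coeffMap_apply, germShift_apply, map_add, map_smul]

/-- Chains are the principal parts on which M acts as multiplication by the spectral parameter. -/
theorem mem_chains_iff_coeffMap {X : Type} [AddCommGroup X] [Module ℂ X] {M : Module.End ℂ X}
    {c : ℂ} {ξ : ℕ →₀ X} : ξ ∈ chains M c ↔ coeffMap M ξ = germShift c X ξ := by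
  rw [mem_chains, Finsupp.ext_iff]
  rfl

/-- Division of principal parts at `c` by `z`. -/
def germUnshift (c : ℂ) (F : Type*) [NormedAddCommGroup F] [NormedSpace ℂ F] :
    (ℕ →₀ F) →ₗ[ℂ] (ℕ →₀ F) :=
  germAction c fun z => z⁻¹ • ContinuousLinearMap.id ℂ F

variable {c : ℂ}

theorem analyticAt_inv_smul (hc : c ≠ 0) (T : F →L[ℂ] G) :
    AnalyticAt ℂ (fun z : ℂ => z⁻¹ • T) c :=
  ((analyticAt_id (𝕜 := ℂ) (z := c)).inv hc).smul analyticAt_const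

theorem germShift_germUnshift (hc : c ≠ 0) (y : ℕ →₀ F) :
    germShift c F (germUnshift c F y) = y := by
  have h1 : AnalyticAt ℂ (fun z : ℂ => z • ContinuousLinearMap.id ℂ F) c :=
    analyticAt_id.smul analyticAt_const
  have h2 := germAction_comp h1 (analyticAt_inv_smul hc (ContinuousLinearMap.id ℂ F))
  rw [germAction_smul_one] at h2
  have h3 : (fun z : ℂ => (z • ContinuousLinearMap.id ℂ F).comp (z⁻¹ • ContinuousLinearMap.id ℂ F))
      =ᶠ[𝓝 c] fun _ => ContinuousLinearMap.id ℂ F := by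
    filter_upwards [isOpen_ne.mem_nhds hc] with z hz
    ext x
    simp [smul_smul, inv_mul_cancel₀ (show z ≠ 0 from hz)]
  rw [germAction_congr h3, germAction_one] at h2
  exact (LinearMap.congr_fun h2 y).symm

theorem germUnshift_germShift (hc : c ≠ 0) (y : ℕ →₀ F) :
    germUnshift c F (germShift c F y) = y := by
  have h1 : AnalyticAt ℂ (fun z : ℂ => z • ContinuousLinearMap.id ℂ F) c :=
    analyticAt_id.smul analyticAt_const
  have h2 := germAction_comp (analyticAt_inv_smul hc (ContinuousLinearMap.id ℂ F)) h1
  rw [germAction_smul_one] at h2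
  have h3 : (fun z : ℂ => (z⁻¹ • ContinuousLinearMap.id ℂ F).comp (z • ContinuousLinearMap.id ℂ F))
      =ᶠ[𝓝 c] fun _ => ContinuousLinearMap.id ℂ F := by
    filter_upwards [isOpen_ne.mem_nhds hc] with z hz
    ext x
    simp [smul_smul, mul_inv_cancel₀ (show z ≠ 0 from hz)]
  rw [germAction_congr h3, germAction_one] at h2
  exact (LinearMap.congr_fun h2 y).symm

theorem coeffMap_germUnshift (hc : c ≠ 0) (T : F →ₗ[ℂ] G) (y : ℕ →₀ F) :
    coeffMap T (germUnshift c F y) = germUnshift c G (coeffMap T y) := by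
  rw [← germUnshift_germShift hc (coeffMap T (germUnshift c F y)), ← coeffMap_germShift,
    germShift_germUnshift hc]

theorem coeffMap_germUnshift_pow (hc : c ≠ 0) (T : F →ₗ[ℂ] G) (m : ℕ) (y : ℕ →₀ F) :
    coeffMap T ((germUnshift c F ^ m) y) = (germUnshift c G ^ m) (coeffMap T y) := by
  induction m with
  | zero => rfl
  | succ m ih =>
    rw [pow_succ', pow_succ', Module.End.mul_apply, Module.End.mul_apply,
      coeffMap_germUnshift hc, ih]

theorem germAction_inv_pow_smul (hc : c ≠ 0) (T : F →L[ℂ] G) (m : ℕ) (y : ℕ →₀ F) :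
    germAction c (fun z => (z⁻¹) ^ m • T) y =
      coeffMap (T : F →ₗ[ℂ] G) ((germUnshift c F ^ m) y) := by
  induction m generalizing y with
  | zero =>
    simp only [pow_zero, one_smul, germAction_const]
    rfl
  | succ m ih =>
    have h1 : AnalyticAt ℂ (fun z : ℂ => (z⁻¹) ^ m • T) c :=
      (((analyticAt_id (𝕜 := ℂ) (z := c)).inv hc).pow m).smul analyticAt_const
    have h2 := germAction_comp h1 (analyticAt_inv_smul hc (ContinuousLinearMap.id ℂ F))
    have h3 : (fun z : ℂ => ((z⁻¹) ^ m • T).comp (z⁻¹ • ContinuousLinearMap.id ℂ F)) =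
        fun z => (z⁻¹) ^ (m + 1) • T := by
      funext z
      ext x
      simp [smul_smul, pow_succ, mul_comm]
    rw [h3] at h2
    rw [h2, LinearMap.comp_apply, ih, pow_succ, Module.End.mul_apply]
    rfl

end GermShift

namespace PeriodicDDE

variable {n : ℕ} (D : PeriodicDDE n) {k : ℕ} [NeZero k]

/-! ### The action of the characteristic operator on principal parts -/

theorem analyticAt_pencil {p q : ℂ → ℂ} {c : ℂ} (hp : AnalyticAt ℂ p c) (hq : AnalyticAt ℂ q c) :
    AnalyticAt ℂ (fun z => D.pencil k (p z) (q z)) c :=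
  analyticAt_const.sub ((hp.smul analyticAt_const).add (hq.smul analyticAt_const))

theorem analyticAt_inverse_pencil {p q : ℂ → ℂ} {c : ℂ} (hp : AnalyticAt ℂ p c)
    (hq : AnalyticAt ℂ q c) (hu : IsUnit (D.pencil k (p c) (q c))) :
    AnalyticAt ℂ (fun z => Ring.inverse (D.pencil k (p z) (q z))) c := by
  have := analyticAt_inverse (𝕜 := ℂ) hu.unit
  exact AnalyticAt.comp (g := Ring.inverse) (by simpa using this) (D.analyticAt_pencil hp hq)

theorem germAction_pencil {p q : ℂ → ℂ} {c : ℂ} (hp : AnalyticAt ℂ p c) (hq : AnalyticAt ℂ q c)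
    (ω : ℕ →₀ Pieces k n) :
    germAction c (fun z => D.pencil k (p z) (q z)) ω =
      ω - (germAction c (fun z => p z • D.volterraNear k) ω +
        germAction c (fun z => q z • D.volterraFar k) ω) := by
  have h1 : AnalyticAt ℂ (fun z => p z • D.volterraNear k) c := hp.smul analyticAt_const
  have h2 : AnalyticAt ℂ (fun z => q z • D.volterraFar k) c := hq.smul analyticAt_const
  have h3 := germAction_sub (analyticAt_const (v := ContinuousLinearMap.id ℂ (Pieces k n)))
    (h1.add h2)
  rw [germAction_one] at h3
  have h4 := germAction_add h1 h2
  refine (LinearMap.congr_fun h3 ω).trans ?_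
  rw [LinearMap.sub_apply]
  exact congrArg (ω - ·) (LinearMap.congr_fun h4 ω)

/-- The principal part of the solution of the integral equation. -/
def germSolution (k : ℕ) [NeZero k] (p q : ℂ → ℂ) (c : ℂ) (v : ℕ →₀ (Fin k → Fin n → ℂ)) :
    ℕ →₀ Pieces k n :=
  germAction c (fun z => Ring.inverse (D.pencil k (p z) (q z)))
    (coeffMap (D.initial k : (Fin k → Fin n → ℂ) →ₗ[ℂ] Pieces k n) v)

/-- The fixed-point equation of the pencil at the level of principal parts: the germ of the inverse
acts as a two-sided inverse. -/
theorem eq_germSolution_iff {p q : ℂ → ℂ} {c : ℂ} (hp : AnalyticAt ℂ p c) (hq : AnalyticAt ℂ q c)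
    (hu : IsUnit (D.pencil k (p c) (q c))) {v : ℕ →₀ (Fin k → Fin n → ℂ)} {ω : ℕ →₀ Pieces k n} :
    ω = D.germSolution k p q c v ↔
      ω = coeffMap (D.initial k : (Fin k → Fin n → ℂ) →ₗ[ℂ] Pieces k n) v +
        (germAction c (fun z => p z • D.volterraNear k) ω +
          germAction c (fun z => q z • D.volterraFar k) ω) := by
  have hP := D.analyticAt_pencil (k := k) hp hq
  have hI := D.analyticAt_inverse_pencil hp hq hu
  have hev : ∀ᶠ z in 𝓝 c, IsUnit (D.pencil k (p z) (q z)) :=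
    hP.continuousAt.eventually (Units.isOpen.mem_nhds hu)
  have h1 := germAction_comp hI hP
  have h2 := germAction_comp hP hI
  have h1' := germAction_congr (c := c) (f := fun z => (Ring.inverse (D.pencil k (p z) (q z))).comp
    (D.pencil k (p z) (q z))) (g := fun _ => ContinuousLinearMap.id ℂ (Pieces k n))
    (hev.mono fun z hz => Ring.inverse_mul_cancel _ hz)
  rw [h1', germAction_one] at h1
  have h2' := germAction_congr (c := c) (f := fun z => (D.pencil k (p z) (q z)).comp
    (Ring.inverse (D.pencil k (p z) (q z)))) (g := fun _ => ContinuousLinearMap.id ℂ (Pieces k n))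
    (hev.mono fun z hz => Ring.mul_inverse_cancel _ hz)
  rw [h2', germAction_one] at h2
  have h3 := D.germAction_pencil (k := k) hp hq ω
  constructor
  · intro h
    have h4 := LinearMap.congr_fun h2
      (coeffMap (D.initial k : (Fin k → Fin n → ℂ) →ₗ[ℂ] Pieces k n) v)
    rw [LinearMap.comp_apply] at h4
    change _ = germAction c _ (D.germSolution k p q c v) at h4
    rw [← h, h3, LinearMap.id_apply] at h4
    rw [h4, sub_add_cancel]
  · intro h
    have h4 := LinearMap.congr_fun h1 ω
    rw [LinearMap.comp_apply, h3, sub_eq_of_eq_add h] at h4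
    exact h4

/-- With c = 1/z as feedback factor, the last period is fed back after division by the spectral
parameter, that is, from the preceding period. -/
theorem germAction_charOp {p q : ℂ → ℂ} {c : ℂ} (hc : c ≠ 0) (hp : AnalyticAt ℂ p c)
    (hq : AnalyticAt ℂ q c) (hu : IsUnit (D.pencil k (p c) (q c)))
    (v : ℕ →₀ (Fin k → Fin n → ℂ)) :
    germAction c (fun z => D.charOp k (p z) (q z) z⁻¹) v =
      v - (coeffMap (endInner n k : Pieces k n →ₗ[ℂ] (Fin k → Fin n → ℂ))
          (D.germSolution k p q c v) +
        coeffMap (endOuter n k : Pieces k n →ₗ[ℂ] (Fin k → Fin n → ℂ))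
          (germUnshift c _ (D.germSolution k p q c v))) := by
  have hI := D.analyticAt_inverse_pencil hp hq hu
  have hS : AnalyticAt ℂ (fun _ : ℂ => D.initial k) c := analyticAt_const
  have hE0 : AnalyticAt ℂ (fun _ : ℂ => endInner n k) c := analyticAt_const
  have hE1 := analyticAt_inv_smul hc (endOuter n k)
  have h1 := germAction_comp hI hS
  have h2 := germAction_comp (hE0.add hE1) (analyticAt_clm_comp hI hS)
  have h3 := germAction_sub
    (analyticAt_const (v := ContinuousLinearMap.id ℂ (Fin k → Fin n → ℂ)))
    (analyticAt_clm_comp (hE0.add hE1) (analyticAt_clm_comp hI hS))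
  have h4 := germAction_add hE0 hE1
  have h5 := germAction_inv_pow_smul hc (endOuter n k) 1 (D.germSolution k p q c v)
  simp only [pow_one] at h5
  refine (LinearMap.congr_fun h3 v).trans ?_
  rw [LinearMap.sub_apply, germAction_one]
  refine congrArg (v - ·) ((LinearMap.congr_fun h2 v).trans ?_)
  rw [LinearMap.comp_apply, h1, germAction_const, LinearMap.comp_apply]
  refine (LinearMap.congr_fun h4 _).trans ?_
  rw [LinearMap.add_apply, germAction_const]
  exact congrArg₂ (· + ·) rfl h5

variable (n k) in
/-- The initial values of the pieces. -/
def startValues : Pieces k n →L[ℂ] (Fin k → Fin n → ℂ) :=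
  ContinuousLinearMap.pi fun l => Pieces.eval (l, 0)

theorem startValues_apply (w : Pieces k n) (l : Fin k) : startValues n k w l = w (l, 0) := rfl

theorem startValues_initial (v : Fin k → Fin n → ℂ) : startValues n k (D.initial k v) = v :=
  funext fun l => D.initial_apply_zero v l

theorem startValues_volterraNear (w : Pieces k n) : startValues n k (D.volterraNear k w) = 0 :=
  funext fun l => by
    have := D.volterra_apply_zero 1 0 w l
    rw [one_smul, zero_smul, add_zero] at this
    exact this

theorem startValues_volterraFar (w : Pieces k n) : startValues n k (D.volterraFar k w) = 0 :=
  funext fun l => by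
    have := D.volterra_apply_zero 0 1 w l
    rw [one_smul, zero_smul, zero_add] at this
    exact this

theorem endInner_apply_zero (w : Pieces k n) : endInner n k w 0 = 0 := by simp [endInner]

theorem endInner_apply_of_ne (w : Pieces k n) {l : Fin k} (hl : l ≠ 0) :
    endInner n k w l = w (l - 1, 1) := by simp [endInner, hl]

theorem endOuter_apply_zero (w : Pieces k n) : endOuter n k w 0 = w (0 - 1, 1) := by
  simp [endOuter]

theorem endOuter_apply_of_ne (w : Pieces k n) {l : Fin k} (hl : l ≠ 0) :
    endOuter n k w l = 0 := by simp [endOuter, hl]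

theorem eq_endInner_add_endOuter_iff (v w : Pieces k n) (x : Fin k → Fin n → ℂ) :
    x = endInner n k v + endOuter n k w ↔
      (∀ l ≠ 0, x l = v (l - 1, 1)) ∧ x 0 = w (0 - 1, 1) := by
  constructor
  · rintro rfl
    refine ⟨fun l hl => ?_, ?_⟩
    · rw [Pi.add_apply, endInner_apply_of_ne _ hl, endOuter_apply_of_ne _ hl, add_zero]
    · rw [Pi.add_apply, endInner_apply_zero, endOuter_apply_zero, zero_add]
  · rintro ⟨h1, h2⟩
    funext l
    by_cases hl : l = 0
    · subst hl
      rw [Pi.add_apply, endInner_apply_zero, endOuter_apply_zero, zero_add, h2]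
    · rw [Pi.add_apply, endInner_apply_of_ne _ hl, endOuter_apply_of_ne _ hl, add_zero, h1 l hl]

end PeriodicDDE

end LargeDelay
end

noncomputable section

namespace LargeDelay

set_option linter.unusedSectionVars false

namespace PeriodicDDE

variable {n : ℕ} (D : PeriodicDDE n) {k : ℕ} [NeZero k]

/-! ### The time-one map -/

/-- The value of a history at `t`, extended by constants outside `[-d, 0]`. -/
def hist {d : ℝ} (hd : 1 ≤ d) (φ : C(Icc (-d) 0, Fin n → ℂ)) (t : ℝ) : Fin n → ℂ :=
  IccExtend (show -d ≤ 0 by linarith) φ t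

section Hist

variable {d : ℝ} (hd : 1 ≤ d)

theorem continuous_hist (φ : C(Icc (-d) 0, Fin n → ℂ)) : Continuous (hist hd φ) :=
  φ.continuous.Icc_extend'

theorem hist_of_mem (φ : C(Icc (-d) 0, Fin n → ℂ)) {t : ℝ} (ht : t ∈ Icc (-d) 0) :
    hist hd φ t = φ ⟨t, ht⟩ := IccExtend_of_mem _ _ ht

theorem hist_add (φ ψ : C(Icc (-d) 0, Fin n → ℂ)) (t : ℝ) :
    hist hd (φ + ψ) t = hist hd φ t + hist hd ψ t := rfl

theorem hist_smul (c : ℂ) (φ : C(Icc (-d) 0, Fin n → ℂ)) (t : ℝ) :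
    hist hd (c • φ) t = c • hist hd φ t := rfl

theorem hist_ext {φ ψ : C(Icc (-d) 0, Fin n → ℂ)}
    (h : ∀ t ∈ Icc (-d) 0, hist hd φ t = hist hd ψ t) : φ = ψ := by
  ext1 θ
  have := h θ θ.2
  rwa [hist_of_mem hd φ θ.2, hist_of_mem hd ψ θ.2] at this

theorem timeOneMap_apply {φ : C(Icc (-d) 0, Fin n → ℂ)} {x : ℝ → Fin n → ℂ}
    (hx : D.IsDDESolution d φ x) {t : ℝ} (ht : t ∈ Icc (-d) 0) :
    hist hd (D.timeOneMap hd φ) t = x (t + 1) := by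
  rw [hist_of_mem hd _ ht]
  exact (D.existsUnique_timeOneMap hd).choose_spec.1 φ x hx ⟨t, ht⟩

theorem opB_sub_one (t : ℝ) : D.opB (t - 1) = D.opB t := by
  ext1 v
  simp only [opB_apply, Bc, D.periodic_B.sub_eq]

/-- Periodicity of A and B moves the step from [0, 1] to [-1, 0], where the fundamental matrix is
available. -/
theorem exists_isDDESolution (φ : C(Icc (-d) 0, Fin n → ℂ)) :
    ∃ x, D.IsDDESolution d φ x ∧ ∀ t ∈ Icc (-1 : ℝ) 0, x (t + 1) = D.fund t
      (D.fundInv (-1) (hist hd φ 0) +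
        ∫ s in (-1)..t, D.fundInv s (D.opB s (hist hd φ (s + 1 - d)))) := by
  have hm0 : (0 : ℝ) ∈ Icc (-d) 0 := ⟨by linarith, le_rfl⟩
  set g : ℝ → Fin n → ℂ := fun s => D.opB s (hist hd φ (s + 1 - d)) with hg
  have hgc : Continuous g := D.continuous_opB.clm_apply
    ((continuous_hist hd φ).comp (by fun_prop))
  set u : ℝ → Fin n → ℂ := fun t => D.fund t (D.fundInv (-1) (hist hd φ 0) +
    ∫ s in (-1)..t, D.fundInv s (g s)) with hu
  have hu0 : u (-1) = hist hd φ 0 := by simp [hu]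
  set x : ℝ → Fin n → ℂ := fun t => if t ≤ 0 then hist hd φ t else u (t - 1) with hx
  have hx0 : ∀ t ≤ 0, x t = hist hd φ t := fun t ht => if_pos ht
  have hx1 : ∀ t, 0 ≤ t → x t = u (t - 1) := by
    intro t ht
    rcases eq_or_lt_of_le ht with rfl | h
    · rw [hx0 _ le_rfl, zero_sub, hu0]
    · exact if_neg (not_le.2 h)
  refine ⟨x, ⟨fun θ => ?_, fun t ht => ?_⟩, fun t ht => ?_⟩
  · rw [hx0 _ θ.2.2, hist_of_mem hd φ θ.2]
  · have ht' : t - 1 ∈ Icc (-1 : ℝ) 0 := ⟨by linarith [ht.1], by linarith [ht.2]⟩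
    have h1 := D.hasDerivWithinAt_variation (g := g) hgc.continuousOn
      (D.fundInv (-1) (hist hd φ 0)) ht'
    have h2 : HasDerivWithinAt (fun r : ℝ => r - 1) 1 (Icc 0 1) t :=
      (hasDerivWithinAt_id t _).sub_const 1
    have hm : MapsTo (fun r : ℝ => r - 1) (Icc 0 1) (Icc (-1) 0) := fun r hr =>
      ⟨by linarith [hr.1], by linarith [hr.2]⟩
    have h3 := HasDerivWithinAt.scomp t h1 h2 hm
    refine (h3.congr (fun r hr => hx1 r hr.1) (hx1 t ht.1)).congr_deriv ?_
    have h4 : D.Ac (t - 1) = D.Ac t := by simp only [Ac, D.periodic_A.sub_eq]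
    have h5 : t - 1 + 1 - d = t - d := by ring
    rw [one_smul, hx1 t ht.1, hx0 (t - d) (by linarith [ht.2]), h4]
    simp only [hg, opB_sub_one, h5]
    rfl
  · rw [hx1 _ (by linarith [ht.1]), add_sub_cancel_right]

theorem hist_timeOneMap_of_le (φ : C(Icc (-d) 0, Fin n → ℂ)) {t : ℝ} (ht : t ∈ Icc (-d) (-1)) :
    hist hd (D.timeOneMap hd φ) t = hist hd φ (t + 1) := by
  obtain ⟨x, hx, -⟩ := D.exists_isDDESolution hd φ
  have hm : t + 1 ∈ Icc (-d) 0 := ⟨by linarith [ht.1], by linarith [ht.2]⟩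
  rw [D.timeOneMap_apply hd hx ⟨ht.1, by linarith [ht.2]⟩, hist_of_mem hd φ hm]
  exact hx.history ⟨t + 1, hm⟩

theorem hist_timeOneMap_of_ge (φ : C(Icc (-d) 0, Fin n → ℂ)) {t : ℝ} (ht : t ∈ Icc (-1 : ℝ) 0) :
    hist hd (D.timeOneMap hd φ) t = D.fund t (D.fundInv (-1) (hist hd φ 0) +
      ∫ s in (-1)..t, D.fundInv s (D.opB s (hist hd φ (s + 1 - d)))) := by
  obtain ⟨x, hx, h⟩ := D.exists_isDDESolution hd φ
  rw [D.timeOneMap_apply hd hx ⟨by linarith [ht.1], ht.2⟩, h t ht]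

/-- After m steps the original history is found m periods back, as far as the history interval
reaches. -/
theorem hist_timeOneMap_pow (φ : C(Icc (-d) 0, Fin n → ℂ)) (m : ℕ) {t : ℝ} (ht : t ≤ 0)
    (htm : -d ≤ t - m) : hist hd ((D.timeOneMap hd ^ m) φ) (t - m) = hist hd φ t := by
  induction m with
  | zero => simp
  | succ m ih =>
    push_cast at htm ⊢
    have hm : (0 : ℝ) ≤ m := Nat.cast_nonneg m
    rw [pow_succ', Module.End.mul_apply, D.hist_timeOneMap_of_le hd _ ⟨htm, by linarith⟩,
      ← ih (by linarith)]
    congr 1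
    ring

variable (n k) in
/-- The restriction of a history to `[-1, 0]`. -/
def restrictPieces : C(Icc (-d) 0, Fin n → ℂ) →ₗ[ℂ] Pieces k n where
  toFun φ := Pieces.mk (fun x => hist hd φ (piecePt k x))
    ((continuous_hist hd φ).comp continuous_piecePt)
  map_add' _ _ := rfl
  map_smul' _ _ := rfl

theorem restrictPieces_apply (φ : C(Icc (-d) 0, Fin n → ℂ)) (x : Fin k × unitInterval) :
    restrictPieces n k hd φ x = hist hd φ (piecePt k x) := rfl

variable (n k) in
/-- The values of a history at the nodes. -/
def nodeValues : C(Icc (-d) 0, Fin n → ℂ) →ₗ[ℂ] (Fin k → Fin n → ℂ) :=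
  (startValues n k : Pieces k n →ₗ[ℂ] (Fin k → Fin n → ℂ)) ∘ₗ restrictPieces n k hd

theorem nodeValues_eq (φ : C(Icc (-d) 0, Fin n → ℂ)) :
    nodeValues n k hd φ = startValues n k (restrictPieces n k hd φ) := rfl

/-- The new period is continuous at inner nodes, and its initial value is the end value of the
previous period. -/
theorem nodeValues_timeOneMap (φ : C(Icc (-d) 0, Fin n → ℂ)) :
    nodeValues n k hd (D.timeOneMap hd φ) =
      endInner n k (restrictPieces n k hd (D.timeOneMap hd φ)) +
        endOuter n k (restrictPieces n k hd φ) := by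
  rw [eq_endInner_add_endOuter_iff]
  refine ⟨fun l hl => ?_, ?_⟩
  · rw [nodeValues_eq, startValues_apply, restrictPieces_apply, restrictPieces_apply,
      piecePt_end hl]
  · rw [nodeValues_eq, startValues_apply, restrictPieces_apply, restrictPieces_apply,
      piecePt_first, piecePt_last, D.hist_timeOneMap_of_le hd φ ⟨by linarith, le_rfl⟩,
      neg_add_cancel]

end Hist

/-! ### One step of the monodromy map in terms of pieces -/

section Step

/-- The forcing of the delay equation with delay `N + τ` on one period, described by the restrictions
`a` and `b` of a history to `[-N, 1 - N]` and `[-1 - N, -N]`. -/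
theorem delayed_eq_lagged {N : ℕ} {f : ℝ → Fin n → ℂ} {a b : Pieces k n}
    (ha : ∀ x, f (piecePt k x - (N - 1)) = a x)
    (hb : ∀ x, -(N + D.τ) ≤ piecePt k x - N → f (piecePt k x - N) = b x) {s : ℝ}
    (hs : s ∈ Ico (-1 : ℝ) 0) :
    f (s + 1 - (N + D.τ)) = D.lagged 1 0 a s + D.lagged 0 1 b s := by
  have hτ := D.τ_mem
  simp only [lagged, one_mul, zero_mul, add_zero, zero_add]
  -- Without wrap-around the delayed time is (s - τ) - (N - 1), with it (s - τ + 1) - N. The latter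
  -- is at least -(N + τ) because s ≥ -1, so only the part of `b` inside the history is used.
  rcases D.pmod_sub_τ hs with ⟨h, h1⟩ | ⟨h, h1⟩
  · rw [(D.weight_true h).1, (D.weight_true h).2, one_smul, zero_smul, add_zero, liftPieces, ← ha,
      piecePt_pieceOf, h1]
    congr 1
    ring
  · rw [(D.weight_false h).1, (D.weight_false h).2, one_smul, zero_smul, zero_add, liftPieces,
      ← hb _ (by rw [piecePt_pieceOf, h1]; linarith [hs.1]), piecePt_pieceOf, h1]
    congr 1
    ring

/-- The forcing by the delayed pieces `a` and `b`. -/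
def forcing (a b : Pieces k n) (s : ℝ) : Fin n → ℂ :=
  D.opB s (D.lagged 1 0 a s) + D.opB s (D.lagged 0 1 b s)

theorem intervalIntegrable_forcing (a b : Pieces k n) (r t : ℝ) :
    IntervalIntegrable (fun s => D.fundInv s (D.forcing a b s)) MeasureTheory.volume r t := by
  simp only [forcing, map_add]
  exact (D.intervalIntegrable_lagged 1 0 a r t).add (D.intervalIntegrable_lagged 0 1 b r t)

theorem volterra_forcing (a b : Pieces k n) (x : Fin k × unitInterval) :
    (D.volterraNear k a + D.volterraFar k b) x = D.fund (piecePt k x)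
      (∫ s in (node k x.1)..(piecePt k x), D.fundInv s (D.forcing a b s)) := by
  have h1 := D.volterra_apply 1 0 a x
  have h2 := D.volterra_apply 0 1 b x
  rw [one_smul, zero_smul, add_zero] at h1
  rw [one_smul, zero_smul, zero_add] at h2
  simp only [forcing, map_add]
  rw [Pieces.add_apply, h1, h2, intervalIntegral.integral_add
    (D.intervalIntegrable_lagged 1 0 a _ _) (D.intervalIntegrable_lagged 0 1 b _ _), map_add]

variable {N : ℕ} (hN : 1 ≤ N)

theorem restrictPieces_monodromy_apply {φ : C(Icc (-((N : ℝ) + D.τ)) 0, Fin n → ℂ)}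
    {a b : Pieces k n} (ha : ∀ x, hist (D.one_le_delay hN) φ (piecePt k x - (N - 1)) = a x)
    (hb : ∀ x, -(N + D.τ) ≤ piecePt k x - N →
      hist (D.one_le_delay hN) φ (piecePt k x - N) = b x) (x : Fin k × unitInterval) :
    restrictPieces n k (D.one_le_delay hN) (D.monodromy hN φ) x = D.fund (piecePt k x)
      (D.fundInv (-1) (hist (D.one_le_delay hN) φ 0) +
        ∫ s in (-1)..(piecePt k x), D.fundInv s (D.forcing a b s)) := by
  rw [restrictPieces_apply, monodromy, D.hist_timeOneMap_of_ge _ _ (piecePt_mem x)]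
  congr 2
  refine intervalIntegral_congr_Ioo (piecePt_mem x).1 fun s hs => ?_
  rw [D.delayed_eq_lagged ha hb ⟨hs.1.le, hs.2.trans_le (piecePt_mem x).2⟩, map_add]
  rfl

theorem restrictPieces_monodromy {φ : C(Icc (-((N : ℝ) + D.τ)) 0, Fin n → ℂ)}
    {a b : Pieces k n} (ha : ∀ x, hist (D.one_le_delay hN) φ (piecePt k x - (N - 1)) = a x)
    (hb : ∀ x, -(N + D.τ) ≤ piecePt k x - N →
      hist (D.one_le_delay hN) φ (piecePt k x - N) = b x) :
    restrictPieces n k (D.one_le_delay hN) (D.monodromy hN φ) =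
      D.initial k (nodeValues n k (D.one_le_delay hN) (D.monodromy hN φ)) +
        (D.volterraNear k a + D.volterraFar k b) := by
  refine Pieces.ext fun x => ?_
  have h := D.restrictPieces_monodromy_apply hN ha hb
  rw [Pieces.add_apply, volterra_forcing, initial_apply, nodeValues_eq, startValues_apply, h x,
    D.fund_variation_shift (D.intervalIntegrable_forcing a b) (node k x.1), h (x.1, 0),
    piecePt_zero, map_add]

/-- Recognises the new period: pieces that solve the forced equation locally, match at the inner
nodes and start at the present value agree with the solution. -/
theorem restrictPieces_monodromy_eq {φ : C(Icc (-((N : ℝ) + D.τ)) 0, Fin n → ℂ)}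
    {a b w : Pieces k n} (ha : ∀ x, hist (D.one_le_delay hN) φ (piecePt k x - (N - 1)) = a x)
    (hb : ∀ x, -(N + D.τ) ≤ piecePt k x - N →
      hist (D.one_le_delay hN) φ (piecePt k x - N) = b x)
    (hw : w = D.initial k (startValues n k w) + (D.volterraNear k a + D.volterraFar k b))
    (hin : ∀ l : Fin k, l ≠ 0 → w (l, 0) = w (l - 1, 1))
    (h0 : w (0, 0) = hist (D.one_le_delay hN) φ 0) :
    restrictPieces n k (D.one_le_delay hN) (D.monodromy hN φ) = w := by
  refine Pieces.ext fun x => ?_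
  rw [D.restrictPieces_monodromy_apply hN ha hb, ← h0]
  refine (D.eq_variation_of_pieces (D.intervalIntegrable_forcing a b) (fun x => ?_) hin x).symm
  conv_lhs => rw [hw]
  rw [Pieces.add_apply, volterra_forcing, initial_apply, map_add]
  rfl

/-- The recursion satisfied by the restrictions of the iterates of the monodromy map. -/
theorem restrictPieces_monodromy_pow (φ : C(Icc (-((N : ℝ) + D.τ)) 0, Fin n → ℂ)) :
    restrictPieces n k (D.one_le_delay hN) ((D.monodromy hN ^ (N + 1)) φ) =
      D.initial k (nodeValues n k (D.one_le_delay hN) ((D.monodromy hN ^ (N + 1)) φ)) +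
        (D.volterraNear k (restrictPieces n k (D.one_le_delay hN) (D.monodromy hN φ)) +
          D.volterraFar k (restrictPieces n k (D.one_le_delay hN) φ)) := by
  have hτ := D.τ_mem
  rw [pow_succ', Module.End.mul_apply]
  refine D.restrictPieces_monodromy hN (fun x => ?_) (fun x hx => ?_)
  · have h1 : ((N - 1 : ℕ) : ℝ) = (N : ℝ) - 1 := by
      rw [Nat.cast_sub hN, Nat.cast_one]
    -- Writing the N-th iterate as N - 1 steps applied to the image of φ shows that image N - 1
    -- periods back; N periods back one sees φ itself.
    have h2 : (D.monodromy hN ^ N) φ = (D.monodromy hN ^ (N - 1)) (D.monodromy hN φ) := by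
      rw [← Module.End.mul_apply, ← pow_succ, Nat.sub_add_cancel hN]
    rw [h2, restrictPieces_apply, ← h1]
    refine D.hist_timeOneMap_pow _ _ _ (piecePt_mem x).2 ?_
    rw [h1]
    linarith [(piecePt_mem x).1, hτ.1]
  · exact D.hist_timeOneMap_pow _ _ _ (piecePt_mem x).2 hx

end Step

end PeriodicDDE

end LargeDelay
end

noncomputable section

namespace LargeDelay

set_option linter.unusedSectionVars false

/-- As c ≠ 0, division by the spectral parameter preserves chains and inverts M there, although M
need not be invertible on the whole space. -/
theorem germUnshift_mem_chains {X : Type} [NormedAddCommGroup X] [NormedSpace ℂ X]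
    {M : Module.End ℂ X} {c : ℂ} (hc : c ≠ 0) {ξ : ℕ →₀ X} (h : ξ ∈ chains M c) :
    germUnshift c X ξ ∈ chains M c ∧ ∀ i, M (germUnshift c X ξ i) = ξ i := by
  have h1 : coeffMap M (germUnshift c X ξ) = ξ := by
    rw [coeffMap_germUnshift hc, mem_chains_iff_coeffMap.1 h, germUnshift_germShift hc]
  exact ⟨mem_chains_iff_coeffMap.2 (by rw [h1, germShift_germUnshift hc]),
    fun i => DFunLike.congr_fun h1 i⟩

theorem germUnshift_pow_mem_chains {X : Type} [NormedAddCommGroup X] [NormedSpace ℂ X]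
    {M : Module.End ℂ X} {c : ℂ} (hc : c ≠ 0) {ξ : ℕ →₀ X} (h : ξ ∈ chains M c) (m : ℕ) :
    (germUnshift c X ^ m) ξ ∈ chains M c ∧ ∀ i, (M ^ m) ((germUnshift c X ^ m) ξ i) = ξ i := by
  induction m with
  | zero => exact ⟨h, fun _ => rfl⟩
  | succ m ih =>
    have h1 := germUnshift_mem_chains hc ih.1
    refine ⟨by rw [pow_succ']; exact h1.1, fun i => ?_⟩
    rw [pow_succ M, pow_succ', Module.End.mul_apply, Module.End.mul_apply, h1.2 i, ih.2 i]

theorem exists_piecePt_sub {k : ℕ} [NeZero k] {t : ℝ} (ht : t ≤ 0) :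
    ∃ (x : Fin k × unitInterval) (j : ℕ), t = piecePt k x - j := by
  rcases eq_or_lt_of_le ht with rfl | h
  · exact ⟨(0 - 1, 1), 0, by rw [piecePt_last, Nat.cast_zero, sub_zero]⟩
  · have h5 : ⌊t⌋ < 0 := Int.floor_lt.2 (by simpa using h)
    have h6 : (((-⌊t⌋ - 1).toNat : ℕ) : ℝ) = -⌊t⌋ - 1 := by
      have : (((-⌊t⌋ - 1).toNat : ℤ)) = -⌊t⌋ - 1 := Int.toNat_of_nonneg (by omega)
      exact_mod_cast this
    refine ⟨pieceOf k t, (-⌊t⌋ - 1).toNat, ?_⟩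
    rw [piecePt_pieceOf, h6, PeriodicDDE.pmod, Int.fract]
    ring

namespace PeriodicDDE

variable {n : ℕ} (D : PeriodicDDE n) {k : ℕ} [NeZero k]

/-! ### Multiplicities for the monodromy map -/

section Monodromy

variable {N : ℕ} (hN : 1 ≤ N)

theorem le_of_le_piecePt_sub {x : Fin k × unitInterval} {j : ℕ}
    (h : -((N : ℝ) + D.τ) ≤ piecePt k x - j) : j ≤ N := by
  have h1 := (piecePt_mem x).2
  have h2 := D.τ_mem.2
  have : (j : ℝ) < N + 1 := by linarith
  exact Nat.lt_succ_iff.1 (by exact_mod_cast this)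

theorem analyticAt_inv_pow {c : ℂ} (hc : c ≠ 0) (m : ℕ) :
    AnalyticAt ℂ (fun z : ℂ => z⁻¹ ^ m) c :=
  ((analyticAt_id (𝕜 := ℂ) (z := c)).inv hc).pow m

theorem eq_germSolution_monodromy_iff {c : ℂ} (hc : c ≠ 0)
    (hu : IsUnit (D.pencil k (c⁻¹ ^ N) (c⁻¹ ^ (N + 1)))) {v : ℕ →₀ (Fin k → Fin n → ℂ)}
    {ω : ℕ →₀ Pieces k n} :
    ω = D.germSolution k (fun z => z⁻¹ ^ N) (fun z => z⁻¹ ^ (N + 1)) c v ↔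
      ω = coeffMap (D.initial k : (Fin k → Fin n → ℂ) →ₗ[ℂ] Pieces k n) v +
        (coeffMap (D.volterraNear k : Pieces k n →ₗ[ℂ] Pieces k n) ((germUnshift c _ ^ N) ω) +
          coeffMap (D.volterraFar k : Pieces k n →ₗ[ℂ] Pieces k n)
            ((germUnshift c _ ^ (N + 1)) ω)) := by
  rw [D.eq_germSolution_iff (analyticAt_inv_pow hc N) (analyticAt_inv_pow hc (N + 1)) hu,
    germAction_inv_pow_smul hc, germAction_inv_pow_smul hc]

/-- Apply the recursion for N + 1 steps to the chain divided by z^{N+1}: M becomes multiplication by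
z, and the delayed terms acquire the factors z^{-N} and z^{-N-1} of the pencil. -/
theorem chain_restrictPieces {c : ℂ} (hc : c ≠ 0)
    (hu : IsUnit (D.pencil k (c⁻¹ ^ N) (c⁻¹ ^ (N + 1))))
    {ξ : ℕ →₀ C(Icc (-((N : ℝ) + D.τ)) 0, Fin n → ℂ)} (h : ξ ∈ chains (D.monodromy hN) c) :
    coeffMap (restrictPieces n k (D.one_le_delay hN)) ξ =
      D.germSolution k (fun z => z⁻¹ ^ N) (fun z => z⁻¹ ^ (N + 1)) c
        (coeffMap (nodeValues n k (D.one_le_delay hN)) ξ) := by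
  rw [D.eq_germSolution_monodromy_iff hc hu, ← coeffMap_germUnshift_pow hc,
    ← coeffMap_germUnshift_pow hc]
  ext i : 1
  have h1 := germUnshift_pow_mem_chains hc h (N + 1)
  have h2 := germUnshift_mem_chains hc (germUnshift_pow_mem_chains hc h N).1
  have h3 := D.restrictPieces_monodromy_pow (k := k) hN ((germUnshift c _ ^ (N + 1)) ξ i)
  rw [h1.2 i] at h3
  have h4 : D.monodromy hN ((germUnshift c _ ^ (N + 1)) ξ i) = (germUnshift c _ ^ N) ξ i := by
    rw [pow_succ', Module.End.mul_apply]
    exact h2.2 i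
  rw [h4] at h3
  exact h3

theorem chain_nodeValues {c : ℂ} (hc : c ≠ 0)
    {ξ : ℕ →₀ C(Icc (-((N : ℝ) + D.τ)) 0, Fin n → ℂ)} (h : ξ ∈ chains (D.monodromy hN) c) :
    coeffMap (nodeValues n k (D.one_le_delay hN)) ξ =
      coeffMap (endInner n k : Pieces k n →ₗ[ℂ] (Fin k → Fin n → ℂ))
          (coeffMap (restrictPieces n k (D.one_le_delay hN)) ξ) +
        coeffMap (endOuter n k : Pieces k n →ₗ[ℂ] (Fin k → Fin n → ℂ))
          (germUnshift c _ (coeffMap (restrictPieces n k (D.one_le_delay hN)) ξ)) := by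
  rw [← coeffMap_germUnshift hc]
  ext i : 1
  have h1 := germUnshift_mem_chains hc h
  have h2 := D.nodeValues_timeOneMap (k := k) (D.one_le_delay hN) (germUnshift c _ ξ i)
  have h3 : D.timeOneMap (D.one_le_delay hN) (germUnshift c _ ξ i) = ξ i := h1.2 i
  rw [h3] at h2
  exact h2

/-- On [-1-j, -j] a chain shows the restriction to [-1, 0] of the chain divided by z^j, which
vanishes together with that of the chain. -/
theorem chain_eq_zero {c : ℂ} (hc : c ≠ 0)
    {ξ : ℕ →₀ C(Icc (-((N : ℝ) + D.τ)) 0, Fin n → ℂ)} (h : ξ ∈ chains (D.monodromy hN) c)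
    (h0 : coeffMap (restrictPieces n k (D.one_le_delay hN)) ξ = 0) : ξ = 0 := by
  ext i : 1
  refine hist_ext (D.one_le_delay hN) fun t ht => ?_
  obtain ⟨x, j, rfl⟩ := exists_piecePt_sub (k := k) ht.2
  have h1 := D.hist_timeOneMap_pow (D.one_le_delay hN) ((germUnshift c _ ^ j) ξ i) j
    (piecePt_mem x).2 ht.1
  have h2 : (D.timeOneMap (D.one_le_delay hN) ^ j) ((germUnshift c _ ^ j) ξ i) = ξ i :=
    (germUnshift_pow_mem_chains hc h j).2 i
  have h3 := coeffMap_germUnshift_pow hc (restrictPieces n k (D.one_le_delay hN)) j ξ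
  rw [h0, map_zero] at h3
  have h4 := congrArg (fun w : Pieces k n => w x) (DFunLike.congr_fun h3 i)
  rw [h2] at h1
  rw [h1]
  exact h4

/-- `W (j + 1)` prescribes the chain on [-1-j, -j], and `W 0` the period that M must produce. `hend`
allows the gluing, `hW` makes M produce `W 0`, and `hshift` is then the chain relation on every
period. -/
theorem exists_chain {c : ℂ} {W : ℕ → ℕ →₀ Pieces k n}
    (hshift : ∀ j, germShift c _ (W (j + 1)) = W j)
    (hend : ∀ j i, startValues n k (W j i) = endInner n k (W j i) + endOuter n k (W (j + 1) i))
    (hW : ∀ i, W 0 i = D.initial k (startValues n k (W 0 i)) +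
      (D.volterraNear k (W N i) + D.volterraFar k (W (N + 1) i))) :
    ∃ ξ ∈ chains (D.monodromy hN) c,
      coeffMap (restrictPieces n k (D.one_le_delay hN)) ξ = W 1 := by
  have hd := D.one_le_delay hN
  have hin : ∀ i j, ∀ l : Fin k, l ≠ 0 → W j i (l, 0) = W j i (l - 1, 1) := fun i j =>
    ((eq_endInner_add_endOuter_iff _ _ _).1 (hend j i)).1
  have hout : ∀ i j, W j i (0, 0) = W (j + 1) i (0 - 1, 1) := fun i j =>
    ((eq_endInner_add_endOuter_iff _ _ _).1 (hend j i)).2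
  have hglue : ∀ i, ∃ f : ℝ → Fin n → ℂ, ContinuousOn f (Iic 0) ∧
      ∀ (j : ℕ) x, f (piecePt k x - j) = W (j + 1) i x := fun i =>
    exists_glue (y := fun j => W (j + 1) i) (fun j => hin i (j + 1)) fun j => hout i (j + 1)
  choose f hfc hf using hglue
  let g : ℕ → C(Icc (-((N : ℝ) + D.τ)) 0, Fin n → ℂ) := fun i =>
    ⟨fun θ => f i θ, (hfc i).comp_continuous continuous_subtype_val fun θ => θ.2.2⟩
  have hg : ∀ i, ∀ t ∈ Icc (-((N : ℝ) + D.τ)) 0, hist (D.one_le_delay hN) (g i) t = f i t :=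
    fun i t ht => hist_of_mem _ _ ht
  let ξ : ℕ →₀ C(Icc (-((N : ℝ) + D.τ)) 0, Fin n → ℂ) :=
    -- The history interval meets only the N + 1 periods j = 0, …, N, so finitely many finite
    -- supports suffice.
    Finsupp.onFinset ((Finset.range (N + 1)).biUnion fun j => (W (j + 1)).support) g fun i hi => by
      by_contra hmem
      refine hi (hist_ext (D.one_le_delay hN) fun t ht => ?_)
      obtain ⟨x, j, rfl⟩ := exists_piecePt_sub (k := k) ht.2
      have hj := D.le_of_le_piecePt_sub ht.1
      have h1 : W (j + 1) i = 0 := by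
        by_contra h0
        exact hmem (Finset.mem_biUnion.2 ⟨j, Finset.mem_range.2 (Nat.lt_succ_iff.2 hj),
          Finsupp.mem_support_iff.2 h0⟩)
      rw [hg i _ ht, hf, h1]
      rfl
  have hξ : ∀ i (j : ℕ) x, -((N : ℝ) + D.τ) ≤ piecePt k x - j →
      hist (D.one_le_delay hN) (ξ i) (piecePt k x - j) = W (j + 1) i x := fun i j x h => by
    have hj : (0 : ℝ) ≤ j := Nat.cast_nonneg j
    rw [← hf]
    exact hg i _ ⟨h, by linarith [(piecePt_mem x).2]⟩
  have hξ0 : ∀ i x, hist (D.one_le_delay hN) (ξ i) (piecePt k x) = W 1 i x := fun i x => by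
    have := hξ i 0 x (by push_cast; linarith [(piecePt_mem x).1])
    rwa [Nat.cast_zero, sub_zero] at this
  have hτ := D.τ_mem
  have hM : ∀ i, restrictPieces n k (D.one_le_delay hN) (D.monodromy hN (ξ i)) = W 0 i := by
    intro i
    refine D.restrictPieces_monodromy_eq hN (fun x => ?_) (fun x hx => ?_) (hW i) (hin i 0) ?_
    · have h1 : ((N - 1 : ℕ) : ℝ) = (N : ℝ) - 1 := by
        rw [Nat.cast_sub hN, Nat.cast_one]
      have := hξ i (N - 1) x (by rw [h1]; linarith [(piecePt_mem x).1, hτ.1])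
      rwa [h1, Nat.sub_add_cancel hN] at this
    · exact hξ i N x hx
    · rw [hout i 0, ← hξ0, piecePt_last]
  refine ⟨ξ, mem_chains.2 fun i => hist_ext (D.one_le_delay hN) fun t ht => ?_, ?_⟩
  · obtain ⟨x, j, rfl⟩ := exists_piecePt_sub (k := k) ht.2
    have h1 : W j i x = c • W (j + 1) i x + W (j + 1) (i + 1) x := by
      rw [← hshift j]
      rfl
    rw [hist_add, hist_smul, hξ _ _ _ ht.1, hξ _ _ _ ht.1, ← h1]
    rcases j with _ | j
    · rw [Nat.cast_zero, sub_zero, ← restrictPieces_apply, hM]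
    · have hj : (0 : ℝ) ≤ j := Nat.cast_nonneg j
      have h2 : piecePt k x - ((j + 1 : ℕ) : ℝ) + 1 = piecePt k x - j := by
        push_cast
        ring
      have h3 : piecePt k x - ((j + 1 : ℕ) : ℝ) ≤ -1 := by
        push_cast
        linarith [(piecePt_mem x).2]
      rw [monodromy, D.hist_timeOneMap_of_le _ _ ⟨ht.1, h3⟩, h2, hξ]
      rw [← h2]
      linarith [ht.1]
  · ext i : 1
    exact Pieces.ext fun x => hξ0 i x

/-- The node values carry chains bijectively onto the kernel of the germ of `charOp`. Node values
determine the newest period through the pencil and the older ones by division by z; conversely, a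
kernel element extends to all periods in that way. -/
theorem rank_maxGenEigenspace_monodromy {c : ℂ} (hc : c ≠ 0)
    (hu : IsUnit (D.pencil k (c⁻¹ ^ N) (c⁻¹ ^ (N + 1)))) {d : ℕ}
    (hd : analyticOrderAt (fun z : ℂ => (D.charOp k (z⁻¹ ^ N) (z⁻¹ ^ (N + 1)) z⁻¹).det) c = d) :
    Module.rank ℂ ((D.monodromy hN).maxGenEigenspace c) = d := by
  have hp := analyticAt_inv_pow hc N
  have hq := analyticAt_inv_pow hc (N + 1)
  have hi : AnalyticAt ℂ (fun z : ℂ => z⁻¹) c := (analyticAt_id (𝕜 := ℂ) (z := c)).inv hc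
  refine rank_maxGenEigenspace_of_chains (D.analyticAt_charOp hp hq hi hu) hd
    (nodeValues n k (D.one_le_delay hN)) (fun ξ h => ?_) (fun ξ h h0 => ?_) fun v hv => ?_
  · rw [D.germAction_charOp hc hp hq hu, ← D.chain_restrictPieces hN hc hu h,
      ← D.chain_nodeValues hN hc h, sub_self]
  · refine D.chain_eq_zero (k := k) hN hc h ?_
    have h1 := D.chain_restrictPieces (k := k) hN hc hu h
    rw [h0] at h1
    rw [h1, germSolution, map_zero, map_zero]
  · rw [D.germAction_charOp hc hp hq hu, sub_eq_zero] at hv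
    set ω := D.germSolution k (fun z => z⁻¹ ^ N) (fun z => z⁻¹ ^ (N + 1)) c v with hω
    have hω1 := (D.eq_germSolution_monodromy_iff hc hu).1 hω
    have hst : coeffMap (startValues n k : Pieces k n →ₗ[ℂ] (Fin k → Fin n → ℂ)) ω = v := by
      ext i : 1
      have h1 := DFunLike.congr_fun hω1 i
      have h2 := congrArg (startValues n k) h1
      refine h2.trans ?_
      simp only [Finsupp.add_apply, coeffMap_apply, ContinuousLinearMap.coe_coe, map_add,
        startValues_initial, startValues_volterraNear, startValues_volterraFar, add_zero]
    -- `W j` is z^{1-j} ω, so that ω itself sits on the newest period of the history, and z ω on the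
    -- period to be produced.
    let W : ℕ → ℕ →₀ Pieces k n := fun j => (germUnshift c _ ^ j) (germShift c _ ω)
    have hWs : ∀ j, W (j + 1) = (germUnshift c _ ^ j) ω := fun j => by
      simp only [W]
      rw [pow_succ, Module.End.mul_apply, germUnshift_germShift hc]
    have hWu : ∀ j, W (j + 1) = germUnshift c _ (W j) := fun j => by
      simp only [W]
      rw [pow_succ', Module.End.mul_apply]
    have hshift : ∀ j, germShift c _ (W (j + 1)) = W j := fun j => by
      rw [hWu, germShift_germUnshift hc]
    have hend : ∀ j, coeffMap (startValues n k : Pieces k n →ₗ[ℂ] (Fin k → Fin n → ℂ)) (W j) =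
        coeffMap (endInner n k : Pieces k n →ₗ[ℂ] (Fin k → Fin n → ℂ)) (W j) +
        coeffMap (endOuter n k : Pieces k n →ₗ[ℂ] (Fin k → Fin n → ℂ)) (W (j + 1)) := by
      intro j
      -- The kernel condition is the case j = 1. Multiplying it by z gives j = 0, and dividing by z
      -- gives every later case.
      induction j with
      | zero =>
        have h1 : W 0 = germShift c _ ω := rfl
        have h2 : W 1 = ω := hWs 0
        rw [zero_add, h2, h1, coeffMap_germShift, hst, hv, map_add, coeffMap_germShift,
          ← coeffMap_germShift, ← coeffMap_germShift, germShift_germUnshift hc]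
      | succ j ih =>
        rw [hWu j, hWu (j + 1), coeffMap_germUnshift hc, ih, map_add, coeffMap_germUnshift hc,
          coeffMap_germUnshift hc]
    obtain ⟨ξ, hξ, hξ1⟩ := D.exists_chain (k := k) hN (W := W) hshift
      (fun j i => DFunLike.congr_fun (hend j) i) (fun i => by
        have h1 : W 0 = coeffMap (D.initial k : (Fin k → Fin n → ℂ) →ₗ[ℂ] Pieces k n)
            (coeffMap (startValues n k : Pieces k n →ₗ[ℂ] (Fin k → Fin n → ℂ)) (W 0)) +
            (coeffMap (D.volterraNear k : Pieces k n →ₗ[ℂ] Pieces k n) (W N) +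
              coeffMap (D.volterraFar k : Pieces k n →ₗ[ℂ] Pieces k n) (W (N + 1))) := by
          rw [← hWs, ← hWs] at hω1
          have h2 : W 0 = germShift c _ ω := rfl
          conv_lhs => rw [h2, hω1]
          rw [h2, map_add, map_add, ← coeffMap_germShift, ← coeffMap_germShift,
            ← coeffMap_germShift, hshift, hshift, coeffMap_germShift c
              (startValues n k : Pieces k n →ₗ[ℂ] (Fin k → Fin n → ℂ)), hst]
        exact DFunLike.congr_fun h1 i)
    refine ⟨ξ, hξ, ?_⟩
    have h1 : W 1 = ω := hWs 0
    rw [← hst, ← h1, ← hξ1]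
    ext i : 1
    rfl

end Monodromy

/-! ### Multiplicities for the instantaneous system -/

variable (k) in
/-- The solution operator of `x' = A(t) x` on `[-1, 0]`. -/
def flowPieces : (Fin n → ℂ) →ₗ[ℂ] Pieces k n where
  toFun v := Pieces.mk (fun x => D.fund (piecePt k x) (D.fundInv (-1) v))
    ((D.continuous_fund.comp continuous_piecePt).clm_apply continuous_const)
  map_add' v w := Pieces.ext fun x => by simp
  map_smul' c v := Pieces.ext fun x => by simp

theorem flowPieces_apply (v : Fin n → ℂ) (x : Fin k × unitInterval) :
    D.flowPieces k v x = D.fund (piecePt k x) (D.fundInv (-1) v) := rfl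

theorem flowPieces_eq_initial (v : Fin n → ℂ) :
    D.flowPieces k v = D.initial k (startValues n k (D.flowPieces k v)) := by
  refine Pieces.ext fun x => ?_
  rw [initial_apply, startValues_apply, flowPieces_apply, flowPieces_apply, piecePt_zero,
    fundInv_fund]

theorem propagator_zero_apply (v : Fin n → ℂ) :
    D.propagator 0 0 (-1) v = D.fund 0 (D.fundInv (-1) v) := by
  rw [D.propagator_apply 0 le_rfl (by norm_num) le_rfl]
  simp

theorem isUnit_pencil_zero : IsUnit (D.pencil k 0 0) := by
  have : D.pencil k 0 0 = 1 := by
    rw [pencil, zero_smul, zero_smul, add_zero, sub_zero]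
    rfl
  rw [this]
  exact isUnit_one

theorem eq_germSolution_zero_iff {c : ℂ} {v : ℕ →₀ (Fin k → Fin n → ℂ)} {ω : ℕ →₀ Pieces k n} :
    ω = D.germSolution k (fun _ => 0) (fun _ => 0) c v ↔
      ω = coeffMap (D.initial k : (Fin k → Fin n → ℂ) →ₗ[ℂ] Pieces k n) v := by
  have h : ∀ T : Pieces k n →L[ℂ] Pieces k n, germAction c (fun _ => (0 : ℂ) • T) ω = 0 := by
    intro T
    rw [germAction_const]
    ext i : 1
    simp
  rw [D.eq_germSolution_iff analyticAt_const analyticAt_const D.isUnit_pencil_zero, h, h, add_zero,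
    add_zero]

theorem startValues_flowPieces_propagator (v : Fin n → ℂ) :
    startValues n k (D.flowPieces k (D.propagator 0 0 (-1) v)) =
      endInner n k (D.flowPieces k (D.propagator 0 0 (-1) v)) +
        endOuter n k (D.flowPieces k v) := by
  rw [eq_endInner_add_endOuter_iff]
  refine ⟨fun l hl => ?_, ?_⟩
  · rw [startValues_apply, flowPieces_apply, flowPieces_apply, piecePt_end hl]
  · rw [startValues_apply, flowPieces_apply, flowPieces_apply, piecePt_first, piecePt_last,
      fund_fundInv, propagator_zero_apply]

theorem eq_flowPieces {w : Pieces k n} (hw : w = D.initial k (startValues n k w))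
    (hin : ∀ l : Fin k, l ≠ 0 → w (l, 0) = w (l - 1, 1)) : w = D.flowPieces k (w (0, 0)) := by
  refine Pieces.ext fun x => ?_
  have := D.eq_variation_of_pieces (w := w) (g := fun _ => 0) (by simp) (fun x => by
    conv_lhs => rw [hw]
    simp [initial_apply, startValues_apply]) hin x
  simpa [flowPieces_apply] using this

/-- The chain correspondence without delay terms: a chain of initial vectors at -1 is propagated to
the nodes, and the feedback condition says that the monodromy matrix acts as multiplication by z. -/
theorem rank_maxGenEigenspace_propagator {c : ℂ} (hc : c ≠ 0) {d : ℕ}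
    (hd : analyticOrderAt (fun z : ℂ => (D.charOp k 0 0 z⁻¹).det) c = d) :
    Module.rank ℂ (Module.End.maxGenEigenspace (D.propagator 0 0 (-1)) c) = d := by
  have h00 : AnalyticAt ℂ (fun _ : ℂ => (0 : ℂ)) c := analyticAt_const
  have hu : IsUnit (D.pencil k 0 0) := D.isUnit_pencil_zero
  have hi : AnalyticAt ℂ (fun z : ℂ => z⁻¹) c := (analyticAt_id (𝕜 := ℂ) (z := c)).inv hc
  have hres : ∀ ξ : ℕ →₀ (Fin n → ℂ), coeffMap (D.flowPieces k) ξ =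
      D.germSolution k (fun _ => 0) (fun _ => 0) c (coeffMap
        ((startValues n k : Pieces k n →ₗ[ℂ] (Fin k → Fin n → ℂ)) ∘ₗ D.flowPieces k) ξ) := by
    intro ξ
    rw [eq_germSolution_zero_iff]
    ext i : 1
    exact D.flowPieces_eq_initial (ξ i)
  refine rank_maxGenEigenspace_of_chains (D.analyticAt_charOp h00 h00 hi hu) hd
    ((startValues n k : Pieces k n →ₗ[ℂ] (Fin k → Fin n → ℂ)) ∘ₗ D.flowPieces k)
    (fun ξ h => ?_) (fun ξ h h0 => ?_) fun v hv => ?_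
  · rw [D.germAction_charOp hc h00 h00 hu, ← hres, sub_eq_zero, ← coeffMap_germUnshift hc]
    ext i : 1
    have h1 := (germUnshift_mem_chains hc h).2 i
    have h2 := D.startValues_flowPieces_propagator (k := k) (germUnshift c _ ξ i)
    rw [h1] at h2
    exact h2
  · ext i : 1
    have h1 := congrFun (DFunLike.congr_fun h0 i) 0
    have h2 : D.flowPieces k (ξ i) (0, 0) = 0 := h1
    rw [flowPieces_apply, piecePt_first, fund_fundInv] at h2
    exact h2
  · rw [D.germAction_charOp hc h00 h00 hu, sub_eq_zero] at hv
    set ω := D.germSolution k (fun _ => 0) (fun _ => 0) c v with hω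
    have hω1 := D.eq_germSolution_zero_iff.1 hω
    have hst : ∀ i, startValues n k (ω i) = v i := fun i => by
      rw [hω1]
      exact D.startValues_initial (v i)
    have hvi : ∀ i, startValues n k (ω i) =
        endInner n k (ω i) + endOuter n k (germUnshift c _ ω i) := fun i => by
      rw [hst]
      exact DFunLike.congr_fun hv i
    let T : Pieces k n →ₗ[ℂ] (Fin n → ℂ) := (Pieces.eval (0, 0) : Pieces k n →L[ℂ] _)
    have hflow : ∀ i, ω i = D.flowPieces k (ω i (0, 0)) := fun i =>
      D.eq_flowPieces (by
        rw [hst]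
        exact DFunLike.congr_fun hω1 i)
        ((eq_endInner_add_endOuter_iff _ _ _).1 (hvi i)).1
    have hflow' : coeffMap (D.flowPieces k) (coeffMap T ω) = ω := by
      ext i : 1
      exact (hflow i).symm
    refine ⟨coeffMap T ω, ?_, ?_⟩
    · rw [mem_chains_iff_coeffMap]
      have h1 : coeffMap T ω =
          coeffMap (D.propagator 0 0 (-1)) (germUnshift c _ (coeffMap T ω)) := by
        ext i : 1
        have h2 := ((eq_endInner_add_endOuter_iff _ _ _).1 (hvi i)).2
        rw [startValues_apply] at h2
        refine h2.trans ?_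
        have h3 := coeffMap_germUnshift hc (D.flowPieces k) (coeffMap T ω)
        rw [hflow'] at h3
        rw [← h3, coeffMap_apply, coeffMap_apply, flowPieces_apply, piecePt_last,
          propagator_zero_apply]
      have h4 := congrArg (germShift c _) h1
      rw [← coeffMap_germShift c (D.propagator 0 0 (-1)), germShift_germUnshift hc] at h4
      exact h4.symm
    · ext i : 1
      rw [← hst, hflow i]
      rfl

end PeriodicDDE

end LargeDelay
end

noncomputable section

namespace LargeDelay

set_option linter.unusedSectionVars false

namespace PeriodicDDE

variable {n : ℕ} (D : PeriodicDDE n) {k : ℕ} [NeZero k]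

/-! ### Finite order -/

/-- Without delay and feedback the first piece starts at 0, and matching at the nodes passes zero on
to all the others. -/
theorem eq_zero_of_charOp_zero {v : Fin k → Fin n → ℂ} (h : D.charOp k 0 0 0 v = 0) : v = 0 := by
  set w := Ring.inverse (D.pencil k 0 0) (D.initial k v) with hw
  have h1 := (D.eq_inverse_pencil_iff D.isUnit_pencil_zero v w).1 hw
  rw [zero_smul, zero_smul, add_zero, add_zero] at h1
  have h2 : v - (endInner n k w + (0 : ℂ) • endOuter n k w) = 0 := h
  have hst : startValues n k w = v := by rw [h1, startValues_initial]
  have h3 : ∀ l, w (l, 0) = (if l = 0 then (0 : ℂ) else 1) • w (l - 1, 1) := fun l => by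
    rw [← end_apply, ← sub_eq_zero.1 h2, ← hst, startValues_apply]
  have h4 : w (0, 0) = 0 := by rw [h3 0, if_pos rfl, zero_smul]
  have h5 := D.eq_flowPieces (w := w) (by rw [hst]; exact h1) fun l hl => by
    rw [h3 l, if_neg hl, one_smul]
  rw [h4, map_zero] at h5
  rw [← hst, h5, map_zero]

theorem det_charOp_zero_ne_zero : (D.charOp k 0 0 0).det ≠ 0 := by
  intro h
  obtain ⟨v, hv, hv0⟩ :=
    Submodule.exists_mem_ne_zero_of_ne_bot (LinearMap.bot_lt_ker_of_det_eq_zero h).ne'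
  exact hv0 (D.eq_zero_of_charOp_zero hv)

/-- The identity theorem on the closed disc: an infinite order anywhere would force the determinant
to vanish at the centre, where p = q = 0. -/
theorem analyticOrderAt_det_charOp_ne_top {p q : ℂ → ℂ} {ρ : ℝ}
    (hp : ∀ z, AnalyticAt ℂ p z) (hq : ∀ z, AnalyticAt ℂ q z) (hp0 : p 0 = 0) (hq0 : q 0 = 0)
    (hu : ∀ z, z ≠ 0 → ‖z‖ ≤ ρ → IsUnit (D.pencil k (p z) (q z))) {z : ℂ} (hz : ‖z‖ ≤ ρ) :
    analyticOrderAt (fun z => (D.charOp k (p z) (q z) z).det) z ≠ ⊤ := by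
  have hu' : ∀ z, ‖z‖ ≤ ρ → IsUnit (D.pencil k (p z) (q z)) := fun z hz => by
    rcases eq_or_ne z 0 with rfl | h
    · rw [hp0, hq0]
      exact D.isUnit_pencil_zero
    · exact hu z h hz
  have hA : AnalyticOnNhd ℂ (fun z => (D.charOp k (p z) (q z) z).det) (Metric.closedBall 0 ρ) :=
    fun z hz => analyticAt_det (D.analyticAt_charOp (hp z) (hq z) analyticAt_id
      (hu' z (mem_closedBall_zero_iff.1 hz)))
  have h0 : (0 : ℂ) ∈ Metric.closedBall (0 : ℂ) ρ :=
    mem_closedBall_zero_iff.2 (by rw [norm_zero]; exact (norm_nonneg z).trans hz)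
  refine hA.analyticOrderAt_ne_top_of_isPreconnected
    (convex_closedBall (0 : ℂ) ρ).isPreconnected h0 (mem_closedBall_zero_iff.2 hz) ?_
  rw [(hA 0 h0).analyticOrderAt_eq_zero.2]
  · exact ENat.zero_ne_top
  · simp only [hp0, hq0]
    exact D.det_charOp_zero_ne_zero

/-- Both functions are the determinant in the variable ζ, composed with ζ = e^{-ν} or ζ = 1/z. These
maps have nonzero derivative and meet at the same ζ. -/
theorem exists_analyticOrderAt_eq {p q : ℂ → ℂ} {ρ : ℝ}
    (hp : ∀ z, AnalyticAt ℂ p z) (hq : ∀ z, AnalyticAt ℂ q z) (hp0 : p 0 = 0) (hq0 : q 0 = 0)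
    (hu : ∀ z, z ≠ 0 → ‖z‖ ≤ ρ → IsUnit (D.pencil k (p z) (q z))) {μ : ℂ}
    (hμ : Real.exp (-μ.re) ≤ ρ) :
    ∃ m : ℕ, analyticOrderAt (fun ν => (D.charOp k (p (Complex.exp (-ν))) (q (Complex.exp (-ν)))
        (Complex.exp (-ν))).det) μ = m ∧
      analyticOrderAt (fun z => (D.charOp k (p z⁻¹) (q z⁻¹) z⁻¹).det) (Complex.exp μ) = m := by
  have hn : ‖Complex.exp (-μ)‖ ≤ ρ := by rwa [Complex.norm_exp, Complex.neg_re]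
  obtain ⟨m, hm⟩ := ENat.ne_top_iff_exists.1
    (D.analyticOrderAt_det_charOp_ne_top hp hq hp0 hq0 hu hn)
  refine ⟨m, ?_, ?_⟩
  · have h1 : HasDerivAt (fun ν : ℂ => Complex.exp (-ν)) (Complex.exp (-μ) * -1) μ :=
      (hasDerivAt_neg μ).cexp
    have h2 := analyticOrderAt_comp_of_deriv_ne_zero
      (f := fun z => (D.charOp k (p z) (q z) z).det) (z₀ := μ)
      (g := fun ν : ℂ => Complex.exp (-ν)) (analyticAt_id.neg.cexp) (by
        rw [h1.deriv]
        simp [Complex.exp_ne_zero])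
    exact h2.trans hm.symm
  · have hc := Complex.exp_ne_zero μ
    have h2 := analyticOrderAt_comp_of_deriv_ne_zero
      (f := fun z => (D.charOp k (p z) (q z) z).det) (z₀ := Complex.exp μ)
      (g := fun z : ℂ => z⁻¹) ((analyticAt_id (𝕜 := ℂ)).inv hc) (by
        rw [(hasDerivAt_inv hc).deriv]
        simp [hc])
    rw [← Complex.exp_neg] at h2
    exact h2.trans hm.symm

/-! ### The spectra -/

theorem exp_neg_mul_exp_tau (N : ℕ) (ν : ℂ) :
    Complex.exp (-(N + D.τ) * ν) * Complex.exp (ν * D.τ) = Complex.exp (-ν) ^ N := by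
  rw [← Complex.exp_add, ← Complex.exp_nat_mul]
  ring_nf

theorem exp_neg_mul_exp_tau_sub (N : ℕ) (ν : ℂ) :
    Complex.exp (-(N + D.τ) * ν) * Complex.exp (ν * (D.τ - 1)) = Complex.exp (-ν) ^ (N + 1) := by
  rw [← Complex.exp_add, ← Complex.exp_nat_mul]
  push_cast
  ring_nf

theorem charFun_delay (N : ℕ) (ν : ℂ) : D.charFun k (ν, Complex.exp (-(N + D.τ) * ν)) =
    (D.charOp k (Complex.exp (-ν) ^ N) (Complex.exp (-ν) ^ (N + 1)) (Complex.exp (-ν))).det := by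
  rw [charFun, charOpAt, exp_neg_mul_exp_tau, exp_neg_mul_exp_tau_sub]

theorem charFun_zero (ν : ℂ) : D.charFun k (ν, 0) = (D.charOp k 0 0 (Complex.exp (-ν))).det := by
  rw [charFun, charOpAt, zero_mul, zero_mul]

section Spectra

variable {R : ℝ}

/-- The half-plane Re ν ≥ -R/(N + τ) is what bounds |e^{-(N+τ)ν}| by e^R; it lies inside Re ν ≥ -R
because N + τ ≥ 1. -/
theorem isUnit_pencil_pow (hA : supNorm D.A + R ≤ k) (hB : supNorm D.B * Real.exp (1 + R) < k)
    (hR : 0 < R) {N : ℕ} (hN : 1 ≤ N) {ν : ℂ}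
    (hν : -(R / (N + D.τ)) ≤ ν.re) :
    IsUnit (D.pencil k (Complex.exp (-ν) ^ N) (Complex.exp (-ν) ^ (N + 1))) := by
  have hd := D.one_le_delay hN
  have hd0 : 0 < (N : ℝ) + D.τ := by linarith
  rw [← D.exp_neg_mul_exp_tau, ← D.exp_neg_mul_exp_tau_sub]
  refine D.isUnit_pencil hA hB ?_ ?_
  · have : R / (N + D.τ) ≤ R := div_le_self hR.le hd
    linarith
  · rw [Complex.norm_exp, Real.exp_le_exp]
    have h1 : (-((N : ℂ) + D.τ) * ν).re = -((N + D.τ) * ν.re) := by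
      simp [Complex.mul_re]
      ring
    rw [h1]
    have h2 := mul_le_mul_of_nonneg_left hν hd0.le
    rw [mul_neg, mul_div_cancel₀ _ hd0.ne'] at h2
    linarith

theorem exists_rank_monodromy (hA : supNorm D.A + R ≤ k) (hB : supNorm D.B * Real.exp (1 + R) < k)
    (hR : 0 < R) {N : ℕ} (hN : 1 ≤ N) {μ : ℂ}
    (hμ : -(R / (N + D.τ)) ≤ μ.re) :
    ∃ m : ℕ, analyticOrderAt (fun ν : ℂ => D.charFun k (ν, Complex.exp (-(N + D.τ) * ν))) μ = m ∧
      Module.rank ℂ ((D.monodromy hN).maxGenEigenspace (Complex.exp μ)) = m := by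
  have hN0 : N ≠ 0 := by omega
  -- Each nonzero point of the disc of radius e^{R/(N+τ)} is e^{-ν} with ν = -log z in the
  -- admissible half-plane.
  have hu : ∀ z : ℂ, z ≠ 0 → ‖z‖ ≤ Real.exp (R / (N + D.τ)) →
      IsUnit (D.pencil k (z ^ N) (z ^ (N + 1))) := by
    intro z hz hn
    have h1 : Complex.exp (-(-Complex.log z)) = z := by rw [neg_neg, Complex.exp_log hz]
    have h2 := D.isUnit_pencil_pow hA hB hR hN (ν := -Complex.log z) (by
      rw [Complex.neg_re, Complex.log_re, neg_le_neg_iff]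
      exact (Real.log_le_iff_le_exp (norm_pos_iff.2 hz)).2 hn)
    rwa [h1] at h2
  obtain ⟨m, h1, h2⟩ := D.exists_analyticOrderAt_eq (k := k) (p := fun z => z ^ N)
    (q := fun z => z ^ (N + 1)) (fun z => analyticAt_id.pow N) (fun z => analyticAt_id.pow (N + 1))
    (zero_pow hN0) (zero_pow (Nat.succ_ne_zero N)) hu (μ := μ)
    (Real.exp_le_exp.2 (by linarith))
  refine ⟨m, ?_, ?_⟩
  · simp only [charFun_delay]
    exact h1
  · refine D.rank_maxGenEigenspace_monodromy (k := k) hN (Complex.exp_ne_zero μ) ?_ h2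
    rw [← Complex.exp_neg]
    exact D.isUnit_pencil_pow hA hB hR hN hμ

end Spectra

variable (k) in
theorem exists_rank_propagator (μ : ℂ) :
    ∃ m : ℕ, analyticOrderAt (fun ν : ℂ => D.charFun k (ν, 0)) μ = m ∧
      Module.rank ℂ (Module.End.maxGenEigenspace (D.propagator 0 0 (-1)) (Complex.exp μ)) = m := by
  obtain ⟨m, h1, h2⟩ := D.exists_analyticOrderAt_eq (k := k) (p := fun _ => 0)
    (q := fun _ => 0) (fun z => analyticAt_const) (fun z => analyticAt_const) rfl rfl
    (fun _ _ _ => D.isUnit_pencil_zero) (μ := μ) le_rfl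
  refine ⟨m, ?_, D.rank_maxGenEigenspace_propagator (Complex.exp_ne_zero μ) h2⟩
  simp only [charFun_zero]
  exact h1

/-- A nonzero generalised eigenspace already contains an eigenvector, so multiplicity zero means not
an eigenvalue. -/
theorem hasEigenvalue_iff_rank_ne_zero {X : Type} [AddCommGroup X] [Module ℂ X]
    (M : Module.End ℂ X) (c : ℂ) :
    M.HasEigenvalue c ↔ Module.rank ℂ (M.maxGenEigenspace c) ≠ 0 := by
  rw [Ne, Submodule.rank_eq_zero]
  exact (Module.End.hasUnifEigenvalue_iff_hasUnifEigenvalue_one (f := M) (μ := c) (k := ⊤)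
    (by simp)).symm

section Spectra

variable {R : ℝ}

theorem monodromy_spectrum (hA : supNorm D.A + R ≤ k) (hB : supNorm D.B * Real.exp (1 + R) < k)
    (hR : 0 < R) {N : ℕ} (hN : 1 ≤ N) {μ : ℂ}
    (hμ : -(R / (N + D.τ)) ≤ μ.re) :
    (D.IsFloquetExponent hN μ ↔ D.charFun k (μ, Complex.exp (-(N + D.τ) * μ)) = 0) ∧
    FiniteDimensional ℂ ((D.monodromy hN).maxGenEigenspace (Complex.exp μ)) ∧
    analyticOrderAt (fun ν : ℂ => D.charFun k (ν, Complex.exp (-(N + D.τ) * ν))) μ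
      = (Module.finrank ℂ ((D.monodromy hN).maxGenEigenspace (Complex.exp μ)) : ℕ∞) := by
  obtain ⟨m, h1, h2⟩ := D.exists_rank_monodromy (k := k) hA hB hR hN hμ
  obtain ⟨h3, h4⟩ := finrank_of_rank_eq_natCast
    (X := (D.monodromy hN).maxGenEigenspace (Complex.exp μ)) h2
  refine ⟨?_, h3, by rw [h1, h4]⟩
  have hu := D.isUnit_pencil_pow (k := k) hA hB hR hN hμ
  have han : AnalyticAt ℂ (fun ν : ℂ => D.charFun k (ν, Complex.exp (-(N + D.τ) * ν))) μ := by
    simp only [charFun_delay]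
    have he : AnalyticAt ℂ (fun ν : ℂ => Complex.exp (-ν)) μ := analyticAt_id.neg.cexp
    exact analyticAt_det (D.analyticAt_charOp (he.pow N) (he.pow (N + 1)) he hu)
  rw [IsFloquetExponent, hasEigenvalue_iff_rank_ne_zero, h2, ← han.analyticOrderAt_ne_zero, h1]
  simp

theorem mem_instantaneousSpectrum_iff (hA : supNorm D.A + R ≤ k) (hB : supNorm D.B * Real.exp (1 + R) < k)
    {μ : ℂ} (hμ : -R ≤ μ.re) :
    μ ∈ D.instantaneousSpectrum ↔ D.charFun k (μ, 0) = 0 := by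
  have hu := D.isUnit_pencil (k := k) hA hB (z := 0) hμ (by rw [norm_zero]; positivity)
  rw [D.charFun_eq_zero_iff hu]
  constructor
  · rintro ⟨y, h1, h2, h3, h4⟩
    exact ⟨y, ⟨h1, fun t ht => by simpa using h2 t ht, h3⟩, h4⟩
  · rintro ⟨y, ⟨h1, h2, h3⟩, h4⟩
    exact ⟨y, h1, fun t ht => by simpa using h2 t ht, h3, h4⟩

/-- The boundary value problem at μ = iω and z = e^{-γ-iφ}; the condition γ ≥ -R is exactly |z| ≤
e^R. -/
theorem mem_asymptoticContinuousSpectrum_iff (hA : supNorm D.A + R ≤ k) (hB : supNorm D.B * Real.exp (1 + R) < k)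
    (hR : 0 < R) {γ ω : ℝ} (hγ : -R ≤ γ)
    (hω : ω ∈ Ico (-Real.pi) Real.pi) :
    (γ + Complex.I * ω : ℂ) ∈ D.asymptoticContinuousSpectrum ↔
      ∃ ϕ : ℝ, D.charFun k (Complex.I * ω, Complex.exp (-γ - Complex.I * ϕ)) = 0 := by
  have hre : (γ + Complex.I * ω : ℂ).re = γ := by simp
  have him : (γ + Complex.I * ω : ℂ).im = ω := by simp
  have hu : ∀ ϕ : ℝ, _ := fun ϕ => D.charFun_eq_zero_iff (D.isUnit_pencil (k := k) hA hB
    (μ := Complex.I * ω) (z := Complex.exp (-γ - Complex.I * ϕ)) (by simp [hR.le]) (by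
      rw [Complex.norm_exp, Real.exp_le_exp]
      simp
      linarith))
  simp only [hu]
  rw [asymptoticContinuousSpectrum, Set.mem_ofPred_eq, hre, him]
  constructor
  · rintro ⟨-, ϕ, y, h1, h2, h3, h4⟩
    exact ⟨ϕ, y, ⟨h1, h2, h3⟩, h4⟩
  · rintro ⟨ϕ, y, ⟨h1, h2, h3⟩, h4⟩
    exact ⟨hω, ϕ, y, h1, h2, h3, h4⟩

end Spectra

end PeriodicDDE

end LargeDelay
end

/-! ### The characteristic function theorem -/

theorem mainTheorem2 {n : ℕ} (D : LargeDelay.PeriodicDDE n) (R : ℝ) (hR : 0 < R)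
    (k : ℕ) (hk : D.subdivisionBound R < k) :
    -- unique solvability of the integral equation
    (∀ μ z : ℂ, -R ≤ μ.re → ‖z‖ ≤ Real.exp R → ∀ v : Fin k → Fin n → ℂ,
      ∃ y : ℝ → Fin n → ℂ, D.IsShootingSolution k μ z v y ∧
        ∀ y' : ℝ → Fin n → ℂ, D.IsShootingSolution k μ z v y' → Set.EqOn y' y (Set.Icc (-1) 0)) ∧
    ∃ (Δ : ℂ → ℂ → Matrix (Fin k × Fin n) (Fin k × Fin n) ℂ) (h : ℂ × ℂ → ℂ),
      -- `h` is the determinant of the characteristic matrix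
      (∀ μ z : ℂ, -R ≤ μ.re → ‖z‖ ≤ Real.exp R →
        D.IsCharacteristicMatrix k μ z (Δ μ z) ∧ h (μ, z) = (Δ μ z).det) ∧
      -- `h` is holomorphic on a neighbourhood of the closed domain
      AnalyticOnNhd ℂ h ({μ : ℂ | -R ≤ μ.re} ×ˢ {z : ℂ | ‖z‖ ≤ Real.exp R}) ∧
      -- Floquet exponents of `M_N`, with multiplicities
      (∀ (N : ℕ) (hN : 1 ≤ N) (μ : ℂ), -(R / (N + D.τ)) ≤ μ.re →
        (D.IsFloquetExponent hN μ ↔ h (μ, Complex.exp (-(N + D.τ) * μ)) = 0) ∧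
        FiniteDimensional ℂ ((D.monodromy hN).maxGenEigenspace (Complex.exp μ)) ∧
        analyticOrderAt (fun ν : ℂ => h (ν, Complex.exp (-(N + D.τ) * ν))) μ
          = (Module.finrank ℂ ((D.monodromy hN).maxGenEigenspace (Complex.exp μ)) : ℕ∞)) ∧
      -- instantaneous spectrum, with multiplicities
      (∀ μ : ℂ, -R ≤ μ.re →
        (μ ∈ D.instantaneousSpectrum ↔ h (μ, 0) = 0) ∧
        analyticOrderAt (fun ν : ℂ => h (ν, 0)) μ
          = (Module.finrank ℂ
              (Module.End.maxGenEigenspace (D.propagator 0 0 (-1)) (Complex.exp μ)) : ℕ∞)) ∧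
      -- strongly unstable spectrum
      (∀ μ : ℂ, μ ∈ D.stronglyUnstableSpectrum ↔ h (μ, 0) = 0 ∧ 0 < μ.re) ∧
      -- asymptotic continuous spectrum
      (∀ γ ω : ℝ, -R ≤ γ → ω ∈ Set.Ico (-Real.pi) Real.pi →
        ((γ + Complex.I * ω : ℂ) ∈ D.asymptoticContinuousSpectrum ↔
          ∃ ϕ : ℝ, h (Complex.I * ω, Complex.exp (-γ - Complex.I * ϕ)) = 0)) := by
  have hA : LargeDelay.PeriodicDDE.supNorm D.A + R ≤ k := ((le_max_left _ _).trans_lt hk).le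
  have hB : LargeDelay.PeriodicDDE.supNorm D.B * Real.exp (1 + R) < k :=
    (le_max_right _ _).trans_lt hk
  -- Positivity of k follows from the bound with B, whose left-hand side is nonnegative.
  have hk0 : (0 : ℝ) < k := lt_of_le_of_lt
    (mul_nonneg (LargeDelay.PeriodicDDE.supNorm_nonneg D.B) (Real.exp_pos _).le) hB
  have : NeZero k := ⟨by exact_mod_cast hk0.ne'⟩
  refine ⟨fun μ z hμ hz v => D.exists_isShootingSolution (D.isUnit_pencil hA hB hμ hz) v,
    D.charMatrix k, D.charFun k, fun μ z hμ hz =>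
      ⟨D.isCharacteristicMatrix_charMatrix (D.isUnit_pencil hA hB hμ hz),
        (D.det_charMatrix μ z).symm⟩,
    fun x hx => D.analyticAt_charFun (D.isUnit_pencil hA hB hx.1 hx.2),
    fun N hN μ hμ => D.monodromy_spectrum hA hB hR hN hμ, fun μ hμ => ?_, fun μ => ?_,
    fun γ ω hγ hω => D.mem_asymptoticContinuousSpectrum_iff hA hB hR hγ hω⟩
  · obtain ⟨m, h1, h2⟩ := D.exists_rank_propagator k μ
    refine ⟨D.mem_instantaneousSpectrum_iff hA hB hμ, ?_⟩
    rw [h1, (LargeDelay.finrank_of_rank_eq_natCast h2).2]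
  · constructor
    · rintro ⟨h1, h2⟩
      exact ⟨(D.mem_instantaneousSpectrum_iff hA hB (by linarith)).1 h1, h2⟩
    · rintro ⟨h1, h2⟩
      exact ⟨(D.mem_instantaneousSpectrum_iff hA hB (by linarith)).2 h1, h2⟩
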